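/- **Theorem (Galois correspondence for covering maps of graphs of groups).** *Conventions.* A graph $\Gamma$ has vertices, oriented edges $e$ with a fixed-point-free reversal $e\mapsto\bar e$, and terminal vertices $\tau(e)$. A graph of groups $(\Gamma,\mathscr G)$ is a connected graph $\Gamma$ with a group $G_v$ for each vertex, a group $G_e=G_{\bar e}$ for each edge and monomorphisms $\iota_e\colon G_e\to G_{\tau(e)}$ for each oriented edge. Paths are sequences $g_0e_1g_1\cdots e_kg_k$ with $e_1\cdots e_k$ an edge path and the $g_i$ in the groups of the successive vertices; homotopy rel endpoints is generated by inserting or removing $e\bar e$ and by $\iota_{\bar e}(h)e\simeq e\,\iota_e(h)$ for $h\in G_e$. For a vertex $p$, $\pi_1(\Gamma,\mathscr G,p)$ is the group of homotopy classes of loops at $p$. A (non-collapsing) morphism $f\colon(\Lambda,\mathscr L)\to(\Gamma,\mathscr G)$ is a morphism of graphs sending edges to edges, with homomorphisms $f_v\colon\mathscr L_v\to\mathscr G_{f(v)}$, $f_e=f_{\bar e}\colon\mathscr L_e\to\mathscr G_{f(e)}$ and elements $\delta_e\in\mathscr G_{f(\tau(e))}$ such that $f_{\tau(e)}(\iota_e(h))=\delta_e\,\iota_{f(e)}(f_e(h))\,\delta_e^{-1}$.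 It acts on paths by $f_v$ on group elements and $e\mapsto\delta_{\bar e}f(e)\delta_e^{-1}$, and so induces $f_\sharp$ on fundamental groups. It is a covering map if it is surjective on vertices and edges, all $f_v,f_e$ are injective, and for each vertex $v$ the map $$\coprod_{\tau(e)=v}\mathscr L_v/\iota_e(\mathscr L_e)\to\coprod_{\tau(e')=f(v)}\mathscr G_{f(v)}/\iota_{e'}(\mathscr G_{e'}),\qquad([g],e)\mapsto([f_v(g)\delta_e],f(e))$$ is bijective. Two morphisms $f,f'$ are equivalent fixing a vertex $q$ if they have the same underlying morphism of graphs and there are $g_v\in\mathscr G_{f(v)}$ with $g_q=1$ and $k_e=k_{\bar e}\in\mathscr G_{f(e)}$ with $f'_v=\mathrm{ad}(g_v)f_v$, $f'_e=\mathrm{ad}(k_e^{-1})f_e$ and $\delta'_e=g_{\tau(e)}\delta_e\iota_{f(e)}(k_e)$, where $\mathrm{ad}(g)(x)=gxg^{-1}$. For pointed covering maps $\rho_i\colon(\Lambda_i,\mathscr L_i,q_i)\to(\Gamma,\mathscr G,p)$, a morphism $f\colon(\Lambda_1,\mathscr L_1,q_1)\to(\Lambda_2,\mathscr L_2,q_2)$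 is *over* $(\Gamma,\mathscr G,p)$ if $f(q_1)=q_2$ and $\rho_2f$ is equivalent to $\rho_1$ fixing $q_1$. The Bass–Serre tree $T$ has as vertices over $w$ the homotopy classes of paths from $p$ to $w$ modulo right multiplication by $G_w$, and as oriented edges over $e$ the homotopy classes of paths from $p$ to $\tau(\bar e)$ modulo right multiplication by $\iota_{\bar e}(G_e)$; the edge $[\alpha]$ over $e$ has terminal vertex $[\alpha e]$ and reversal $[\alpha e]$ over $\bar e$. The group $\pi_1(\Gamma,\mathscr G,p)$ acts on the left, and $\tilde p$ is the class of the constant path. For $H\le\pi_1(\Gamma,\mathscr G,p)$, the graph $H\backslash T$ is made a graph of groups by choosing lifts $\tilde x,\tilde e$ to $T$ of its vertices and edges (with $\tilde{\bar e}=\bar{\tilde e}$, and with $\tilde p$ as the lift of its own image $q$) and elements $t_e\in H$ with $t_e\cdot\tau(\tilde e)=\widetilde{\tau(e)}$: its vertex and edge groups are the stabilizers in $H$ of the lifts, and $\iota_e(h)=t_eht_e^{-1}$. A path in $H\backslash T$ determines the element of $H$ obtained by multiplying its group elements and the elements $t_{\bar e}t_e^{-1}$ for its oriented edges $e$. *Theorem.*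 Let $(\Gamma,\mathscr G)$ be a graph of groups and $p$ a vertex of $\Gamma$. The assignment $\rho\mapsto\rho_\sharp(\pi_1(\Lambda,\mathscr L,q))$ is an order-preserving bijective correspondence between (connected) pointed covering maps $\rho\colon(\Lambda,\mathscr L,q)\to(\Gamma,\mathscr G,p)$, up to isomorphism over $(\Gamma,\mathscr G,p)$, and subgroups of $\pi_1(\Gamma,\mathscr G,p)$, with inverse $H\mapsto H\backslash T$. Precisely: 1. For pointed covering maps $\rho_1,\rho_2$ of $(\Gamma,\mathscr G,p)$, $(\rho_1)_\sharp(\pi_1(\Lambda_1,\mathscr L_1,q_1))=(\rho_2)_\sharp(\pi_1(\Lambda_2,\mathscr L_2,q_2))$ if and only if there is an isomorphism $(\Lambda_1,\mathscr L_1,q_1)\to(\Lambda_2,\mathscr L_2,q_2)$ over $(\Gamma,\mathscr G,p)$. 2. $(\rho_1)_\sharp(\pi_1(\Lambda_1,\mathscr L_1,q_1))\le(\rho_2)_\sharp(\pi_1(\Lambda_2,\mathscr L_2,q_2))$ if and only if there is a covering map $(\Lambda_1,\mathscr L_1,q_1)\to(\Lambda_2,\mathscr L_2,q_2)$ over $(\Gamma,\mathscr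 G,p)$. 3. For every subgroup $H\le\pi_1(\Gamma,\mathscr G,p)$, choices as above exist, and for all such choices there is a covering map $r\colon(H\backslash T,q)\to(\Gamma,\mathscr G,p)$ induced by the inclusion of $H$ and the identity of $T$, that is: on graphs $r$ is induced by the projection $T\to\Gamma$; for every loop $c$ at $q$, $r_\sharp[c]$ is the element of $H$ determined by $c$; and for every path $c$ from $q$ to a vertex $x$, if $h\in H$ is the element determined by $c$, then the vertex of $T$ represented by the path $r(c)$ is $h\cdot\tilde x$. Moreover $r_\sharp(\pi_1(H\backslash T,q))=H$, and every pointed covering map of $(\Gamma,\mathscr G,p)$ whose image subgroup is $H$ is isomorphic to $r$ over $(\Gamma,\mathscr G,p)$. -/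

import Mathlib

universe u

namespace BassSerre

/-! ### Graphs -/

/-- A graph: vertices `V`, oriented edges `E`, a fixed point free orientation reversal `bar` and the
terminal vertex `τ` of an oriented edge. The initial vertex of `e` is `τ (bar e)`. -/
structure OGraph where
  V : Type u
  E : Type u
  bar : E → E
  bar_bar : ∀ e, bar (bar e) = e
  bar_ne : ∀ e, bar e ≠ e
  τ : E → V

namespace OGraph

/-- The (unoriented) edges of a graph: pairs `{e, bar e}`. -/
def Edge (Γ : OGraph.{u}) : Type u := Quot (fun e e' : Γ.E => e' = Γ.bar e)

/-- The edge underlying an oriented edge. -/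
def edge (Γ : OGraph.{u}) (e : Γ.E) : Γ.Edge := Quot.mk _ e

theorem edge_bar (Γ : OGraph.{u}) (e : Γ.E) : Γ.edge (Γ.bar e) = Γ.edge e :=
  (Quot.sound (r := fun e e' : Γ.E => e' = Γ.bar e) rfl).symm

/-- `v` and `w` are joined by a finite edge path. -/
def Reachable (Γ : OGraph.{u}) : Γ.V → Γ.V → Prop :=
  Relation.ReflTransGen (fun v w => ∃ e, Γ.τ (Γ.bar e) = v ∧ Γ.τ e = w)

structure Connected (Γ : OGraph.{u}) : Prop where
  nonempty : Nonempty Γ.V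
  reachable : ∀ v w, Γ.Reachable v w

end OGraph

/-! ### Graphs of groups -/

/-- A graph of groups: a connected graph, a group for every vertex, a group for every (unoriented)
edge, and for every oriented edge `e` a monomorphism from the group of the edge underlying `e` to the
group of the terminal vertex of `e`. -/
structure GraphOfGroups extends OGraph.{u} where
  connected : toOGraph.Connected
  VG : V → Type u
  EG : toOGraph.Edge → Type u
  [groupV : ∀ v, Group (VG v)]
  [groupE : ∀ a, Group (EG a)]
  ι : ∀ e, EG (toOGraph.edge e) →* VG (τ e)
  ι_injective : ∀ e, Function.Injective (ι e)

attribute [instance] GraphOfGroups.groupV GraphOfGroups.groupE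

namespace GraphOfGroups

/-- `ι e`, with its source and target named by elements equal to `edge e` and `τ e`. -/
def inc (G : GraphOfGroups.{u}) {a : G.Edge} {v : G.V} (e : G.E) (ha : G.edge e = a)
    (hv : G.τ e = v) : G.EG a →* G.VG v :=
  match a, v, ha, hv with
  | _, _, rfl, rfl => G.ι e

/-! ### Paths and homotopy -/

/-- Paths `g₀ e₁ g₁ e₂ ⋯ eₖ gₖ` between vertices of a graph of groups. -/
inductive Path (G : GraphOfGroups.{u}) : G.V → G.V → Type u
  | single {v : G.V} (g : G.VG v) : Path G v v
  | cons {v u w : G.V} (g : G.VG v) (e : G.E) (hv : G.τ (G.bar e) = v) (hu : G.τ e = u)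
      (γ : Path G u w) : Path G v w

namespace Path

variable {G : GraphOfGroups.{u}}

/-- Multiply the first group element of a path on the left. -/
def lmul {v w : G.V} (g : G.VG v) : Path G v w → Path G v w
  | single h => single (g * h)
  | cons h e hv hu γ => cons (g * h) e hv hu γ

/-- Concatenation; the two group elements that become adjacent are multiplied. -/
def comp {v w x : G.V} : Path G v w → Path G w x → Path G v x
  | single g, δ => δ.lmul g
  | cons g e hv hu γ, δ => cons g e hv hu (γ.comp δ)

/-- The path with its orientation reversed. -/
def reverse {v w : G.V} : Path G v w → Path G w v
  | single g => single g⁻¹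
  | cons g e hv hu γ =>
      γ.reverse.comp (cons 1 (G.bar e) ((congrArg G.τ (G.bar_bar e)).trans hu) hv (single g⁻¹))

/-- Homotopy rel endpoints: the equivalence relation generated by inserting or removing `e ē`, and by
exchanging `ι_ē(h) e` and `e ι_e(h)` for `h` in the group of the edge underlying `e`. -/
inductive Homotopic : ∀ {v w : G.V}, Path G v w → Path G v w → Prop
  | refl {v w : G.V} (γ : Path G v w) : Homotopic γ γ
  | symm {v w : G.V} {γ γ' : Path G v w} : Homotopic γ γ' → Homotopic γ' γ
  | trans {v w : G.V} {γ γ' γ'' : Path G v w} :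
      Homotopic γ γ' → Homotopic γ' γ'' → Homotopic γ γ''
  | cons {v u w : G.V} (g : G.VG v) (e : G.E) (hv : G.τ (G.bar e) = v) (hu : G.τ e = u)
      {γ γ' : Path G u w} : Homotopic γ γ' →
      Homotopic (Path.cons g e hv hu γ) (Path.cons g e hv hu γ')
  | backtrack {v u w : G.V} (g : G.VG v) (e : G.E) (hv : G.τ (G.bar e) = v) (hu : G.τ e = u)
      (hu' : G.τ (G.bar (G.bar e)) = u) (γ : Path G v w) :
      Homotopic (Path.cons g e hv hu (Path.cons 1 (G.bar e) hu' hv γ)) (γ.lmul g)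
  | slide {v u w : G.V} (g : G.VG v) (e : G.E) (hv : G.τ (G.bar e) = v) (hu : G.τ e = u)
      (h : G.EG (G.edge e)) (γ : Path G u w) :
      Homotopic (Path.cons (g * G.inc (G.bar e) (G.edge_bar e) hv h) e hv hu γ)
        (Path.cons g e hv hu (γ.lmul (G.inc e rfl hu h)))

theorem lmul_single {v : G.V} (g h : G.VG v) : (single h).lmul g = single (g * h) := rfl

theorem lmul_cons {v u w : G.V} (g h : G.VG v) (e : G.E) (hv : G.τ (G.bar e) = v)
    (hu : G.τ e = u) (γ : Path G u w) : (cons h e hv hu γ).lmul g = cons (g * h) e hv hu γ := rfl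

theorem lmul_lmul {v w : G.V} (g h : G.VG v) (γ : Path G v w) :
    (γ.lmul h).lmul g = γ.lmul (g * h) := by
  cases γ <;> simp [lmul_single, lmul_cons, mul_assoc]

theorem one_lmul {v w : G.V} (γ : Path G v w) : γ.lmul 1 = γ := by
  cases γ <;> simp [lmul_single, lmul_cons]

theorem lmul_comp {v w x : G.V} (g : G.VG v) (γ : Path G v w) (δ : Path G w x) :
    (γ.lmul g).comp δ = (γ.comp δ).lmul g := by
  cases γ <;> simp [lmul_single, lmul_cons, comp, lmul_lmul]

theorem comp_assoc {v w x y : G.V} (γ : Path G v w) (δ : Path G w x) (ε : Path G x y) :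
    (γ.comp δ).comp ε = γ.comp (δ.comp ε) := by
  induction γ with
  | single g => simp [comp, lmul_comp]
  | cons g e hv hu γ ih => simp [comp, ih]

theorem comp_one {v w : G.V} (γ : Path G v w) : γ.comp (single 1) = γ := by
  induction γ with
  | single g => simp [comp, lmul_single]
  | cons g e hv hu γ ih => simp [comp, ih]

theorem Homotopic.lmul {v w : G.V} (g : G.VG v) {γ γ' : Path G v w} (h : Homotopic γ γ') :
    Homotopic (γ.lmul g) (γ'.lmul g) := by
  induction h with
  | refl γ => exact .refl _
  | symm _ ih => exact (ih g).symm
  | trans _ _ ih ih' => exact (ih g).trans (ih' g)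
  | cons g' e hv hu h _ => exact .cons _ e hv hu h
  | backtrack g' e hv hu hu' γ =>
    rw [lmul_lmul]
    exact .backtrack _ e hv hu hu' γ
  | slide g' e hv hu h γ =>
    simp only [Path.lmul_cons, ← mul_assoc]
    exact .slide _ e hv hu h γ

theorem Homotopic.comp_left {v w x : G.V} (γ : Path G v w) {δ δ' : Path G w x}
    (h : Homotopic δ δ') : Homotopic (γ.comp δ) (γ.comp δ') := by
  induction γ with
  | single g => exact h.lmul g
  | cons g e hv hu γ ih => exact .cons g e hv hu (ih h)

theorem Homotopic.comp_right {v w x : G.V} {γ γ' : Path G v w} (h : Homotopic γ γ')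
    (δ : Path G w x) : Homotopic (γ.comp δ) (γ'.comp δ) := by
  induction h with
  | refl γ => exact .refl _
  | symm _ ih => exact (ih δ).symm
  | trans _ _ ih ih' => exact (ih δ).trans (ih' δ)
  | cons g e hv hu _ ih => exact .cons g e hv hu (ih δ)
  | backtrack g e hv hu hu' γ =>
    rw [lmul_comp]
    exact .backtrack g e hv hu hu' _
  | slide g e hv hu h γ =>
    simp only [Path.comp, lmul_comp]
    exact .slide g e hv hu h _

theorem reverse_comp {v w : G.V} (γ : Path G v w) : Homotopic (γ.reverse.comp γ) (single 1) := by
  induction γ with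
  | single g => simpa [reverse, comp, lmul_single, lmul_cons] using Homotopic.refl _
  | @cons v u w g e hv hu γ ih =>
    simp only [reverse, comp_assoc, comp, lmul_cons, inv_mul_cancel]
    refine Homotopic.trans (Homotopic.comp_left _ ?_) ih
    have key : ∀ e' : G.E, e' = G.bar (G.bar e) → ∀ (hv' : G.τ (G.bar e') = v) (hu' : G.τ e' = u),
        Homotopic (Path.cons 1 (G.bar e) ((congrArg G.τ (G.bar_bar e)).trans hu) hv
          (Path.cons 1 e' hv' hu' γ)) γ := by
      rintro _ rfl hv' hu'
      have := Homotopic.backtrack (1 : G.VG u) (G.bar e) hu' hv hv' γ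
      rwa [one_lmul] at this
    exact key e (G.bar_bar e).symm hv hu

theorem comp_reverse {v w : G.V} (γ : Path G v w) : Homotopic (γ.comp γ.reverse) (single 1) := by
  induction γ with
  | single g => simpa [reverse, comp, lmul_single, lmul_cons] using Homotopic.refl _
  | @cons v u w g e hv hu γ ih =>
    simp only [reverse, comp, ← comp_assoc]
    refine (Homotopic.cons g e hv hu (ih.comp_right _)).trans ?_
    simp only [comp, lmul_cons, one_mul]
    refine (Homotopic.backtrack g e hv hu _ _).trans ?_
    simpa [lmul_single, lmul_cons] using Homotopic.refl _

theorem Homotopic.reverse {v w : G.V} {γ γ' : Path G v w} (h : Homotopic γ γ') :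
    Homotopic γ.reverse γ'.reverse := by
  have h1 : Homotopic γ.reverse (γ.reverse.comp (γ.comp γ'.reverse)) := by
    have := Homotopic.comp_left γ.reverse ((comp_reverse γ').symm.trans (h.symm.comp_right _))
    rwa [comp_one] at this
  have h2 : Homotopic (γ.reverse.comp (γ.comp γ'.reverse)) γ'.reverse := by
    rw [← comp_assoc]
    have := (reverse_comp γ).comp_right γ'.reverse
    rwa [comp, one_lmul] at this
  exact h1.trans h2

def setoid (v w : G.V) : Setoid (Path G v w) :=
  ⟨Homotopic, ⟨Homotopic.refl, Homotopic.symm, Homotopic.trans⟩⟩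

end Path

/-- Homotopy classes rel endpoints of paths from `v` to `w`. -/
def PathClass (G : GraphOfGroups.{u}) (v w : G.V) : Type u := Quotient (Path.setoid v w)

namespace PathClass

variable {G : GraphOfGroups.{u}}

/-- The class of a path. -/
def mk {v w : G.V} (γ : Path G v w) : PathClass G v w := Quotient.mk (Path.setoid v w) γ

/-- Concatenation of homotopy classes. -/
def comp {v w x : G.V} (α : PathClass G v w) (β : PathClass G w x) : PathClass G v x :=
  Quotient.liftOn₂ α β (fun γ δ => mk (γ.comp δ)) (fun _ _ _ _ h h' =>
    Quotient.sound ((Path.Homotopic.comp_right h _).trans (Path.Homotopic.comp_left _ h')))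

/-- The class of the reversed path. -/
def reverse {v w : G.V} (α : PathClass G v w) : PathClass G w v :=
  Quotient.liftOn α (fun γ => mk γ.reverse) (fun _ _ h => Quotient.sound (Path.Homotopic.reverse h))

/-- The path consisting of one element of a vertex group. -/
def ofVertex {v : G.V} (g : G.VG v) : PathClass G v v := mk (.single g)

/-- The path `e` (with trivial vertex group elements) from `v` to `w`. -/
def ofEdge {v w : G.V} (e : G.E) (hv : G.τ (G.bar e) = v) (hw : G.τ e = w) : PathClass G v w :=
  mk (.cons 1 e hv hw (.single 1))

theorem comp_assoc {v w x y : G.V} (α : PathClass G v w) (β : PathClass G w x)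
    (γ : PathClass G x y) : (α.comp β).comp γ = α.comp (β.comp γ) := by
  induction α using Quotient.inductionOn
  induction β using Quotient.inductionOn
  induction γ using Quotient.inductionOn
  exact congrArg mk (Path.comp_assoc _ _ _)

theorem one_comp {v w : G.V} (α : PathClass G v w) : (ofVertex 1).comp α = α := by
  induction α using Quotient.inductionOn
  exact congrArg mk (Path.one_lmul _)

theorem comp_one {v w : G.V} (α : PathClass G v w) : α.comp (ofVertex 1) = α := by
  induction α using Quotient.inductionOn
  exact congrArg mk (Path.comp_one _)

theorem reverse_comp {v w : G.V} (α : PathClass G v w) : α.reverse.comp α = ofVertex 1 := by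
  induction α using Quotient.inductionOn
  exact Quotient.sound (Path.reverse_comp _)

theorem ofVertex_mul {v : G.V} (g h : G.VG v) :
    ofVertex (g * h) = (ofVertex g).comp (ofVertex h) := rfl

theorem ofEdge_bar {v w : G.V} (e : G.E) (hv : G.τ (G.bar e) = v) (hw : G.τ e = w)
    (hw' : G.τ (G.bar (G.bar e)) = w) :
    (ofEdge e hv hw).comp (ofEdge (G.bar e) hw' hv) = ofVertex 1 := by
  refine Quotient.sound (s := Path.setoid v v) ?_
  change Path.Homotopic _ _
  have := Path.Homotopic.backtrack (1 : G.VG v) e hv hw hw' (.single 1)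
  simpa [Path.comp, Path.lmul_single, Path.lmul_cons] using this

theorem slide {v w : G.V} (e : G.E) (hv : G.τ (G.bar e) = v) (hw : G.τ e = w)
    (h : G.EG (G.edge e)) :
    (ofVertex (G.inc (G.bar e) (G.edge_bar e) hv h)).comp (ofEdge e hv hw) =
      (ofEdge e hv hw).comp (ofVertex (G.inc e rfl hw h)) := by
  refine Quotient.sound (s := Path.setoid v w) ?_
  change Path.Homotopic _ _
  have := Path.Homotopic.slide 1 e hv hw h (.single 1)
  simpa [Path.comp, Path.lmul_single, Path.lmul_cons] using this

end PathClass

/-- The fundamental group: homotopy classes of loops based at `p`, under concatenation. -/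
def PiOne (G : GraphOfGroups.{u}) (p : G.V) : Type u := PathClass G p p

instance (G : GraphOfGroups.{u}) (p : G.V) : Group (PiOne G p) where
  mul := PathClass.comp
  one := PathClass.ofVertex 1
  inv := PathClass.reverse
  mul_assoc := PathClass.comp_assoc
  one_mul := PathClass.one_comp
  mul_one := PathClass.comp_one
  inv_mul_cancel := PathClass.reverse_comp

/-! ### Morphisms -/

/-- Morphisms of graphs of groups which do not collapse edges: a morphism of graphs, homomorphisms of
vertex and edge groups, and elements `δ e` of the group of the image of the terminal vertex of `e`
such that `f_v ι_e = ad(δ_e) ι_{f(e)} f_e`. -/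
structure Hom (L G : GraphOfGroups.{u}) where
  onV : L.V → G.V
  onE : L.E → G.E
  onEdge : L.Edge → G.Edge
  onE_bar : ∀ e, onE (L.bar e) = G.bar (onE e)
  τ_onE : ∀ e, G.τ (onE e) = onV (L.τ e)
  edge_onE : ∀ e, G.edge (onE e) = onEdge (L.edge e)
  vhom : ∀ v, L.VG v →* G.VG (onV v)
  ehom : ∀ a, L.EG a →* G.EG (onEdge a)
  δ : ∀ e, G.VG (onV (L.τ e))
  pseudonatural : ∀ e (h : L.EG (L.edge e)),
    vhom (L.τ e) (L.ι e h) = δ e * G.inc (onE e) (edge_onE e) (τ_onE e) (ehom _ h) * (δ e)⁻¹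

namespace Hom

variable {K L G : GraphOfGroups.{u}}

theorem τ_onE' (f : Hom L G) {e : L.E} {v : L.V} (hv : L.τ e = v) : G.τ (f.onE e) = f.onV v :=
  (f.τ_onE e).trans (congrArg f.onV hv)

theorem τ_bar_onE (f : Hom L G) {e : L.E} {v : L.V} (hv : L.τ (L.bar e) = v) :
    G.τ (G.bar (f.onE e)) = f.onV v :=
  (congrArg G.τ (f.onE_bar e)).symm.trans (f.τ_onE' hv)

/-- `δ e`, with the terminal vertex of `e` named by an element equal to it. -/
def δ' (f : Hom L G) {v : L.V} (e : L.E) (hv : L.τ e = v) : G.VG (f.onV v) :=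
  match v, hv with
  | _, rfl => f.δ e

theorem pseudonatural' (f : Hom L G) {v : L.V} (e : L.E) (hv : L.τ e = v)
    (h : L.EG (L.edge e)) :
    f.vhom v (L.inc e rfl hv h) =
      f.δ' e hv * G.inc (f.onE e) (f.edge_onE e) (f.τ_onE' hv) (f.ehom _ h) * (f.δ' e hv)⁻¹ := by
  subst hv
  exact f.pseudonatural e h

theorem pseudonatural'' (f : Hom L G) {a : L.Edge} {v : L.V} (e : L.E) (ha : L.edge e = a)
    (hv : L.τ e = v) (h : L.EG a) (ha' : G.edge (f.onE e) = f.onEdge a) :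
    f.vhom v (L.inc e ha hv h) =
      f.δ' e hv * G.inc (f.onE e) ha' (f.τ_onE' hv) (f.ehom _ h) * (f.δ' e hv)⁻¹ := by
  subst ha
  exact f.pseudonatural' e hv h

/-- The composition `f ∘ k`. -/
def comp (f : Hom L G) (k : Hom K L) : Hom K G where
  onV v := f.onV (k.onV v)
  onE e := f.onE (k.onE e)
  onEdge a := f.onEdge (k.onEdge a)
  onE_bar e := by rw [k.onE_bar, f.onE_bar]
  τ_onE e := f.τ_onE' (k.τ_onE e)
  edge_onE e := by rw [f.edge_onE, k.edge_onE]
  vhom v := (f.vhom (k.onV v)).comp (k.vhom v)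
  ehom a := (f.ehom (k.onEdge a)).comp (k.ehom a)
  δ e := f.vhom _ (k.δ e) * f.δ' (k.onE e) (k.τ_onE e)
  pseudonatural e h := by
    simp only [MonoidHom.comp_apply, k.pseudonatural e h, map_mul, map_inv, mul_inv_rev]
    rw [f.pseudonatural'' (k.onE e) (k.edge_onE e) (k.τ_onE e) (k.ehom _ h)
      (by rw [f.edge_onE, k.edge_onE])]
    simp only [mul_assoc]

/-- Change a morphism by elements `g v` of the vertex groups `G_{f(v)}` and `k a` of the edge groups
`G_{f(a)}`: replace `f_v` by `ad(g_v) ∘ f_v`, `f_a` by `ad(k_a⁻¹) ∘ f_a` and `δ_e` by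
`g_{τ(e)} δ_e ι_{f(e)}(k_e)`. -/
def twist (f : Hom L G) (g : ∀ v, G.VG (f.onV v)) (k : ∀ a, G.EG (f.onEdge a)) : Hom L G where
  onV := f.onV
  onE := f.onE
  onEdge := f.onEdge
  onE_bar := f.onE_bar
  τ_onE := f.τ_onE
  edge_onE := f.edge_onE
  vhom v := (MulAut.conj (g v)).toMonoidHom.comp (f.vhom v)
  ehom a := (MulAut.conj (k a)⁻¹).toMonoidHom.comp (f.ehom a)
  δ e := g (L.τ e) * f.δ e * G.inc (f.onE e) (f.edge_onE e) (f.τ_onE e) (k (L.edge e))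
  pseudonatural e h := by
    simp [f.pseudonatural e h, mul_assoc]

/-- `f` and `f'` are equivalent fixing the vertex `q`. -/
def EquivFixing (q : L.V) (f f' : Hom L G) : Prop :=
  ∃ (g : ∀ v, G.VG (f.onV v)) (k : ∀ a, G.EG (f.onEdge a)), g q = 1 ∧ f' = f.twist g k

/-- Isomorphisms of graphs of groups. -/
structure IsIso (f : Hom L G) : Prop where
  onV : Function.Bijective f.onV
  onE : Function.Bijective f.onE
  vhom : ∀ v, Function.Bijective (f.vhom v)
  ehom : ∀ a, Function.Bijective (f.ehom a)

/-! ### Action of morphisms on paths -/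

/-- The action on paths: `f_v` on group elements, and `e ↦ δ_ē f(e) δ_e⁻¹`. -/
def mapPath (f : Hom L G) {v w : L.V} : Path L v w → Path G (f.onV v) (f.onV w)
  | .single g => .single (f.vhom _ g)
  | .cons g e hv hu γ =>
      .cons (f.vhom _ g * f.δ' (L.bar e) hv) (f.onE e) (f.τ_bar_onE hv) (f.τ_onE' hu)
        ((f.mapPath γ).lmul (f.δ' e hu)⁻¹)

theorem mapPath_lmul (f : Hom L G) {v w : L.V} (g : L.VG v) (γ : Path L v w) :
    f.mapPath (γ.lmul g) = (f.mapPath γ).lmul (f.vhom v g) := by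
  cases γ <;> simp [mapPath, Path.lmul_single, Path.lmul_cons, mul_assoc]

theorem mapPath_comp (f : Hom L G) {v w x : L.V} (γ : Path L v w) (γ' : Path L w x) :
    f.mapPath (γ.comp γ') = (f.mapPath γ).comp (f.mapPath γ') := by
  induction γ with
  | single g => simp [mapPath, Path.comp, mapPath_lmul]
  | cons g e hv hu γ ih => simp [mapPath, Path.comp, ih, Path.lmul_comp]

theorem inc_congr {a : G.Edge} {v : G.V} {e e' : G.E} (h : e = e') (ha : G.edge e = a)
    (hv : G.τ e = v) (ha' : G.edge e' = a) (hv' : G.τ e' = v) (x : G.EG a) :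
    G.inc e ha hv x = G.inc e' ha' hv' x := by
  subst h; rfl

theorem δ'_congr (f : Hom L G) {v : L.V} {e e' : L.E} (h : e = e') (hv : L.τ e = v)
    (hv' : L.τ e' = v) : f.δ' e hv = f.δ' e' hv' := by
  subst h; rfl

theorem cons_congr {v u w : G.V} (g : G.VG v) {e e' : G.E} (h : e = e')
    (hv : G.τ (G.bar e) = v) (hu : G.τ e = u) (hv' : G.τ (G.bar e') = v) (hu' : G.τ e' = u)
    (γ : Path G u w) : Path.cons g e hv hu γ = Path.cons g e' hv' hu' γ := by
  subst h; rfl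

theorem slide' {v u w : G.V} (g : G.VG v) (e : G.E) (hv : G.τ (G.bar e) = v)
    (hu : G.τ e = u) {a : G.Edge} (ha : G.edge e = a) (ha' : G.edge (G.bar e) = a) (h : G.EG a)
    (γ : Path G u w) :
    Path.Homotopic (Path.cons (g * G.inc (G.bar e) ha' hv h) e hv hu γ)
      (Path.cons g e hv hu (γ.lmul (G.inc e ha hu h))) := by
  subst ha
  exact .slide g e hv hu h γ

theorem mapPath_homotopic (f : Hom L G) {v w : L.V} {γ γ' : Path L v w}
    (h : Path.Homotopic γ γ') : Path.Homotopic (f.mapPath γ) (f.mapPath γ') := by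
  induction h with
  | refl γ => exact .refl _
  | symm _ ih => exact ih.symm
  | trans _ _ ih ih' => exact ih.trans ih'
  | cons g e hv hu _ ih => exact .cons _ _ _ _ (ih.lmul _)
  | backtrack g e hv hu hu' γ =>
    rw [mapPath_lmul]
    simp only [mapPath, Path.lmul_cons, map_one, one_mul]
    rw [f.δ'_congr (L.bar_bar e) hu' hu, inv_mul_cancel,
      cons_congr (1 : G.VG (f.onV _)) (f.onE_bar e) _ _
        ((congrArg G.τ (G.bar_bar _)).trans (f.τ_onE' hu)) (f.τ_bar_onE hv)]
    refine (Path.Homotopic.backtrack _ _ _ _ _ _).trans ?_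
    rw [Path.lmul_lmul, mul_inv_cancel_right]
    exact .refl _
  | slide g e hv hu h γ =>
    simp only [mapPath, mapPath_lmul, Path.lmul_lmul, map_mul]
    have hb : G.edge (f.onE (L.bar e)) = f.onEdge (L.edge e) := by
      rw [f.edge_onE, L.edge_bar]
    have ha' : G.edge (G.bar (f.onE e)) = f.onEdge (L.edge e) := by
      rw [G.edge_bar, f.edge_onE]
    rw [f.pseudonatural'' (L.bar e) (L.edge_bar e) hv h hb, f.pseudonatural'' e rfl hu h
      (f.edge_onE e), inc_congr (f.onE_bar e) hb (f.τ_onE' hv) ha' (f.τ_bar_onE hv)]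
    have := slide' (f.vhom _ g * f.δ' (L.bar e) hv) (f.onE e) (f.τ_bar_onE hv) (f.τ_onE' hu)
      (f.edge_onE e) ha' (f.ehom _ h) ((f.mapPath γ).lmul (f.δ' e hu)⁻¹)
    simpa only [Path.lmul_lmul, mul_assoc, inv_mul_cancel, mul_one, inv_mul_cancel_left] using this

/-- The action on homotopy classes of paths starting at `q`, where `f q = p`. -/
def mapClass (f : Hom L G) {q x : L.V} {p : G.V} (h : f.onV q = p) (α : PathClass L q x) :
    PathClass G p (f.onV x) :=
  match p, h with
  | _, rfl => Quotient.liftOn α (fun γ => PathClass.mk (f.mapPath γ))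
      (fun _ _ h => Quotient.sound (f.mapPath_homotopic h))

/-- The induced homomorphism of fundamental groups, where `f q = p`. -/
def mapPiOne (f : Hom L G) {q : L.V} {p : G.V} (h : f.onV q = p) : PiOne L q →* PiOne G p :=
  match p, h with
  | _, rfl =>
    { toFun := f.mapClass rfl
      map_one' := congrArg (fun g => PathClass.mk (.single g)) (map_one (f.vhom q))
      map_mul' := fun α β => by
        induction α using Quotient.inductionOn
        induction β using Quotient.inductionOn
        exact congrArg PathClass.mk (f.mapPath_comp _ _) }

end Hom

/-! ### Covering maps -/

/-- The disjoint union of the coset spaces `G_v / ι_e(G_e)` over the oriented edges `e` with terminal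
vertex `v`. -/
def Star (G : GraphOfGroups.{u}) (v : G.V) : Type u :=
  Σ e : {e : G.E // G.τ e = v}, G.VG v ⧸ (G.inc e.1 rfl e.2).range

/-- The local map `([g], e) ↦ ([f_v(g) δ_e], f(e))`. -/
def Hom.star {L G : GraphOfGroups.{u}} (f : Hom L G) (v : L.V) (s : L.Star v) :
    G.Star (f.onV v) :=
  ⟨⟨f.onE s.1.1, f.τ_onE' s.1.2⟩,
    Quotient.liftOn' s.2
      (fun g => ((f.vhom v g * f.δ' s.1.1 s.1.2 : G.VG (f.onV v)) :
        G.VG (f.onV v) ⧸ (G.inc (f.onE s.1.1) rfl (f.τ_onE' s.1.2)).range))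
      (fun g g' h => by
        rw [QuotientGroup.leftRel_apply] at h
        obtain ⟨k, hk⟩ := h
        refine QuotientGroup.eq.2 ?_
        have hg : g' = g * L.inc s.1.1 rfl s.1.2 k := by rw [hk, mul_inv_cancel_left]
        have key : ∀ {a : G.Edge} (ha : G.edge (f.onE s.1.1) = a) (x : G.EG a),
            G.inc (f.onE s.1.1) ha (f.τ_onE' s.1.2) x ∈
              (G.inc (f.onE s.1.1) rfl (f.τ_onE' s.1.2)).range := by
          rintro _ rfl x
          exact ⟨x, rfl⟩
        rw [hg, map_mul, f.pseudonatural' s.1.1 s.1.2 k]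
        convert key (f.edge_onE s.1.1) (f.ehom _ k) using 1
        group)⟩

structure Hom.IsImmersion {L G : GraphOfGroups.{u}} (f : Hom L G) : Prop where
  vhom : ∀ v, Function.Injective (f.vhom v)
  ehom : ∀ a, Function.Injective (f.ehom a)
  star : ∀ v, Function.Injective (f.star v)

structure Hom.IsCovering {L G : GraphOfGroups.{u}} (f : Hom L G) : Prop where
  immersion : f.IsImmersion
  onV : Function.Surjective f.onV
  onE : Function.Surjective f.onE
  star : ∀ v, Function.Bijective (f.star v)

/-- Pointed covering maps `ρ : (L, q) → (G, p)`, with `L` connected as every graph of groups. -/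
structure PointedCovering (G : GraphOfGroups.{u}) (p : G.V) where
  L : GraphOfGroups.{u}
  q : L.V
  ρ : Hom L G
  covering : ρ.IsCovering
  pointed : ρ.onV q = p

/-- The image of the fundamental group under `ρ`. -/
def PointedCovering.subgroup {G : GraphOfGroups.{u}} {p : G.V} (C : PointedCovering G p) :
    Subgroup (PiOne G p) :=
  (C.ρ.mapPiOne C.pointed).range

/-- `f` is a pointed morphism over `(G, p)`: it sends `q₁` to `q₂`, and `ρ₂ f` agrees with `ρ₁` up to
equivalence fixing the basepoint. -/
structure PointedCovering.IsOver {G : GraphOfGroups.{u}} {p : G.V} (C₁ C₂ : PointedCovering G p)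
    (f : Hom C₁.L C₂.L) : Prop where
  pointed : f.onV C₁.q = C₂.q
  equiv : Hom.EquivFixing C₁.q (C₂.ρ.comp f) C₁.ρ

end GraphOfGroups

/-! ### Graphs of groups induced by group actions -/

/-- A group acting on a graph by automorphisms, without inversions in edges. -/
structure IsGraphAction (K : Type u) [Group K] (T : OGraph.{u}) [MulAction K T.V]
    [MulAction K T.E] : Prop where
  smul_bar : ∀ (k : K) (e : T.E), T.bar (k • e) = k • T.bar e
  smul_τ : ∀ (k : K) (e : T.E), T.τ (k • e) = k • T.τ e
  no_inversion : ∀ (k : K) (e : T.E), k • e ≠ T.bar e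

section Action

variable {K : Type u} [Group K] {T : OGraph.{u}} [MulAction K T.V] [MulAction K T.E]

theorem IsGraphAction.subgroup (A : IsGraphAction K T) (H : Subgroup K) : IsGraphAction H T :=
  ⟨fun k e => A.smul_bar k e, fun k e => A.smul_τ k e, fun k e => A.no_inversion k e⟩

/-- The quotient graph `K \ T`. -/
def quotientGraph (A : IsGraphAction K T) : OGraph.{u} where
  V := MulAction.orbitRel.Quotient K T.V
  E := MulAction.orbitRel.Quotient K T.E
  bar := Quotient.map T.bar (by
    rintro _ e ⟨k, rfl⟩
    exact ⟨k, (A.smul_bar k e).symm⟩)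
  bar_bar e := by
    induction e using Quotient.inductionOn
    exact congrArg (Quotient.mk _) (T.bar_bar _)
  bar_ne e := by
    induction e using Quotient.inductionOn with
    | _ e =>
      intro h
      obtain ⟨k, hk⟩ := Quotient.exact h
      exact A.no_inversion k e hk
  τ := Quotient.map T.τ (by
    rintro _ e ⟨k, rfl⟩
    exact ⟨k, (A.smul_τ k e).symm⟩)

/-- The projection `T → K \ T` on vertices. -/
def orbitV (A : IsGraphAction K T) (x : T.V) : (quotientGraph A).V := Quotient.mk _ x

/-- The projection `T → K \ T` on oriented edges. -/
def orbitE (A : IsGraphAction K T) (e : T.E) : (quotientGraph A).E := Quotient.mk _ e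

theorem quotientGraph_connected (A : IsGraphAction K T) (hT : T.Connected) :
    (quotientGraph A).Connected where
  nonempty := hT.nonempty.map (orbitV A)
  reachable v w := by
    induction v using Quotient.inductionOn with
    | _ v =>
      induction w using Quotient.inductionOn with
      | _ w =>
        induction hT.reachable v w with
        | refl => exact .refl
        | tail _ h ih =>
          obtain ⟨e, rfl, rfl⟩ := h
          exact .tail ih ⟨orbitE A e, rfl, rfl⟩

/-- The choices that determine the graph of groups induced by an action: a lift of every vertex and
every edge of `K \ T` (the basepoint `x₀` being the lift of its own orbit), and for every oriented
edge `e` of `K \ T` an element `t e` of `K` carrying the terminal vertex of the lift of `e` to the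
lift of the terminal vertex of `e`. -/
structure OrbitLifts (A : IsGraphAction K T) (x₀ : T.V) where
  vert : (quotientGraph A).V → T.V
  vert_spec : ∀ x, orbitV A (vert x) = x
  vert_base : vert (orbitV A x₀) = x₀
  edge : (quotientGraph A).E → T.E
  edge_spec : ∀ e, orbitE A (edge e) = e
  edge_bar : ∀ e, edge ((quotientGraph A).bar e) = T.bar (edge e)
  t : (quotientGraph A).E → K
  t_spec : ∀ e, t e • T.τ (edge e) = vert ((quotientGraph A).τ e)

/-- The graph of groups `K \ T` induced by an action: vertex and edge groups are the stabilizers of the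
chosen lifts, and `ι e` is `h ↦ t_e h t_e⁻¹`. (The lifts of `e` and `ē` have the same stabilizer.) -/
def OrbitLifts.graphOfGroups {A : IsGraphAction K T} {x₀ : T.V} (D : OrbitLifts A x₀)
    (hT : T.Connected) : GraphOfGroups.{u} where
  toOGraph := quotientGraph A
  connected := quotientGraph_connected A hT
  VG x := MulAction.stabilizer K (D.vert x)
  EG a := (⨅ e : {e : (quotientGraph A).E // (quotientGraph A).edge e = a},
    MulAction.stabilizer K (D.edge e.1) : Subgroup K)
  ι e := ((MulAut.conj (D.t e)).toMonoidHom.comp (Subgroup.subtype _)).codRestrict _ (by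
    rintro ⟨k, hk⟩
    have hk' : k • D.edge e = D.edge e := (Subgroup.mem_iInf.1 hk) ⟨e, rfl⟩
    have h : k • T.τ (D.edge e) = T.τ (D.edge e) := by rw [← A.smul_τ, hk']
    change (D.t e * k * (D.t e)⁻¹) • D.vert _ = D.vert _
    rw [← D.t_spec e, smul_smul, inv_mul_cancel_right, mul_smul, h])
  ι_injective e := by
    intro k k' h
    have h' : D.t e * (k : K) * (D.t e)⁻¹ = D.t e * (k' : K) * (D.t e)⁻¹ :=
      congrArg (fun x : MulAction.stabilizer K (D.vert ((quotientGraph A).τ e)) => (x : K)) h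
    exact Subtype.ext (mul_left_cancel (mul_right_cancel h'))

/-- The element of `K` determined by a path of `K \ T`: group elements are sent to themselves and an
oriented edge `e` is sent to `t_ē t_e⁻¹`. On loops at the orbit of `x₀` this is the identification of
the fundamental group of `K \ T` with `K`. For a path `c` from the orbit of `x₀` to `x`, the lift of `c`
to `T` starting at `x₀` ends at `D.holonomy c • D.vert x`. -/
def OrbitLifts.holonomy {A : IsGraphAction K T} {x₀ : T.V} (D : OrbitLifts A x₀)
    (hT : T.Connected) {x y : (D.graphOfGroups hT).V} :
    GraphOfGroups.Path (D.graphOfGroups hT) x y → K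
  | .single g => Subtype.val (p := fun k => k ∈ MulAction.stabilizer K (D.vert x)) g
  | .cons g e _ _ γ =>
      Subtype.val (p := fun k => k ∈ MulAction.stabilizer K (D.vert x)) g *
        (D.t ((quotientGraph A).bar e) * (D.t e)⁻¹) * D.holonomy hT γ

end Action

/-! ### The Bass–Serre tree -/

namespace GraphOfGroups

variable (G : GraphOfGroups.{u}) (p : G.V)

/-- `(w, α) ∼ (w, α g)` for homotopy classes `α` of paths from `p` to `w` and `g ∈ G_w`. -/
inductive TreeVRel : (Σ w, PathClass G p w) → (Σ w, PathClass G p w) → Prop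
  | intro {w : G.V} (α : PathClass G p w) (g : G.VG w) :
      TreeVRel ⟨w, α⟩ ⟨w, α.comp (.ofVertex g)⟩

/-- Vertices of the Bass–Serre tree over `w`: homotopy classes of paths from `p` to `w`, modulo `G_w`. -/
def TreeV : Type u := Quot (TreeVRel G p)

/-- An oriented edge `e` with a homotopy class of paths from `p` to its initial vertex `v`. -/
structure TreePreE where
  e : G.E
  v : G.V
  hv : G.τ (G.bar e) = v
  α : PathClass G p v

/-- `(e, α) ∼ (e, α ι_ē(h))` for `h ∈ G_e`. -/
inductive TreeERel : TreePreE G p → TreePreE G p → Prop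
  | intro (e : G.E) {v : G.V} (hv : G.τ (G.bar e) = v) (α : PathClass G p v)
      (h : G.EG (G.edge e)) :
      TreeERel ⟨e, v, hv, α⟩ ⟨e, v, hv, α.comp (.ofVertex (G.inc (G.bar e) (G.edge_bar e) hv h))⟩

/-- Oriented edges of the Bass–Serre tree over `e`: homotopy classes of paths from `p` to the initial
vertex of `e`, modulo `ι_ē(G_e)`. -/
def TreeE : Type u := Quot (TreeERel G p)

variable {G p}

/-- The vertex of the tree given by a homotopy class of paths. -/
def treeVertex {w : G.V} (α : PathClass G p w) : TreeV G p := Quot.mk _ ⟨w, α⟩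

/-- The oriented edge of the tree over `e` given by a homotopy class of paths. -/
def treeEdge {v : G.V} (e : G.E) (hv : G.τ (G.bar e) = v) (α : PathClass G p v) : TreeE G p :=
  Quot.mk _ ⟨e, v, hv, α⟩

theorem treeVertex_comp {w : G.V} (α : PathClass G p w) (g : G.VG w) :
    treeVertex (α.comp (.ofVertex g)) = treeVertex α :=
  (Quot.sound (.intro α g)).symm

theorem treeEdge_comp {v : G.V} (e : G.E) (hv : G.τ (G.bar e) = v) (α : PathClass G p v)
    {a : G.Edge} (ha : G.edge (G.bar e) = a) (h : G.EG a) :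
    treeEdge e hv (α.comp (.ofVertex (G.inc (G.bar e) ha hv h))) = treeEdge e hv α := by
  obtain rfl : G.edge e = a := (G.edge_bar e).symm.trans ha
  exact (Quot.sound (.intro e hv α h)).symm

theorem treeEdge_congr {v : G.V} {e e' : G.E} (h : e = e') (hv : G.τ (G.bar e) = v)
    (hv' : G.τ (G.bar e') = v) (α : PathClass G p v) : treeEdge e hv α = treeEdge e' hv' α := by
  subst h; rfl

/-- The reversal of the edge `(e, α)` is `(ē, α e)`. -/
def treeBar : TreeE G p → TreeE G p :=
  Quot.lift (fun x => treeEdge (G.bar x.e) (congrArg G.τ (G.bar_bar x.e))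
      (x.α.comp (.ofEdge x.e x.hv rfl))) (by
    rintro _ _ ⟨e, hv, α, h⟩
    dsimp only
    rw [PathClass.comp_assoc, PathClass.slide, ← PathClass.comp_assoc,
      Hom.inc_congr (G.bar_bar e).symm rfl rfl ((G.edge_bar _).trans (G.edge_bar e))
        (congrArg G.τ (G.bar_bar e)), treeEdge_comp])

/-- The terminal vertex of the edge `(e, α)` is `α e`. -/
def treeTau : TreeE G p → TreeV G p :=
  Quot.lift (fun x => treeVertex (x.α.comp (.ofEdge x.e x.hv rfl))) (by
    rintro _ _ ⟨e, hv, α, h⟩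
    dsimp only
    rw [PathClass.comp_assoc, PathClass.slide, ← PathClass.comp_assoc, treeVertex_comp])

/-- The projection of the tree to the graph on oriented edges. -/
def treeProjE : TreeE G p → G.E :=
  Quot.lift (fun x => x.e) (by
    rintro _ _ ⟨e, hv, α, h⟩
    rfl)

/-- The projection of the tree to the graph on vertices. -/
def treeProjV : TreeV G p → G.V :=
  Quot.lift (fun x => x.1) (by
    rintro _ _ ⟨α, g⟩
    rfl)

theorem treeProjE_bar (x : TreeE G p) : treeProjE (treeBar x) = G.bar (treeProjE x) := by
  induction x using Quot.inductionOn
  rfl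

variable (G p) in
/-- The Bass–Serre tree. -/
def tree : OGraph.{u} where
  V := TreeV G p
  E := TreeE G p
  bar := treeBar
  bar_bar x := by
    induction x using Quot.inductionOn with
    | _ x =>
      obtain ⟨e, v, hv, α⟩ := x
      subst hv
      have h : G.bar (G.bar e) = e := G.bar_bar e
      change treeEdge (G.bar (G.bar e)) _ ((α.comp _).comp _) = treeEdge e _ α
      have key : ∀ {u : G.V} (hu : G.τ (G.bar (G.bar e)) = G.τ e) (hu' : G.τ (G.bar e) = u)
          (h' : G.τ (G.bar (G.bar (G.bar e))) = u),
          treeEdge (G.bar (G.bar e)) h' ((α.comp (.ofEdge e rfl rfl)).comp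
            (.ofEdge (G.bar e) hu hu')) = treeEdge e rfl α := by
        rintro _ hu rfl h'
        rw [PathClass.comp_assoc, PathClass.ofEdge_bar, PathClass.comp_one]
        exact treeEdge_congr h _ _ α
      exact key _ rfl _
  bar_ne x h := G.bar_ne (treeProjE x) ((treeProjE_bar x).symm.trans (congrArg treeProjE h))
  τ := treeTau

variable (G p) in
/-- The distinguished lift of `p`: the class of the constant path. -/
def treeBase : (tree G p).V := treeVertex (PathClass.ofVertex (1 : G.VG p))

theorem tree_connected : (tree G p).Connected where
  nonempty := ⟨treeBase G p⟩
  reachable := by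
    have hsymm : ∀ x y : (tree G p).V, (tree G p).Reachable x y → (tree G p).Reachable y x := by
      intro x y h
      induction h with
      | refl => exact .refl
      | tail _ h ih =>
        obtain ⟨e, rfl, rfl⟩ := h
        exact .head ⟨(tree G p).bar e, congrArg _ ((tree G p).bar_bar e), rfl⟩ ih
    have key : ∀ {v w : G.V} (γ : Path G v w) (α : PathClass G p v),
        (tree G p).Reachable (treeVertex α) (treeVertex (α.comp (.mk γ))) := by
      intro v w γ
      induction γ with
      | single g =>
        intro α
        exact (congrArg ((tree G p).Reachable (treeVertex α)) (treeVertex_comp α g)).mpr .refl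
      | @cons v u w g e hv hu γ ih =>
        intro α
        subst hu
        have h1 : α.comp (.mk (.cons g e hv rfl γ)) =
            ((α.comp (.ofVertex g)).comp (.ofEdge e hv rfl)).comp (.mk γ) := by
          rw [PathClass.comp_assoc, PathClass.comp_assoc]
          refine congrArg α.comp (congrArg PathClass.mk ?_)
          simp [Path.comp, Path.lmul_cons, Path.one_lmul]
        rw [h1]
        refine Relation.ReflTransGen.head ?_ (ih _)
        refine ⟨treeEdge e hv (α.comp (.ofVertex g)), ?_, rfl⟩
        change treeVertex (((α.comp (.ofVertex g)).comp (.ofEdge e hv rfl)).comp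
          (.ofEdge (G.bar e) _ _)) = _
        subst hv
        rw [PathClass.comp_assoc (α.comp _)]
        refine (congrArg (fun β => treeVertex ((α.comp (.ofVertex g)).comp β))
          (PathClass.ofEdge_bar e rfl rfl (congrArg G.τ (G.bar_bar e)))).trans ?_
        rw [PathClass.comp_one, treeVertex_comp]
    have base : ∀ x : (tree G p).V, (tree G p).Reachable (treeBase G p) x := by
      intro x
      induction x using Quot.inductionOn with
      | _ x =>
        obtain ⟨w, α⟩ := x
        induction α using Quotient.inductionOn with
        | _ γ =>
          have := key γ (PathClass.ofVertex (1 : G.VG p))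
          rwa [PathClass.one_comp] at this
    intro x y
    exact Relation.ReflTransGen.trans (hsymm _ _ (base x)) (base y)

/-- The action of the fundamental group on the tree by concatenation on the left. -/
instance : MulAction (PiOne G p) (tree G p).V where
  smul g := Quot.map (fun x => ⟨x.1, PathClass.comp g x.2⟩) (by
    rintro _ _ ⟨α, h⟩
    exact PathClass.comp_assoc (G := G) g α (.ofVertex h) ▸ TreeVRel.intro _ h)
  one_smul x := by
    induction x using Quot.inductionOn with
    | _ x => exact congrArg (fun α => treeVertex α) (PathClass.one_comp x.2)
  mul_smul g h x := by
    induction x using Quot.inductionOn with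
    | _ x => exact congrArg (fun α => treeVertex α) (PathClass.comp_assoc g h x.2)

instance : MulAction (PiOne G p) (tree G p).E where
  smul g := Quot.map (fun x => ⟨x.e, x.v, x.hv, PathClass.comp g x.α⟩) (by
    rintro _ _ ⟨e, hv, α, h⟩
    exact PathClass.comp_assoc (G := G) g α (.ofVertex _) ▸ TreeERel.intro e hv _ h)
  one_smul x := by
    induction x using Quot.inductionOn with
    | _ x => exact congrArg (fun α => treeEdge x.e x.hv α) (PathClass.one_comp x.α)
  mul_smul g h x := by
    induction x using Quot.inductionOn with
    | _ x => exact congrArg (fun α => treeEdge x.e x.hv α) (PathClass.comp_assoc g h x.α)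

theorem treeProjE_smul (g : PiOne G p) (x : (tree G p).E) : treeProjE (g • x) = treeProjE x := by
  induction x using Quot.inductionOn
  rfl

variable (G p) in
theorem tree_action : IsGraphAction (PiOne G p) (tree G p) where
  smul_bar g x := by
    induction x using Quot.inductionOn with
    | _ x =>
      exact congrArg (fun α => treeEdge (G.bar x.e) _ α) (PathClass.comp_assoc g x.α _)
  smul_τ g x := by
    induction x using Quot.inductionOn with
    | _ x => exact congrArg (fun α => treeVertex α) (PathClass.comp_assoc g x.α _)
  no_inversion g x h := by
    have := congrArg treeProjE h
    rw [treeProjE_smul] at this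
    exact G.bar_ne _ ((treeProjE_bar x).symm.trans this.symm)

/-- The choices that determine the graph of groups `H \ T`, for the Bass–Serre tree `T` and a subgroup
`H` of the fundamental group. -/
abbrev QuotientLifts (H : Subgroup (PiOne G p)) : Type u :=
  OrbitLifts ((tree_action G p).subgroup H) (treeBase G p)

namespace QuotientLifts

variable {H : Subgroup (PiOne G p)}

/-- The graph of groups `H \ T`. -/
abbrev quotient (D : QuotientLifts H) : GraphOfGroups.{u} := D.graphOfGroups tree_connected

/-- The basepoint of `H \ T`: the image of the distinguished lift of `p`. -/
def base (D : QuotientLifts H) : D.quotient.V :=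
  orbitV ((tree_action G p).subgroup H) (treeBase G p)

/-- `r : H \ T → G` is induced by the inclusion of `H` into the fundamental group and the identity
of `T`: on graphs it is induced by the projection of `T`; it takes a loop at the basepoint, regarded as
an element of `H`, to the same element of the fundamental group; and the lifts to `T` of a path `c` from
the basepoint and of its image under `r` end at the same vertex. -/
structure IsInduced (D : QuotientLifts H) (r : Hom D.quotient G) (hr : r.onV D.base = p) :
    Prop where
  onV : ∀ x : (tree G p).V, r.onV (orbitV ((tree_action G p).subgroup H) x) = treeProjV x
  onE : ∀ e : (tree G p).E, r.onE (orbitE ((tree_action G p).subgroup H) e) = treeProjE e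
  loop : ∀ c : Path D.quotient D.base D.base,
    r.mapPiOne hr (PathClass.mk c) = (D.holonomy tree_connected c : PiOne G p)
  path : ∀ (x : D.quotient.V) (c : Path D.quotient D.base x),
    (treeVertex (r.mapClass hr (PathClass.mk c)) : (tree G p).V) =
      D.holonomy tree_connected c • D.vert x

end QuotientLifts

end GraphOfGroups

end BassSerre

open BassSerre GraphOfGroups

namespace BassSerre

/-! The proof is covering space theory, with unique path lifting replaced by unique lifting modulo
vertex groups. Let `f : L → G` be a covering map. Bijectivity on stars says that after any lifted
path, an edge of `G` preceded by a vertex group element lifts in exactly one way, up to an edge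
group element that can slide across the edge. A lift is recorded as a pair `(α, g)` of a path class
of `L` and an element of the vertex group in `G` at its end, modulo `(α l, g) ∼ (α, f(l) g)`.
Following an edge is total because star maps are surjective and single valued because they are
injective, so the fundamental groupoid of `G` acts on lifts. This yields `IsCovering.exists_lift`
and `IsCovering.lift_unique`. Injectivity on path classes follows, and so does `IsCovering.isIso`: a
covering map that is onto on fundamental groups is an isomorphism.

If the image subgroup of `ρ₁` lies in that of `ρ₂`, choose paths `α x` from the basepoint and write
`ρ₁(α x) = ρ₂(β x) g x`. The inclusion then lifts every `g x · ρ₁(θ) · (g x')⁻¹` through `ρ₂`.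
Applied to vertex group elements and to edges, this gives the data of a morphism over `(G, p)`
(`exists_lift_of_data`, `exists_hom_of_le`). It is a covering map because two out of three star maps
are bijective. If the subgroups are equal, it is onto on fundamental groups, hence an isomorphism.

For `H \ T`, choose path classes `a x` and `s e` representing the lifts. Elements of stabilizers
move these classes by right multiplication by elements of the groups of `G`, and these elements,
with the discrepancy between `t_e s_e` and `a`, define `r`. They are unique because vertex groups
embed in the fundamental groupoid (`PathClass.ofVertex_injective`), which is shown with an action on
which they act freely. Stars at `x` and at `r(x)` both enumerate the edges of `T` ending at the lift
of `x`, so `r` is a covering map. The formula `h · a y = a x · r(c)`, for `h` the element determined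
by `c`, identifies the image of `r` with `H`. -/

/-! ### Choices compatible with orientation reversal -/

theorem OGraph.eq_or_eq_bar {Γ : OGraph.{u}} {e e' : Γ.E} (h : Γ.edge e = Γ.edge e') :
    e' = e ∨ e' = Γ.bar e := by
  have key : ∀ {x y : Γ.E}, Relation.EqvGen (fun e e' : Γ.E => e' = Γ.bar e) x y →
      y = x ∨ y = Γ.bar x := by
    intro x y h
    induction h with
    | rel x y h => exact .inr h
    | refl x => exact .inl rfl
    | symm x y _ ih =>
      rcases ih with rfl | rfl
      · exact .inl rfl
      · exact .inr (Γ.bar_bar x).symm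
    | trans x y z _ _ ih ih' =>
      rcases ih with rfl | rfl <;> rcases ih' with rfl | rfl
      · exact .inl rfl
      · exact .inr rfl
      · exact .inr rfl
      · exact .inl (Γ.bar_bar x)
  exact key (Quot.eqvGen_exact h)

/-- Elements attached to oriented edges can be chosen compatibly with orientation reversal. -/
theorem OGraph.exists_bar_compatible {Γ : OGraph.{u}} {B : Γ.E → Type*}
    (R : ∀ e e', B e → B e' → Prop)
    (hsymm : ∀ e b b', R e (Γ.bar e) b b' → R (Γ.bar e) e b' b)
    (h : ∀ e, ∃ b b', R e (Γ.bar e) b b') :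
    ∃ b : ∀ e, B e, ∀ e, R e (Γ.bar e) (b e) (b (Γ.bar e)) := by
  classical
  choose b₁ b₂ hb using h
  -- One orientation of each edge is preferred: `b₁` is used there, and the matching `b₂`,
  -- transported along an equality of edges, on its reversal. The two cases are disjoint since `bar`
  -- has no fixed points.
  let rep : Γ.Edge → Γ.E := fun a => (Quot.exists_rep a).choose
  have hrep : ∀ a, Γ.edge (rep a) = a := fun a => (Quot.exists_rep a).choose_spec
  have hcase : ∀ e, e = rep (Γ.edge e) ∨ e = Γ.bar (rep (Γ.edge e)) :=
    fun e => OGraph.eq_or_eq_bar (hrep _)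
  let b : ∀ e, B e := fun e => if h : e = rep (Γ.edge e) then b₁ e else
    ((hcase e).resolve_left h).symm ▸ b₂ (rep (Γ.edge e))
  have hb₁ : ∀ e, rep (Γ.edge e) = e → b e = b₁ e := fun e he => dif_pos he.symm
  have hb₂ : ∀ e, rep (Γ.edge e) = e → b (Γ.bar e) = b₂ e := by
    intro e he
    have hne : ¬ Γ.bar e = rep (Γ.edge (Γ.bar e)) := by
      rw [Γ.edge_bar, he]
      exact Γ.bar_ne e
    have : rep (Γ.edge (Γ.bar e)) = e := by rw [Γ.edge_bar, he]
    have h' : b (Γ.bar e) = _ := dif_neg hne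
    rw [h']
    have gen : ∀ (e' : Γ.E) (_ : e' = e) (h : Γ.bar e' = Γ.bar e), h ▸ b₂ e' = b₂ e := by
      rintro _ rfl h
      rfl
    exact gen _ this _
  refine ⟨b, fun e => ?_⟩
  rcases hcase e with he | he
  · rw [hb₁ e he.symm, hb₂ e he.symm]
    exact hb e
  · obtain ⟨e', hr⟩ : ∃ e', rep (Γ.edge e) = e' := ⟨_, rfl⟩
    rw [hr] at he
    subst he
    have he' : rep (Γ.edge e') = e' := by rwa [Γ.edge_bar] at hr
    have : ∀ e'', e'' = e' → R (Γ.bar e') e'' (b (Γ.bar e')) (b e'') := by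
      rintro _ rfl
      rw [hb₁ _ he', hb₂ _ he']
      exact hsymm _ _ _ (hb _)
    exact this _ (Γ.bar_bar e')

namespace GraphOfGroups

/-! ### Path classes -/

namespace PathClass

variable {G : GraphOfGroups.{u}}

theorem comp_reverse {v w : G.V} (α : PathClass G v w) : α.comp α.reverse = ofVertex 1 := by
  induction α using Quotient.inductionOn
  exact Quotient.sound (Path.comp_reverse _)

theorem comp_left_cancel {v w x : G.V} (α : PathClass G v w) {β γ : PathClass G w x}
    (h : α.comp β = α.comp γ) : β = γ := by
  rw [← one_comp β, ← reverse_comp α, comp_assoc, h, ← comp_assoc, reverse_comp, one_comp]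

theorem comp_right_cancel {v w x : G.V} {α β : PathClass G v w} (γ : PathClass G w x)
    (h : α.comp γ = β.comp γ) : α = β := by
  rw [← comp_one α, ← comp_reverse γ, ← comp_assoc, h, comp_assoc, comp_reverse, comp_one]

theorem ofVertex_comp_ofVertex {v : G.V} (g h : G.VG v) :
    (ofVertex g).comp (ofVertex h) = ofVertex (g * h) := rfl

theorem comp_ofVertex_ofVertex {v w : G.V} (α : PathClass G v w) (g h : G.VG w) :
    (α.comp (ofVertex g)).comp (ofVertex h) = α.comp (ofVertex (g * h)) := comp_assoc _ _ _

theorem ofEdge_congr {v w : G.V} {e e' : G.E} (h : e = e') (hv : G.τ (G.bar e) = v)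
    (hw : G.τ e = w) (hv' : G.τ (G.bar e') = v) (hw' : G.τ e' = w) :
    ofEdge e hv hw = ofEdge e' hv' hw' := by
  subst h; rfl

theorem slide' {v w : G.V} (e : G.E) {a : G.Edge} (ha : G.edge e = a)
    (ha' : G.edge (G.bar e) = a) (hv : G.τ (G.bar e) = v) (hw : G.τ e = w) (h : G.EG a) :
    (ofVertex (G.inc (G.bar e) ha' hv h)).comp (ofEdge e hv hw) =
      (ofEdge e hv hw).comp (ofVertex (G.inc e ha hw h)) := by
  subst ha
  exact slide e hv hw h

theorem ofVertex_comp_ofVertex_comp {v w : G.V} (g h : G.VG v) (α : PathClass G v w) :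
    (ofVertex g).comp ((ofVertex h).comp α) = (ofVertex (g * h)).comp α :=
  (comp_assoc _ _ _).symm

theorem slide_comp {v w x : G.V} (e : G.E) {a : G.Edge} (ha : G.edge e = a)
    (ha' : G.edge (G.bar e) = a) (hv : G.τ (G.bar e) = v) (hw : G.τ e = w) (h : G.EG a)
    (g : G.VG v) (α : PathClass G w x) :
    (ofVertex (g * G.inc (G.bar e) ha' hv h)).comp ((ofEdge e hv hw).comp α) =
      (ofVertex g).comp ((ofEdge e hv hw).comp ((ofVertex (G.inc e ha hw h)).comp α)) := by
  rw [ofVertex_mul, comp_assoc, ← comp_assoc (ofVertex (G.inc _ _ _ _)), slide' e ha ha', comp_assoc]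

theorem mk_cons {v u w : G.V} (g : G.VG v) (e : G.E) (hv : G.τ (G.bar e) = v) (hu : G.τ e = u)
    (γ : Path G u w) :
    mk (.cons g e hv hu γ) = (ofVertex g).comp ((ofEdge e hv hu).comp (mk γ)) := by
  refine congrArg mk ?_
  simp [Path.comp, Path.lmul_cons, Path.one_lmul]

/-- Group elements and single edges generate the groupoid of path classes, so a multiplicative
identity need only be checked on them. -/
theorem induction {motive : ∀ {v w : G.V}, PathClass G v w → Prop}
    (vertex : ∀ {v : G.V} (g : G.VG v), motive (ofVertex g))
    (edge : ∀ {v w : G.V} (e : G.E) (hv : G.τ (G.bar e) = v) (hw : G.τ e = w),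
      motive (ofEdge e hv hw))
    (comp : ∀ {v w x : G.V} (α : PathClass G v w) (β : PathClass G w x),
      motive α → motive β → motive (α.comp β))
    {v w : G.V} (α : PathClass G v w) : motive α := by
  induction α using Quotient.inductionOn with
  | _ γ =>
    change motive (mk γ)
    induction γ with
    | single g => exact vertex g
    | cons g e hv hu γ ih =>
      rw [mk_cons]
      exact comp _ _ (vertex g) (comp _ _ (edge e hv hu) ih)

end PathClass

theorem exists_pathClass (G : GraphOfGroups.{u}) (v w : G.V) : Nonempty (PathClass G v w) := by
  induction G.connected.reachable v w with
  | refl => exact ⟨.ofVertex 1⟩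
  | tail _ h ih =>
    obtain ⟨e, hv, hw⟩ := h
    exact ih.map fun α => α.comp (.ofEdge e hv hw)

theorem inc_injective (G : GraphOfGroups.{u}) {a : G.Edge} {v : G.V} (e : G.E)
    (ha : G.edge e = a) (hv : G.τ e = v) : Function.Injective (G.inc e ha hv) := by
  subst ha hv
  exact G.ι_injective e

/-! ### Actions of the fundamental groupoid -/

/-- A right action of the fundamental groupoid, given on generators. -/
structure PathAction (G : GraphOfGroups.{u}) where
  X : G.V → Type u
  actV : ∀ {v}, X v → G.VG v → X v
  actE : ∀ {v w} (e : G.E), G.τ (G.bar e) = v → G.τ e = w → X v → X w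
  actV_one : ∀ {v} (s : X v), actV s 1 = s
  actV_mul : ∀ {v} (s : X v) (g h : G.VG v), actV s (g * h) = actV (actV s g) h
  actE_bar : ∀ {v w} (e : G.E) (hv : G.τ (G.bar e) = v) (hw : G.τ e = w)
    (hw' : G.τ (G.bar (G.bar e)) = w) (s : X v), actE (G.bar e) hw' hv (actE e hv hw s) = s
  actE_slide : ∀ {v w} (e : G.E) (hv : G.τ (G.bar e) = v) (hw : G.τ e = w) (s : X v)
    (h : G.EG (G.edge e)), actE e hv hw (actV s (G.inc (G.bar e) (G.edge_bar e) hv h)) =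
      actV (actE e hv hw s) (G.inc e rfl hw h)

namespace PathAction

variable {G : GraphOfGroups.{u}} (A : PathAction G)

def onPath {v w : G.V} : Path G v w → A.X v → A.X w
  | .single g, s => A.actV s g
  | .cons g e hv hu γ, s => onPath γ (A.actE e hv hu (A.actV s g))

theorem onPath_lmul {v w : G.V} (g : G.VG v) (γ : Path G v w) (s : A.X v) :
    A.onPath (γ.lmul g) s = A.onPath γ (A.actV s g) := by
  cases γ <;> simp [onPath, Path.lmul_single, Path.lmul_cons, A.actV_mul]

theorem onPath_comp {v w x : G.V} (γ : Path G v w) (γ' : Path G w x) (s : A.X v) :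
    A.onPath (γ.comp γ') s = A.onPath γ' (A.onPath γ s) := by
  induction γ with
  | single g => exact A.onPath_lmul g γ' s
  | cons g e hv hu γ ih => exact ih γ' _

theorem onPath_homotopic {v w : G.V} {γ γ' : Path G v w} (h : Path.Homotopic γ γ') (s : A.X v) :
    A.onPath γ s = A.onPath γ' s := by
  induction h with
  | refl γ => rfl
  | symm _ ih => exact (ih s).symm
  | trans _ _ ih ih' => exact (ih s).trans (ih' s)
  | cons g e hv hu _ ih => exact ih _
  | backtrack g e hv hu hu' γ =>
    simp only [onPath, onPath_lmul, A.actV_one, A.actE_bar]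
  | slide g e hv hu h γ =>
    simp only [onPath, onPath_lmul, A.actV_mul, A.actE_slide]

def act {v w : G.V} (s : A.X v) (α : PathClass G v w) : A.X w :=
  Quotient.liftOn α (fun γ => A.onPath γ s) fun _ _ h => A.onPath_homotopic h s

theorem act_comp {v w x : G.V} (s : A.X v) (α : PathClass G v w) (β : PathClass G w x) :
    A.act s (α.comp β) = A.act (A.act s α) β := by
  induction α using Quotient.inductionOn
  induction β using Quotient.inductionOn
  exact A.onPath_comp _ _ s


theorem act_ofEdge {v w : G.V} (s : A.X v) (e : G.E) (hv : G.τ (G.bar e) = v) (hw : G.τ e = w) :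
    A.act s (.ofEdge e hv hw) = A.actE e hv hw s := by
  change A.actV (A.actE e hv hw (A.actV s 1)) 1 = _
  rw [A.actV_one, A.actV_one]

end PathAction

/-! ### Vertex groups embed in the fundamental groupoid -/

/-- If `S` is large, then the free right `A`-sets `B × S` and `A × S` are isomorphic. -/
theorem exists_equiv_prod_of_injective {A B S : Type u} [Group A] [Group B] (i : A →* B)
    (hi : Function.Injective i) (hS : Nonempty ((B ⧸ i.range) × S ≃ S)) :
    ∃ φ : B × S ≃ A × S, ∀ g h s, φ (g * i h, s) = ((φ (g, s)).1 * h, (φ (g, s)).2) := by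
  obtain ⟨ε⟩ := hS
  -- Coset representatives exhibit `B` as a free right `A`-set on `B ⧸ i.range`. The bijection `ε`
  -- later absorbs this index set into `S`.
  let ψ₀ : (B ⧸ i.range) × A → B := fun x => x.1.out * i x.2
  have hψ₀ : Function.Bijective ψ₀ := by
    constructor
    · rintro ⟨c, a⟩ ⟨c', a'⟩ h
      have hc : ∀ (c : B ⧸ i.range) (a : A), ((c.out * i a : B) : B ⧸ i.range) = c := by
        intro c a
        conv_rhs => rw [← QuotientGroup.out_eq' c]
        refine (QuotientGroup.eq.2 ?_).symm
        rw [inv_mul_cancel_left]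
        exact ⟨a, rfl⟩
      have h1 : c = c' := by
        rw [← hc c a, ← hc c' a']
        exact congrArg _ h
      subst h1
      exact Prod.ext rfl (hi (mul_left_cancel h))
    · intro b
      have hb : ((b : B ⧸ i.range).out)⁻¹ * b ∈ i.range :=
        QuotientGroup.eq.1 (QuotientGroup.out_eq' _)
      obtain ⟨a, ha⟩ := hb
      refine ⟨⟨b, a⟩, ?_⟩
      change (b : B ⧸ i.range).out * i a = b
      rw [ha, mul_inv_cancel_left]
  let ψ := Equiv.ofBijective ψ₀ hψ₀
  have hψ : ∀ g h, ψ.symm (g * i h) = ((ψ.symm g).1, (ψ.symm g).2 * h) := by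
    intro g h
    rw [Equiv.symm_apply_eq]
    obtain ⟨x, rfl⟩ := ψ.surjective g
    rw [Equiv.symm_apply_apply]
    change x.1.out * i x.2 * i h = x.1.out * i (x.2 * h)
    rw [map_mul, mul_assoc]
  refine ⟨{ toFun := fun x => ((ψ.symm x.1).2, ε ((ψ.symm x.1).1, x.2))
            invFun := fun y => (ψ ((ε.symm y.2).1, y.1), (ε.symm y.2).2)
            left_inv := fun x => by simp
            right_inv := fun y => by simp }, fun g h s => ?_⟩
  simp [hψ]

/-- A right action of the fundamental groupoid on which every vertex group acts freely. -/
theorem exists_free_pathAction (G : GraphOfGroups.{u}) :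
    ∃ A : PathAction G, ∀ v, ∃ s : A.X v, ∀ g h, A.actV s g = A.actV s h → g = h := by
  -- A single `S` must absorb all coset spaces: the factor `ℕ` makes it infinite, and the first
  -- factor makes it at least as large as every vertex group.
  let S : Type u := (Σ v, G.VG v) × ULift.{u} ℕ
  have hne : Nonempty S := G.connected.nonempty.map fun v => (⟨v, 1⟩, ⟨0⟩)
  have hS : ∀ {a : G.Edge} {v : G.V} (e : G.E) (ha : G.edge e = a) (hv : G.τ e = v),
      Nonempty ((G.VG v ⧸ (G.inc e ha hv).range) × S ≃ S) := by
    intro a v e ha hv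
    refine Cardinal.eq.1 ?_
    have h1 : Cardinal.aleph0 ≤ Cardinal.mk S := by
      have : Nonempty (Σ v, G.VG v) := hne.map Prod.fst
      exact Cardinal.aleph0_le_mk S
    have h2 : Cardinal.mk (G.VG v ⧸ (G.inc e ha hv).range) ≤ Cardinal.mk S :=
      Cardinal.mk_quotient_le.trans (Cardinal.mk_le_of_injective
        (f := fun g : G.VG v => ((⟨v, g⟩, ⟨0⟩) : S)) fun g h hgh => by
          simpa using congrArg Prod.fst hgh)
    rw [Cardinal.mk_prod, Cardinal.lift_id, Cardinal.lift_id]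
    exact Cardinal.mul_eq_right h1 h2 (Cardinal.mk_ne_zero _)
  choose φ hφ using fun {a : G.Edge} {v : G.V} (e : G.E) (ha : G.edge e = a) (hv : G.τ e = v) =>
    exists_equiv_prod_of_injective (G.inc e ha hv) (G.inc_injective e ha hv) (hS e ha hv)
  -- At both ends of an edge the fibre is identified with the same free edge group set, and the edge
  -- acts by passing through it. The reversed edge is then the inverse map, and equivariance of `φ`
  -- is the slide relation.
  let T : ∀ {a : G.Edge} {v w : G.V} (e e' : G.E), G.edge e = a → G.edge e' = a → G.τ e' = v →
      G.τ e = w → G.VG v × S → G.VG w × S :=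
    fun e e' ha ha' hv hw x => (φ e ha hw).symm (φ e' ha' hv x)
  have hT : ∀ {a a' : G.Edge} {v w : G.V} (e e' e'' : G.E) (ha : G.edge e = a)
      (ha' : G.edge e' = a) (hb : G.edge e' = a') (hb' : G.edge e'' = a') (hv : G.τ e' = v)
      (hw : G.τ e = w) (hw' : G.τ e'' = w) (_ : e'' = e) (x : G.VG v × S),
      T e' e'' hb hb' hw' hv (T e e' ha ha' hv hw x) = x := by
    intro a a' v w e e' e'' ha ha' hb hb' hv hw hw' he x
    subst he ha hb
    have : G.edge e'' = G.edge e' := hb'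
    simp only [T]
    have key : ∀ (a : G.Edge) (ha : G.edge e'' = a) (ha' : G.edge e' = a),
        (φ e' rfl hv).symm (φ e'' hb' hw ((φ e'' ha hw).symm (φ e' ha' hv x))) = x := by
      intro a ha ha'
      subst ha'
      simp
    exact key _ _ _
  refine ⟨{ X := fun v => G.VG v × S
            actV := fun s g => (s.1 * g, s.2)
            actE := fun e hv hw => T e (G.bar e) rfl (G.edge_bar e) hv hw
            actV_one := fun s => by simp
            actV_mul := fun s g h => by simp [mul_assoc]
            actE_bar := fun e hv hw hw' s => hT _ _ _ _ _ _ _ _ _ _ (G.bar_bar e) s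
            actE_slide := fun e hv hw s h => ?_ }, fun v => ?_⟩
  · obtain ⟨g, s⟩ := s
    simp only [T]
    rw [Equiv.symm_apply_eq, hφ, hφ]
    simp
  · obtain ⟨s⟩ := hne
    exact ⟨(1, s), fun g h hgh => by simpa using hgh⟩

/-- Different elements move a point with free orbit to different points. This takes the place of a
normal form theorem for path classes. -/
theorem PathClass.ofVertex_injective {G : GraphOfGroups.{u}} {v : G.V} :
    Function.Injective (ofVertex : G.VG v → PathClass G v v) := by
  intro g h hgh
  obtain ⟨A, hA⟩ := exists_free_pathAction G
  obtain ⟨s, hs⟩ := hA v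
  exact hs g h (congrArg (A.act s) hgh)

theorem PathClass.comp_ofVertex_cancel {G : GraphOfGroups.{u}} {v w : G.V} (α : PathClass G v w)
    {g h : G.VG w} (hgh : α.comp (ofVertex g) = α.comp (ofVertex h)) : g = h :=
  ofVertex_injective (comp_left_cancel α hgh)

/-! ### Morphisms with named sources and targets -/

namespace Hom

variable {K L G : GraphOfGroups.{u}} (f : Hom L G)

/-- `f_x`, with the image of `x` named by an element equal to it. -/
def onVG {x : L.V} {w : G.V} (hx : f.onV x = w) : L.VG x →* G.VG w :=
  match w, hx with
  | _, rfl => f.vhom x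

/-- `f_a`, with the image of `a` named by an element equal to it. -/
def onEG {a : L.Edge} {b : G.Edge} (ha : f.onEdge a = b) : L.EG a →* G.EG b :=
  match b, ha with
  | _, rfl => f.ehom a

/-- `δ_e`, with the image of the terminal vertex of `e` named by an element equal to it. -/
def delta {w : G.V} (e : L.E) (he : f.onV (L.τ e) = w) : G.VG w :=
  match w, he with
  | _, rfl => f.δ e

theorem onVG_rfl (x : L.V) : f.onVG (rfl : f.onV x = f.onV x) = f.vhom x := rfl

theorem delta_eq_δ' {x : L.V} (e : L.E) (he : L.τ e = x) (h : f.onV (L.τ e) = f.onV x) :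
    f.delta e h = f.δ' e he := by
  subst he; rfl

theorem delta_congr {w : G.V} {e e' : L.E} (h : e = e') (he : f.onV (L.τ e) = w)
    (he' : f.onV (L.τ e') = w) : f.delta e he = f.delta e' he' := by
  subst h; rfl

theorem edge_onE_of_eq {e : L.E} {a : L.Edge} {e' : G.E} (he : L.edge e = a)
    (h : f.onE e = e') : f.onEdge a = G.edge e' := by
  subst he h
  exact (f.edge_onE e).symm

theorem onVG_inc {e : L.E} {e' : G.E} {a : L.Edge} {b : G.Edge} {x : L.V} {w : G.V}
    (he : f.onE e = e') (ha : L.edge e = a) (hb : f.onEdge a = b) (hb' : G.edge e' = b)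
    (hx : L.τ e = x) (hw : f.onV x = w) (hw' : G.τ e' = w) (h : f.onV (L.τ e) = w)
    (m : L.EG a) :
    f.onVG hw (L.inc e ha hx m) =
      f.delta e h * G.inc e' hb' hw' (f.onEG hb m) * (f.delta e h)⁻¹ := by
  subst he ha hx hw hb
  exact f.pseudonatural'' e rfl rfl m _

/-- The action on homotopy classes of paths, with the images of the endpoints named by elements equal
to them. -/
def onClass {x y : L.V} {v w : G.V} (hx : f.onV x = v) (hy : f.onV y = w)
    (α : PathClass L x y) : PathClass G v w :=
  match v, w, hx, hy with
  | _, _, rfl, rfl => f.mapClass rfl α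

theorem onClass_comp {x y z : L.V} {v w u : G.V} (hx : f.onV x = v) (hy : f.onV y = w)
    (hz : f.onV z = u) (α : PathClass L x y) (β : PathClass L y z) :
    f.onClass hx hz (α.comp β) = (f.onClass hx hy α).comp (f.onClass hy hz β) := by
  subst hx hy hz
  induction α using Quotient.inductionOn
  induction β using Quotient.inductionOn
  exact congrArg PathClass.mk (f.mapPath_comp _ _)

theorem onClass_ofVertex {x : L.V} {v : G.V} (hx hx' : f.onV x = v) (g : L.VG x) :
    f.onClass hx hx' (.ofVertex g) = .ofVertex (f.onVG hx g) := by
  subst hx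
  rfl

theorem onClass_ofEdge {x y : L.V} {v w : G.V} {e : L.E} {e' : G.E} (he : f.onE e = e')
    (hx : f.onV x = v) (hy : f.onV y = w) (hex : L.τ (L.bar e) = x) (hey : L.τ e = y)
    (hv : G.τ (G.bar e') = v) (hw : G.τ e' = w)
    (h : f.onV (L.τ (L.bar e)) = v) (h' : f.onV (L.τ e) = w) :
    f.onClass hx hy (.ofEdge e hex hey) =
      ((PathClass.ofVertex (f.delta (L.bar e) h)).comp (.ofEdge e' hv hw)).comp
        (.ofVertex (f.delta e h')⁻¹) := by
  subst he hx hy hex hey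
  refine congrArg PathClass.mk ?_
  simp [Path.comp, Path.lmul_cons, Path.lmul_single, mapPath]
  exact ⟨rfl, rfl⟩

theorem mapClass_eq {x y : L.V} {v : G.V} (hx : f.onV x = v) (α : PathClass L x y) :
    f.mapClass hx α = f.onClass hx rfl α := by
  subst hx; rfl

theorem mapPiOne_eq {x : L.V} {v : G.V} (hx : f.onV x = v) (α : PiOne L x) :
    f.mapPiOne hx α = f.onClass hx hx α := by
  subst hx; rfl

theorem onVG_comp (k : Hom K L) {x : K.V} {y : L.V} {w : G.V} (hx : k.onV x = y)
    (hy : f.onV y = w) (hw : (f.comp k).onV x = w) (g : K.VG x) :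
    (f.comp k).onVG hw g = f.onVG hy (k.onVG hx g) := by
  subst hx hy; rfl

theorem onEG_comp (k : Hom K L) {x : K.Edge} {y : L.Edge} {w : G.Edge} (hx : k.onEdge x = y)
    (hy : f.onEdge y = w) (hw : (f.comp k).onEdge x = w) (g : K.EG x) :
    (f.comp k).onEG hw g = f.onEG hy (k.onEG hx g) := by
  subst hx hy; rfl

theorem delta_comp (k : Hom K L) {e : K.E} {e' : L.E} {y : L.V} {w : G.V} (he : k.onE e = e')
    (hy : k.onV (K.τ e) = y) (hw : f.onV y = w) (h : f.onV (L.τ e') = w)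
    (h' : (f.comp k).onV (K.τ e) = w) :
    (f.comp k).delta e h' = f.onVG hw (k.delta e hy) * f.delta e' h := by
  subst he hy hw
  rw [f.delta_eq_δ' _ (k.τ_onE e)]
  rfl

theorem onClass_comp_hom (k : Hom K L) {x x' : K.V} {y y' : L.V} {w w' : G.V} (hx : k.onV x = y)
    (hx' : k.onV x' = y') (hy : f.onV y = w) (hy' : f.onV y' = w')
    (h : (f.comp k).onV x = w) (h' : (f.comp k).onV x' = w') (α : PathClass K x x') :
    (f.comp k).onClass h h' α = f.onClass hy hy' (k.onClass hx hx' α) := by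
  induction α using PathClass.induction generalizing y y' w w' with
  | vertex g =>
    subst hx hy hx' hy'
    rfl
  | @edge v v' e hv hw =>
    subst hv hw
    have e1 := k.τ_bar_onE (e := e) rfl
    have e2 := k.τ_onE e
    rw [k.onClass_ofEdge rfl hx hx' rfl rfl (e1.trans hx) (e2.trans hx') hx hx',
      f.onClass_comp hy hy', f.onClass_comp hy hy, f.onClass_ofVertex, f.onClass_ofVertex,
      f.onClass_ofEdge rfl hy hy' (e1.trans hx) (e2.trans hx')
        (((f.τ_bar_onE rfl).trans (congrArg f.onV (e1.trans hx))).trans hy)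
        (((f.τ_onE _).trans (congrArg f.onV (e2.trans hx'))).trans hy')
        ((congrArg f.onV (e1.trans hx)).trans hy) ((congrArg f.onV (e2.trans hx')).trans hy'),
      (f.comp k).onClass_ofEdge rfl h h' rfl rfl
        (((f.τ_bar_onE rfl).trans (congrArg f.onV (e1.trans hx))).trans hy)
        (((f.τ_onE _).trans (congrArg f.onV (e2.trans hx'))).trans hy') h h',
      f.delta_comp k rfl hx' hy' ((congrArg f.onV (e2.trans hx')).trans hy') h',
      f.delta_comp k (k.onE_bar e) hx hy ((congrArg f.onV (e1.trans hx)).trans hy) h]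
    simp only [PathClass.comp_assoc, mul_inv_rev, PathClass.ofVertex_mul, map_inv]
    rfl
  | @comp a b c α β ihα ihβ =>
    rw [k.onClass_comp hx rfl hx', f.onClass_comp hy rfl hy',
      (f.comp k).onClass_comp h (rfl : _ = f.onV (k.onV b)) h', ihα hx rfl hy rfl h rfl,
      ihβ rfl hx' rfl hy' rfl h']

theorem twist_onV (g : ∀ v, G.VG (f.onV v)) (k : ∀ a, G.EG (f.onEdge a)) (x : L.V) :
    (f.twist g k).onV x = f.onV x := rfl

theorem twist_onE (g : ∀ v, G.VG (f.onV v)) (k : ∀ a, G.EG (f.onEdge a)) (e : L.E) :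
    (f.twist g k).onE e = f.onE e := rfl

theorem twist_delta (g : ∀ v, G.VG (f.onV v)) (k : ∀ a, G.EG (f.onEdge a)) {e : L.E} {e' : G.E}
    (he : f.onE e = e') {a : L.Edge} (ha : L.edge e = a) (ha' : G.edge e' = f.onEdge a)
    (hv : G.τ e' = f.onV (L.τ e)) :
    (f.twist g k).delta e (f.twist_onV g k _) =
      g (L.τ e) * f.delta e rfl * G.inc e' ha' hv (k a) := by
  subst he ha
  rfl

/-- Equivalent morphisms act on path classes in the same way up to vertex group elements. -/
theorem onClass_twist (g : ∀ v, G.VG (f.onV v)) (k : ∀ a, G.EG (f.onEdge a)) {x y : L.V}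
    (α : PathClass L x y) :
    (PathClass.ofVertex (g x)).comp (f.onClass rfl rfl α) =
      ((f.twist g k).onClass (f.twist_onV g k x) (f.twist_onV g k y) α).comp
        (.ofVertex (g y)) := by
  induction α using PathClass.induction with
  | vertex h =>
    change PathClass.ofVertex (g _ * f.vhom _ h) =
      PathClass.ofVertex (g _ * f.vhom _ h * (g _)⁻¹ * g _)
    rw [inv_mul_cancel_right]
  | @edge v v' e hv hw =>
    subst hv hw
    have ha : G.edge (f.onE e) = f.onEdge (L.edge e) := f.edge_onE e
    have ha' : G.edge (G.bar (f.onE e)) = f.onEdge (L.edge e) := (G.edge_bar _).trans ha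
    rw [f.onClass_ofEdge rfl rfl rfl rfl rfl (f.τ_bar_onE rfl) (f.τ_onE e) rfl rfl,
      (f.twist g k).onClass_ofEdge (f.twist_onE g k e) (f.twist_onV g k _) (f.twist_onV g k _)
        rfl rfl (f.τ_bar_onE rfl) (f.τ_onE e) (f.twist_onV g k _) (f.twist_onV g k _),
      f.twist_delta g k rfl rfl ha (f.τ_onE e),
      f.twist_delta g k (f.onE_bar e) (L.edge_bar e) ha' (f.τ_bar_onE rfl)]
    -- The same `k` occurs in the twisted `δ` of `e` and of its reversal. Sliding `ι_ē(k)` across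
    -- the edge makes it cancel against `ι_e(k)⁻¹`.
    simp only [PathClass.comp_assoc, PathClass.ofVertex_comp_ofVertex_comp,
      PathClass.slide_comp _ ha, PathClass.ofVertex_comp_ofVertex]
    congr 3
    group
  | @comp a b c α β ihα ihβ =>
    rw [f.onClass_comp rfl rfl rfl, (f.twist g k).onClass_comp _ (f.twist_onV g k b) _,
      ← PathClass.comp_assoc, ihα, PathClass.comp_assoc, ihβ, ← PathClass.comp_assoc]

end Hom

/-! ### Stars and local maps in terms of representatives -/

/-- The element `[g]` of `G_v / ι_e(G_e)`. -/
def Star.mk {G : GraphOfGroups.{u}} {v : G.V} (e : G.E) (h : G.τ e = v) (g : G.VG v) : G.Star v :=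
  ⟨⟨e, h⟩, (g : G.VG v ⧸ (G.inc e rfl h).range)⟩

theorem Star.exists_rep {G : GraphOfGroups.{u}} {v : G.V} (s : G.Star v) :
    ∃ (e : G.E) (h : G.τ e = v) (g : G.VG v), s = Star.mk e h g := by
  obtain ⟨⟨e, h⟩, c⟩ := s
  induction c using QuotientGroup.induction_on with | _ g =>
  exact ⟨e, h, g, rfl⟩

theorem Star.mk_eq_mk {G : GraphOfGroups.{u}} {v : G.V} {e e' : G.E} (h : G.τ e = v)
    (h' : G.τ e' = v) (g g' : G.VG v) : Star.mk e h g = Star.mk e' h' g' ↔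
      e = e' ∧ ∃ k : G.EG (G.edge e'), g = g' * G.inc e' rfl h' k := by
  constructor
  · intro H
    obtain ⟨h1, h2⟩ := Sigma.mk.inj_iff.1 H
    obtain rfl : e = e' := congrArg Subtype.val h1
    refine ⟨rfl, ?_⟩
    obtain ⟨k, hk⟩ := QuotientGroup.eq.1 (eq_of_heq h2).symm
    exact ⟨k, by rw [hk, mul_inv_cancel_left]⟩
  · rintro ⟨rfl, k, rfl⟩
    refine congrArg (Sigma.mk (β := fun e : {e : G.E // G.τ e = v} =>
      G.VG v ⧸ (G.inc e.1 rfl e.2).range) ⟨e, h⟩) ?_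
    refine (QuotientGroup.eq.2 ?_).symm
    rw [inv_mul_cancel_left]
    exact ⟨k, rfl⟩

namespace Hom

variable {L G : GraphOfGroups.{u}} (f : Hom L G)

theorem star_mk {x : L.V} (e : L.E) (h : L.τ e = x) (l : L.VG x) :
    f.star x (Star.mk e h l) = Star.mk (f.onE e) (f.τ_onE' h) (f.vhom x l * f.δ' e h) := rfl

/-- This removes the coset spaces: `k` is the ambiguity in the coset downstairs, and `m` the
ambiguity upstairs. -/
theorem star_injective_iff (x : L.V) : Function.Injective (f.star x) ↔
    ∀ (e₁ e₂ : L.E) (h₁ : L.τ e₁ = x) (h₂ : L.τ e₂ = x) (l₁ l₂ : L.VG x)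
      (k : G.EG (G.edge (f.onE e₂))), f.onE e₁ = f.onE e₂ →
      f.vhom x l₁ * f.δ' e₁ h₁ =
        f.vhom x l₂ * f.δ' e₂ h₂ * G.inc (f.onE e₂) rfl (f.τ_onE' h₂) k →
      e₁ = e₂ ∧ ∃ m : L.EG (L.edge e₂), l₁ = l₂ * L.inc e₂ rfl h₂ m := by
  constructor
  · intro H e₁ e₂ h₁ h₂ l₁ l₂ k he hl
    rw [← Star.mk_eq_mk h₁ h₂]
    apply H
    rw [star_mk, star_mk, Star.mk_eq_mk]
    exact ⟨he, k, hl⟩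
  · intro H s₁ s₂ hc
    obtain ⟨e₁, h₁, l₁, rfl⟩ := s₁.exists_rep
    obtain ⟨e₂, h₂, l₂, rfl⟩ := s₂.exists_rep
    rw [star_mk, star_mk, Star.mk_eq_mk] at hc
    obtain ⟨he, k, hk⟩ := hc
    exact (Star.mk_eq_mk h₁ h₂ l₁ l₂).2 (H e₁ e₂ h₁ h₂ l₁ l₂ k he hk)

theorem star_surjective_iff (x : L.V) : Function.Surjective (f.star x) ↔
    ∀ (e' : G.E) (h' : G.τ e' = f.onV x) (g : G.VG (f.onV x)),
      ∃ (e : L.E) (h : L.τ e = x) (l : L.VG x) (k : G.EG (G.edge e')), f.onE e = e' ∧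
        g = f.vhom x l * f.δ' e h * G.inc e' rfl h' k := by
  constructor
  · intro H e' h' g
    obtain ⟨s, hs⟩ := H (Star.mk e' h' g)
    obtain ⟨e, h, l, rfl⟩ := s.exists_rep
    rw [star_mk] at hs
    obtain ⟨he, k, hk⟩ := (Star.mk_eq_mk h' (f.τ_onE' h) _ _).1 hs.symm
    subst he
    exact ⟨e, h, l, k, rfl, hk⟩
  · intro H s
    obtain ⟨e', h', g, rfl⟩ := s.exists_rep
    obtain ⟨e, h, l, k, he, hk⟩ := H e' h' g
    subst he
    refine ⟨Star.mk e h l, ?_⟩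
    rw [star_mk]
    exact ((Star.mk_eq_mk h' (f.τ_onE' h) _ _).2 ⟨rfl, k, hk⟩).symm

variable {f}

theorem eq_of_star_injective {x : L.V} (hf : Function.Injective (f.star x)) {w : G.V}
    (hx : f.onV x = w) {e₁ e₂ : L.E} {e' : G.E} (he₁ : f.onE e₁ = e') (he₂ : f.onE e₂ = e')
    (h₁ : L.τ e₁ = x) (h₂ : L.τ e₂ = x) (d₁ : f.onV (L.τ e₁) = w) (d₂ : f.onV (L.τ e₂) = w)
    {b : G.Edge} (hb : G.edge e' = b) (hw : G.τ e' = w) {a : L.Edge} (ha : L.edge e₂ = a)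
    {l₁ l₂ : L.VG x} {k : G.EG b}
    (h : f.onVG hx l₁ * f.delta e₁ d₁ = f.onVG hx l₂ * f.delta e₂ d₂ * G.inc e' hb hw k) :
    e₁ = e₂ ∧ ∃ m : L.EG a, l₁ = l₂ * L.inc e₂ ha h₂ m := by
  subst hx he₂ hb ha
  rw [f.delta_eq_δ' e₁ h₁, f.delta_eq_δ' e₂ h₂] at h
  exact (f.star_injective_iff x).1 hf e₁ e₂ h₁ h₂ l₁ l₂ k he₁ h

theorem exists_of_star_surjective {x : L.V} (hf : Function.Surjective (f.star x)) {w : G.V}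
    (hx : f.onV x = w) (e' : G.E) (hw : G.τ e' = w) {b : G.Edge} (hb : G.edge e' = b)
    (g : G.VG w) :
    ∃ (e : L.E) (_ : L.τ e = x) (l : L.VG x) (k : G.EG b) (d : f.onV (L.τ e) = w),
      f.onE e = e' ∧ g = f.onVG hx l * f.delta e d * G.inc e' hb hw k := by
  subst hx hb
  obtain ⟨e, h, l, k, he, hg⟩ := (f.star_surjective_iff x).1 hf e' hw g
  refine ⟨e, h, l, k, congrArg f.onV h, he, ?_⟩
  rwa [f.delta_eq_δ' e h]

end Hom

/-! ### Lifting path classes along covering maps -/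

namespace Hom

variable {L G : GraphOfGroups.{u}} (f : Hom L G)

/-- A path class of `L` from `q` to a vertex over `w`, with an element of the vertex group of `w`. -/
structure PreLift (q : L.V) (w : G.V) where
  x : L.V
  hx : f.onV x = w
  α : PathClass L q x
  g : G.VG w

variable {f}

/-- `(α l, g) ∼ (α, f(l) g)`. -/
def PreLift.Rel {q : L.V} {w : G.V} (s s' : f.PreLift q w) : Prop :=
  ∃ l : L.VG s'.x, (⟨s.x, s.α⟩ : Σ x, PathClass L q x) = ⟨s'.x, s'.α.comp (.ofVertex l)⟩ ∧
    f.onVG s'.hx l * s.g = s'.g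

theorem PreLift.rel_equivalence {q : L.V} {w : G.V} :
    Equivalence (PreLift.Rel (f := f) (q := q) (w := w)) where
  refl s := ⟨1, by rw [PathClass.comp_one], by rw [map_one, one_mul]⟩
  symm := by
    rintro ⟨x, hx, α, g⟩ ⟨x', hx', α', g'⟩ ⟨l, h, hg⟩
    dsimp only at l h hg
    obtain ⟨rfl, h⟩ := Sigma.mk.inj_iff.1 h
    obtain rfl := eq_of_heq h
    refine ⟨l⁻¹, ?_, ?_⟩
    · dsimp only
      rw [PathClass.comp_ofVertex_ofVertex, mul_inv_cancel, PathClass.comp_one]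
    · dsimp only
      rw [map_inv, ← hg, inv_mul_cancel_left]
  trans := by
    rintro ⟨x, hx, α, g⟩ ⟨x', hx', α', g'⟩ ⟨x'', hx'', α'', g''⟩ ⟨l, h, hg⟩ ⟨l', h', hg'⟩
    dsimp only at l h hg l' h' hg'
    obtain ⟨rfl, h'⟩ := Sigma.mk.inj_iff.1 h'
    obtain rfl := eq_of_heq h'
    obtain ⟨rfl, h⟩ := Sigma.mk.inj_iff.1 h
    obtain rfl := eq_of_heq h
    refine ⟨l' * l, ?_, ?_⟩
    · dsimp only
      rw [PathClass.comp_ofVertex_ofVertex]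
    · dsimp only
      rw [map_mul, mul_assoc, hg, hg']

def PreLift.setoid (f : Hom L G) (q : L.V) (w : G.V) : Setoid (f.PreLift q w) :=
  ⟨PreLift.Rel, PreLift.rel_equivalence⟩

variable (f) in
/-- The fibre over `w` of the universal right action obtained by lifting paths to `L`. -/
def Lift (q : L.V) (w : G.V) : Type u := Quotient (PreLift.setoid f q w)

namespace Lift

variable {q : L.V}

def mk {x : L.V} {w : G.V} (hx : f.onV x = w) (α : PathClass L q x) (g : G.VG w) : f.Lift q w :=
  Quotient.mk (PreLift.setoid f q w) ⟨x, hx, α, g⟩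

theorem exists_rep {w : G.V} (s : f.Lift q w) :
    ∃ (x : L.V) (hx : f.onV x = w) (α : PathClass L q x) (g : G.VG w), s = mk hx α g := by
  induction s using Quotient.inductionOn with
  | _ s => exact ⟨s.x, s.hx, s.α, s.g, rfl⟩

theorem mk_comp {x : L.V} {w : G.V} (hx : f.onV x = w) (α : PathClass L q x) (l : L.VG x)
    (g : G.VG w) : mk hx (α.comp (.ofVertex l)) g = mk hx α (f.onVG hx l * g) :=
  Quotient.sound (s := PreLift.setoid f q w) ⟨l, rfl, rfl⟩

theorem mk_eq_mk {x x' : L.V} {w : G.V} {hx : f.onV x = w} {hx' : f.onV x' = w}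
    {α : PathClass L q x} {α' : PathClass L q x'} {g g' : G.VG w} (h : mk hx α g = mk hx' α' g') :
    ∃ l : L.VG x', (⟨x, α⟩ : Σ x, PathClass L q x) = ⟨x', α'.comp (.ofVertex l)⟩ ∧
      f.onVG hx' l * g = g' :=
  Quotient.exact h

def mulRight {w : G.V} (s : f.Lift q w) (g : G.VG w) : f.Lift q w :=
  Quotient.map (fun s : f.PreLift q w => (⟨s.x, s.hx, s.α, s.g * g⟩ : f.PreLift q w)) (by
    rintro _ _ ⟨l, h, hg⟩
    exact ⟨l, h, by rw [← mul_assoc, hg]⟩) s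

theorem mulRight_mk {x : L.V} {w : G.V} (hx : f.onV x = w) (α : PathClass L q x) (g h : G.VG w) :
    (mk hx α g).mulRight h = mk hx α (g * h) := rfl

/-- `t` is obtained from `s` by following the edge `e`. -/
def Step {v w : G.V} (e : G.E) (s : f.Lift q v) (t : f.Lift q w) : Prop :=
  ∃ (a : G.Edge) (ha : G.edge e = a) (ha' : G.edge (G.bar e) = a) (hv : G.τ (G.bar e) = v)
    (hw : G.τ e = w) (e' : L.E) (y z : L.V) (hy : L.τ (L.bar e') = y) (hz : L.τ e' = z)
    (hyv : f.onV y = v) (hzw : f.onV z = w) (d : f.onV (L.τ (L.bar e')) = v)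
    (d' : f.onV (L.τ e') = w) (α : PathClass L q y) (k : G.EG a), f.onE e' = e ∧
      s = mk hyv α (f.delta (L.bar e') d * G.inc (G.bar e) ha' hv k) ∧
      t = mk hzw (α.comp (.ofEdge e' hy hz)) (f.delta e' d' * G.inc e ha hw k)

/-- Both ends of a step carry the same edge group element `k`, and `α e' ē' = α`, so the same data
read backwards are a step along the reversal. -/
theorem Step.bar {v w : G.V} {e : G.E} {s : f.Lift q v} {t : f.Lift q w} (h : Step e s t) :
    Step (G.bar e) t s := by
  obtain ⟨a, ha, ha', hv, hw, e', y, z, hy, hz, hyv, hzw, d, d', α, k, he, rfl, rfl⟩ := h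
  have h₁ := L.bar_bar e'
  have h₂ := G.bar_bar e
  refine ⟨a, ha', (congrArg G.edge h₂).trans ha, (congrArg G.τ h₂).trans hw, hv, L.bar e', z, y,
    (congrArg L.τ h₁).trans hz, hy, hzw, hyv, (congrArg (fun e => f.onV (L.τ e)) h₁).trans d', d,
    α.comp (.ofEdge e' hy hz), k, (f.onE_bar e').trans (congrArg G.bar he), ?_, ?_⟩
  · rw [f.delta_congr h₁ _ d', inc_congr h₂ _ _ ha hw]
  · rw [PathClass.comp_assoc, PathClass.ofEdge_bar, PathClass.comp_one]

theorem Step.mulRight {v w : G.V} {e : G.E} {s : f.Lift q v} {t : f.Lift q w} (h : Step e s t)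
    (hv : G.τ (G.bar e) = v) (hw : G.τ e = w) {a : G.Edge} (ha : G.edge e = a)
    (ha' : G.edge (G.bar e) = a) (k : G.EG a) :
    Step e (s.mulRight (G.inc (G.bar e) ha' hv k)) (t.mulRight (G.inc e ha hw k)) := by
  obtain ⟨b, hb, hb', hv, hw, e', y, z, hy, hz, hyv, hzw, d, d', α, k', he, rfl, rfl⟩ := h
  obtain rfl : a = b := ha.symm.trans hb
  refine ⟨a, ha, ha', hv, hw, e', y, z, hy, hz, hyv, hzw, d, d', α, k' * k, he, ?_, ?_⟩
  · rw [mulRight_mk, mul_assoc, map_mul]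
  · rw [mulRight_mk, mul_assoc, map_mul]

/-- Injectivity of the star map at the end of the path, applied to the reversed edges, shows that
two lifts use the same edge and differ by some `m` in its edge group. Sliding `m` across that edge
identifies the two results. -/
theorem Step.unique (hf : f.IsImmersion) {v w : G.V} {e : G.E} {s : f.Lift q v}
    {t t' : f.Lift q w} (h : Step e s t) (h' : Step e s t') : t = t' := by
  obtain ⟨a, ha, ha', hv, hw, e₁, y, z, hy, hz, hyv, hzw, d, d', α, k, he, rfl, rfl⟩ := h
  obtain ⟨a, rfl, hb', _, _, e₂, y', z', hy', hz', hyv', hzw', c, c', β, k', he', hs, rfl⟩ := h'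
  subst ha
  obtain ⟨l, hl, hg⟩ := mk_eq_mk hs
  obtain ⟨rfl, hl⟩ := Sigma.mk.inj_iff.1 hl
  obtain rfl := eq_of_heq hl
  have key : f.onVG hyv' l * f.delta (L.bar e₁) d = f.onVG hyv' 1 * f.delta (L.bar e₂) c *
      G.inc (G.bar e) ha' hv (k' * k⁻¹) := by
    rw [map_one, one_mul, map_mul, ← mul_assoc, ← hg, map_inv]
    group
  obtain ⟨h₁, m, hm⟩ := eq_of_star_injective (hf.star y) hyv'
    ((f.onE_bar e₁).trans (congrArg G.bar he)) ((f.onE_bar e₂).trans (congrArg G.bar he'))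
    hy hy' d c ha' hv (L.edge_bar e₂) key
  obtain rfl : e₁ = e₂ := by rw [← L.bar_bar e₁, h₁, L.bar_bar]
  obtain rfl : z = z' := hz.symm.trans hz'
  rw [one_mul] at hm
  subst hm
  -- Pseudonaturality turns the comparison of the two starting points into an equation in the image
  -- of `ι_ē`, which is injective.
  have hk : f.onEG (f.edge_onE_of_eq rfl he) m * k = k' := by
    rw [f.onVG_inc (e' := G.bar e) ((f.onE_bar e₁).trans (congrArg G.bar he)) _
      (f.edge_onE_of_eq rfl he) ha' hy hyv hv d m, map_one, one_mul, inv_mul_cancel_right] at key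
    rw [G.inc_injective _ _ _ (mul_left_cancel key), inv_mul_cancel_right]
  rw [PathClass.comp_assoc, PathClass.slide' e₁ rfl, ← PathClass.comp_assoc, mk_comp,
    f.onVG_inc he rfl (f.edge_onE_of_eq rfl he) rfl hz hzw hw d' m, ← hk, map_mul]
  group

theorem Step.exists (hf : f.IsCovering) {v w : G.V} (e : G.E) (hv : G.τ (G.bar e) = v)
    (hw : G.τ e = w) (s : f.Lift q v) : ∃ t : f.Lift q w, Step e s t := by
  obtain ⟨y, hyv, α, g, rfl⟩ := exists_rep s
  -- Stars consist of edges ending at `y`, so an edge over the reversal of `e` is found first, and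
  -- the lift leaves `y` along its reversal. The factor `l` is moved into the path class.
  obtain ⟨e', hy, l, k, d, he, rfl⟩ := exists_of_star_surjective (hf.star y).2 hyv (G.bar e) hv
    (G.edge_bar e) g
  have he' : f.onE (L.bar e') = e := by rw [f.onE_bar, he, G.bar_bar]
  have hz : f.onV (L.τ (L.bar e')) = w := by rw [← f.τ_onE, he', hw]
  have hbb := L.bar_bar e'
  refine ⟨mk hz ((α.comp (.ofVertex l)).comp
      (.ofEdge (L.bar e') ((congrArg L.τ hbb).trans hy) rfl))
      (f.delta (L.bar e') hz * G.inc e rfl hw k), _, rfl, G.edge_bar e, hv, hw, L.bar e', y, _,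
      (congrArg L.τ hbb).trans hy, rfl, hyv, hz, (congrArg (fun e => f.onV (L.τ e)) hbb).trans d,
      hz, α.comp (.ofVertex l), k, he', ?_, rfl⟩
  rw [mk_comp, f.delta_congr hbb _ d, mul_assoc]

/-- The right action of the fundamental groupoid by lifting paths. -/
noncomputable def pathAction (hf : f.IsCovering) (q : L.V) : PathAction G where
  X := f.Lift q
  actV := mulRight
  actE e hv hw s := (Step.exists hf e hv hw s).choose
  actV_one s := by
    obtain ⟨y, hyv, α, g, rfl⟩ := exists_rep s
    rw [mulRight_mk, mul_one]
  actV_mul s g h := by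
    obtain ⟨y, hyv, α, g, rfl⟩ := exists_rep s
    simp only [mulRight_mk, mul_assoc]
  -- Both edge relations hold because the two sides are results of the same step: one comes from the
  -- choice, the other from reversing or translating a chosen step.
  actE_bar e hv hw hw' s := Step.unique hf.immersion
    (Step.exists hf (G.bar e) hw' hv _).choose_spec (Step.exists hf e hv hw s).choose_spec.bar
  actE_slide e hv hw s h := Step.unique hf.immersion (Step.exists hf e hv hw _).choose_spec
    ((Step.exists hf e hv hw s).choose_spec.mulRight hv hw rfl (G.edge_bar e) h)

/-- The action of path classes on lifts. -/
noncomputable def act (hf : f.IsCovering) {v w : G.V} (s : f.Lift q v) (γ : PathClass G v w) :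
    f.Lift q w :=
  (pathAction hf q).act s γ

theorem act_comp (hf : f.IsCovering) {v w x : G.V} (s : f.Lift q v) (γ : PathClass G v w)
    (δ : PathClass G w x) : s.act hf (γ.comp δ) = (s.act hf γ).act hf δ :=
  (pathAction hf q).act_comp s γ δ

theorem act_ofVertex (hf : f.IsCovering) {v : G.V} (s : f.Lift q v) (g : G.VG v) :
    s.act hf (.ofVertex g) = s.mulRight g := rfl

theorem step_act_ofEdge (hf : f.IsCovering) {v w : G.V} (s : f.Lift q v) (e : G.E)
    (hv : G.τ (G.bar e) = v) (hw : G.τ e = w) : Step e s (s.act hf (.ofEdge e hv hw)) := by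
  have h : s.act hf (.ofEdge e hv hw) = (Step.exists hf e hv hw s).choose :=
    (pathAction hf q).act_ofEdge s e hv hw
  rw [h]
  exact (Step.exists hf e hv hw s).choose_spec

/-- The image of a path of `L` lifts to that path. For an edge, the edge itself is a step with `k =
1`, and uniqueness of steps excludes any other outcome. -/
theorem act_mk_onClass (hf : f.IsCovering) {x y : L.V} {v w : G.V} (hx : f.onV x = v)
    (hy : f.onV y = w) (α : PathClass L q x) (β : PathClass L x y) :
    (mk hx α 1).act hf (f.onClass hx hy β) =
      mk hy (α.comp β) 1 := by
  induction β using PathClass.induction generalizing v w with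
  | vertex l =>
    obtain rfl : v = w := hx.symm.trans hy
    rw [f.onClass_ofVertex, mk_comp, act_ofVertex, mulRight_mk, one_mul, mul_one]
  | @edge y z e hy' hz' =>
    have hv := (f.τ_bar_onE hy').trans hx
    have hw := (f.τ_onE' hz').trans hy
    have d := (congrArg f.onV hy').trans hx
    have d' := (congrArg f.onV hz').trans hy
    rw [f.onClass_ofEdge rfl hx hy hy' hz' hv hw d d', act_comp, act_comp,
      act_ofVertex, act_ofVertex, mulRight_mk, one_mul]
    have hs : Step (f.onE e) (mk hx α (f.delta (L.bar e) d) : f.Lift q v)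
        (mk hy (α.comp (.ofEdge e hy' hz')) (f.delta e d') : f.Lift q w) :=
      ⟨_, rfl, G.edge_bar _, hv, hw, e, y, z, hy', hz', hx, hy, d, d', α, 1, rfl,
        by rw [map_one, mul_one], by rw [map_one, mul_one]⟩
    rw [Step.unique hf.immersion (step_act_ofEdge hf _ _ hv hw) hs, mulRight_mk, mul_inv_cancel]
  | @comp x y z β γ ihβ ihγ =>
    rw [f.onClass_comp hx rfl hy, act_comp, ihβ, ihγ, PathClass.comp_assoc]

/-- The path class in `G` of a lift. -/
def toPathClass {p : G.V} (hq : f.onV q = p) {w : G.V} (s : f.Lift q w) : PathClass G p w :=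
  Quotient.liftOn s (fun s : f.PreLift q w => (f.onClass hq s.hx s.α).comp (.ofVertex s.g)) (by
    rintro ⟨x, hx, α, g⟩ ⟨x', hx', α', g'⟩ ⟨l, h, hg⟩
    dsimp only at l h hg ⊢
    obtain ⟨rfl, h⟩ := Sigma.mk.inj_iff.1 h
    obtain rfl := eq_of_heq h
    rw [f.onClass_comp hq hx hx, f.onClass_ofVertex, PathClass.comp_ofVertex_ofVertex, hg])

theorem toPathClass_mk {p : G.V} (hq : f.onV q = p) {x : L.V} {w : G.V} (hx : f.onV x = w)
    (α : PathClass L q x) (g : G.VG w) :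
    (mk hx α g).toPathClass hq = (f.onClass hq hx α).comp (.ofVertex g) := rfl

theorem toPathClass_step {p : G.V} (hq : f.onV q = p) {v w : G.V} {e : G.E} {s : f.Lift q v}
    {t : f.Lift q w} (h : Step e s t) (hv : G.τ (G.bar e) = v) (hw : G.τ e = w) :
    t.toPathClass hq = (s.toPathClass hq).comp (.ofEdge e hv hw) := by
  obtain ⟨a, ha, ha', hv, hw, e', y, z, hy, hz, hyv, hzw, d, d', α, k, he, rfl, rfl⟩ := h
  rw [toPathClass_mk, toPathClass_mk, f.onClass_comp hq hyv hzw,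
    f.onClass_ofEdge he hyv hzw hy hz hv hw d d']
  simp only [PathClass.comp_assoc, PathClass.ofVertex_comp_ofVertex, inv_mul_cancel_left]
  rw [← PathClass.slide' e ha ha', ← PathClass.ofVertex_comp_ofVertex, PathClass.comp_assoc]

/-- This is what makes the action a lifting: projected to `G`, it is concatenation. -/
theorem toPathClass_act (hf : f.IsCovering) {p : G.V} (hq : f.onV q = p) {v w : G.V}
    (γ : PathClass G v w) (s : f.Lift q v) :
    (s.act hf γ).toPathClass hq = (s.toPathClass hq).comp γ := by
  induction γ using PathClass.induction with
  | vertex g =>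
    obtain ⟨x, hx, α, h, rfl⟩ := exists_rep s
    rw [act_ofVertex, mulRight_mk, toPathClass_mk, toPathClass_mk, PathClass.comp_ofVertex_ofVertex]
  | edge e hv hw =>
    exact toPathClass_step hq (step_act_ofEdge hf s e hv hw) hv hw
  | comp γ δ ihγ ihδ => rw [act_comp, ihδ, ihγ, PathClass.comp_assoc]

end Lift

/-- Every path class at the image of `q` lifts, up to an element of the last vertex group. -/
theorem IsCovering.exists_lift {f : Hom L G} (hf : f.IsCovering) {q : L.V} {p w : G.V} (hq : f.onV q = p)
    (γ : PathClass G p w) : ∃ (x : L.V) (hx : f.onV x = w) (α : PathClass L q x) (g : G.VG w),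
      γ = (f.onClass hq hx α).comp (.ofVertex g) := by
  have h := Lift.toPathClass_act hf hq γ (Lift.mk hq (.ofVertex 1) 1)
  obtain ⟨x, hx, α, g, hs⟩ := Lift.exists_rep
    ((Lift.mk hq (.ofVertex 1) 1).act hf γ)
  refine ⟨x, hx, α, g, ?_⟩
  rw [hs, Lift.toPathClass_mk, Lift.toPathClass_mk, f.onClass_ofVertex, map_one,
    PathClass.one_comp, PathClass.one_comp] at h
  exact h.symm

/-- Lifts of path classes are unique up to elements of the last vertex group. -/
theorem IsCovering.lift_unique (hf : f.IsCovering) {q : L.V} {p w : G.V} (hq : f.onV q = p)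
    {x x' : L.V} (hx : f.onV x = w) (hx' : f.onV x' = w) {α : PathClass L q x}
    {α' : PathClass L q x'} {g g' : G.VG w}
    (h : (f.onClass hq hx α).comp (.ofVertex g) = (f.onClass hq hx' α').comp (.ofVertex g')) :
    ∃ l : L.VG x', (⟨x, α⟩ : Σ x, PathClass L q x) = ⟨x', α'.comp (.ofVertex l)⟩ ∧
      f.onVG hx' l * g = g' := by
  -- The pair `(α, g)` is recovered from its path class in `G` by acting on the trivial lift, so
  -- equal classes force equality in the quotient `Lift`.
  have key : ∀ {x : L.V} (hx : f.onV x = w) (α : PathClass L q x) (g : G.VG w),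
      (Lift.mk hq (.ofVertex 1) 1).act hf
        ((f.onClass hq hx α).comp (.ofVertex g)) = Lift.mk hx α g := by
    intro x hx α g
    rw [Lift.act_comp, Lift.act_mk_onClass, Lift.act_ofVertex, Lift.mulRight_mk, one_mul, PathClass.one_comp]
  refine Lift.mk_eq_mk (hx := hx) ?_
  rw [← key hx, ← key hx', h]

end Hom

/-! ### Star maps of composites and twists, and recognition of covering maps -/

/-- The action of a vertex group on the star of the vertex. -/
def Star.lmul {G : GraphOfGroups.{u}} {v : G.V} (g : G.VG v) (s : G.Star v) : G.Star v :=
  ⟨s.1, g • s.2⟩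

theorem Star.lmul_mk {G : GraphOfGroups.{u}} {v : G.V} (g h : G.VG v) (e : G.E) (he : G.τ e = v) :
    (Star.mk e he h).lmul g = Star.mk e he (g * h) := rfl

theorem Star.lmul_bijective {G : GraphOfGroups.{u}} {v : G.V} (g : G.VG v) :
    Function.Bijective (Star.lmul g) := by
  have key : ∀ g : G.VG v, Function.LeftInverse (Star.lmul g⁻¹) (Star.lmul g) := by
    intro g s
    obtain ⟨e, h, l, rfl⟩ := s.exists_rep
    rw [Star.lmul_mk, Star.lmul_mk, inv_mul_cancel_left]
  refine ⟨(key g).injective, Function.RightInverse.surjective (g := Star.lmul g⁻¹) ?_⟩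
  have := key g⁻¹
  rwa [inv_inv] at this

namespace Hom

variable {K L G : GraphOfGroups.{u}}

theorem star_comp (f : Hom L G) (k : Hom K L) (x : K.V) :
    (f.comp k).star x = f.star (k.onV x) ∘ k.star x := by
  funext s
  obtain ⟨e, rfl, l, rfl⟩ := s.exists_rep
  change Star.mk _ _ (f.vhom _ (k.vhom _ l) * (f.vhom _ (k.δ e) * f.δ' (k.onE e) (k.τ_onE e))) =
    Star.mk _ _ (f.vhom _ (k.vhom _ l * k.δ e) * f.δ' (k.onE e) (k.τ_onE e))
  rw [map_mul, mul_assoc]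
  rfl

theorem star_twist (f : Hom L G) (g : ∀ v, G.VG (f.onV v)) (k : ∀ a, G.EG (f.onEdge a)) (x : L.V) :
    (f.twist g k).star x = Star.lmul (g x) ∘ f.star x := by
  funext s
  obtain ⟨e, rfl, l, rfl⟩ := s.exists_rep
  change Star.mk (f.onE e) (f.τ_onE e) (g _ * f.vhom _ l * (g _)⁻¹ *
      (g _ * f.δ e * G.inc (f.onE e) (f.edge_onE e) (f.τ_onE e) (k (L.edge e)))) =
    Star.mk (f.onE e) (f.τ_onE e) (g _ * (f.vhom _ l * f.δ e))
  refine (Star.mk_eq_mk _ _ _ _).2 ⟨rfl, ?_⟩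
  have key : ∀ {a : G.Edge} (ha : G.edge (f.onE e) = a) (c : G.EG a),
      ∃ c', G.inc (f.onE e) ha (f.τ_onE e) c = G.inc (f.onE e) rfl (f.τ_onE e) c' := by
    rintro _ rfl c
    exact ⟨c, rfl⟩
  obtain ⟨c, hc⟩ := key (f.edge_onE e) (k (L.edge e))
  exact ⟨c, by rw [hc]; group⟩

/-- Global surjectivity is a consequence of connectedness of `G`: by surjectivity on stars, every
edge at a vertex of the image lies in the image, hence so does its other end. -/
theorem isCovering_of_bijective {f : Hom L G} (hV : ∀ v, Function.Injective (f.vhom v))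
    (hE : ∀ a, Function.Injective (f.ehom a)) (hs : ∀ v, Function.Bijective (f.star v)) :
    f.IsCovering := by
  have hsV : Function.Surjective f.onV := by
    intro w
    obtain ⟨x₀⟩ := L.connected.nonempty
    induction G.connected.reachable (f.onV x₀) w with
    | refl => exact ⟨x₀, rfl⟩
    | tail _ h ih =>
      obtain ⟨e', hv, rfl⟩ := h
      obtain ⟨x, rfl⟩ := ih
      obtain ⟨e, h, -, -, he, -⟩ := (f.star_surjective_iff x).1 (hs x).2 (G.bar e') hv 1
      exact ⟨L.τ (L.bar e), by rw [← f.τ_onE, f.onE_bar, he, G.bar_bar]⟩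
  refine ⟨⟨hV, hE, fun v => (hs v).1⟩, hsV, ?_, hs⟩
  intro e'
  obtain ⟨x, hx⟩ := hsV (G.τ e')
  obtain ⟨e, h, -, -, he, -⟩ := (f.star_surjective_iff x).1 (hs x).2 e' hx.symm 1
  exact ⟨e, he⟩

/-- Star maps compose, so bijectivity passes to the remaining factor. Surjectivity onto `L` needs no
separate argument, as `L` is connected. -/
theorem IsCovering.of_comp {f : Hom L G} {k : Hom K L} (hf : f.IsCovering)
    (h : (f.comp k).IsCovering) : k.IsCovering := by
  refine isCovering_of_bijective (fun v => ?_) (fun a => ?_) (fun v => ?_)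
  · exact Function.Injective.of_comp (f := f.vhom _) (h.immersion.vhom v)
  · exact Function.Injective.of_comp (f := f.ehom _) (h.immersion.ehom a)
  · have := h.star v
    rw [star_comp] at this
    exact (Function.Bijective.of_comp_iff' (hf.star _) _).1 this

theorem IsCovering.of_twist {f : Hom L G} {g : ∀ v, G.VG (f.onV v)} {k : ∀ a, G.EG (f.onEdge a)}
    (h : (f.twist g k).IsCovering) : f.IsCovering := by
  refine isCovering_of_bijective (fun v => ?_) (fun a => ?_) (fun v => ?_)
  · exact Function.Injective.of_comp (f := MulAut.conj (g v)) (h.immersion.vhom v)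
  · exact Function.Injective.of_comp (f := MulAut.conj (k a)⁻¹) (h.immersion.ehom a)
  · have := h.star v
    rw [star_twist] at this
    exact (Function.Bijective.of_comp_iff' (Star.lmul_bijective _) _).1 this

theorem IsIso.isCovering {f : Hom L G} (hf : f.IsIso) : f.IsCovering := by
  refine isCovering_of_bijective (fun v => (hf.vhom v).1) (fun a => (hf.ehom a).1)
    (fun x => ⟨?_, ?_⟩)
  · rw [star_injective_iff]
    intro e₁ e₂ h₁ h₂ l₁ l₂ k he hl
    obtain rfl := hf.onE.1 he
    refine ⟨rfl, ?_⟩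
    have hsurj : ∀ {b : G.Edge} (hb : f.onEdge (L.edge e₁) = b) (k : G.EG b),
        ∃ m, f.onEG hb m = k := by
      rintro _ rfl k
      exact (hf.ehom _).2 k
    obtain ⟨m, rfl⟩ := hsurj (f.edge_onE e₁).symm k
    refine ⟨m, (hf.vhom x).1 ?_⟩
    rw [map_mul, ← f.onVG_rfl x, f.onVG_inc rfl rfl (f.edge_onE e₁).symm rfl h₁ rfl
      (f.τ_onE' h₁) (congrArg f.onV h₁), f.delta_eq_δ' e₁ h₁, f.onVG_rfl, ← mul_assoc, ← mul_assoc,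
      ← hl, mul_inv_cancel_right]
  · rw [star_surjective_iff]
    intro e' h' g
    obtain ⟨e, rfl⟩ := hf.onE.2 e'
    have h : L.τ e = x := hf.onV.1 ((f.τ_onE e).symm.trans h')
    obtain ⟨l, hl⟩ := (hf.vhom x).2 (g * (f.δ' e h)⁻¹)
    exact ⟨e, h, l, 1, rfl, by rw [hl, map_one]; group⟩

/-! ### Equivalence of morphisms, injectivity on path classes and isomorphisms -/

theorem EquivFixing.onClass_eq {q : L.V} {f f' : Hom L G} (h : EquivFixing q f f') {p : G.V}
    (hq : f.onV q = p) (hq' : f'.onV q = p) (α : PathClass L q q) :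
    f'.onClass hq' hq' α = f.onClass hq hq α := by
  subst hq
  obtain ⟨g, k, hg, rfl⟩ := h
  have := f.onClass_twist g k α
  rw [hg, PathClass.one_comp, PathClass.comp_one] at this
  exact this.symm

theorem onEdge_eq {f f' : Hom L G} (hE : ∀ e, f.onE e = f'.onE e) (a : L.Edge) :
    f.onEdge a = f'.onEdge a := by
  induction a using Quot.inductionOn with
  | _ e =>
    change f.onEdge (L.edge e) = f'.onEdge (L.edge e)
    rw [← f.edge_onE, ← f'.edge_onE, hE]

/-- A criterion for equivalence in which the conjugating elements are indexed by the target. -/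
theorem equivFixing_of_forall {q : L.V} {f f' : Hom L G} (hV : ∀ v, f.onV v = f'.onV v)
    (hE : ∀ e, f.onE e = f'.onE e) (g : ∀ v, G.VG (f'.onV v)) (k : ∀ a, G.EG (f'.onEdge a))
    (hq : g q = 1) (hvhom : ∀ v l, f'.vhom v l = g v * f.onVG (hV v) l * (g v)⁻¹)
    (hehom : ∀ a m, f'.ehom a m = (k a)⁻¹ * f.onEG (onEdge_eq hE a) m * k a)
    (hδ : ∀ e, f'.δ e = g (L.τ e) * f.delta e (hV _) *
      G.inc (f'.onE e) (f'.edge_onE e) (f'.τ_onE e) (k (L.edge e))) :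
    EquivFixing q f f' := by
  have hA := onEdge_eq hE
  -- Once the morphisms are taken apart, the equalities of underlying maps can be substituted, and
  -- all transports in the hypotheses become trivial.
  obtain ⟨fV, fE, fA, h1, h2, h3, fv, fe, fδ, h4⟩ := f
  obtain ⟨fV', fE', fA', h1', h2', h3', fv', fe', fδ', h4'⟩ := f'
  obtain rfl : fV = fV' := funext hV
  obtain rfl : fE = fE' := funext hE
  obtain rfl : fA = fA' := funext hA
  refine ⟨g, k, hq, ?_⟩
  unfold twist
  congr 1
  · funext v
    exact MonoidHom.ext fun l => hvhom v l
  · funext a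
    refine MonoidHom.ext fun m => (hehom a m).trans ?_
    simp [onEG]
  · funext e
    exact hδ e

theorem onVG_injective {f : Hom L G} (hf : ∀ v, Function.Injective (f.vhom v)) {x : L.V} {w : G.V}
    (hx : f.onV x = w) : Function.Injective (f.onVG hx) := by
  subst hx
  exact hf x

theorem onEG_injective {f : Hom L G} (hf : ∀ a, Function.Injective (f.ehom a)) {a : L.Edge}
    {b : G.Edge} (ha : f.onEdge a = b) : Function.Injective (f.onEG ha) := by
  subst ha
  exact hf a

/-- Two classes with the same image lift the same path, so they differ by some `l` with `f(l) = 1`,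
and vertex homomorphisms are injective. -/
theorem IsCovering.onClass_injective {f : Hom L G} (hf : f.IsCovering) {q x : L.V} {p w : G.V}
    (hq : f.onV q = p) (hx : f.onV x = w) : Function.Injective (f.onClass hq hx) := by
  intro α β h
  obtain ⟨l, hl, hg⟩ := hf.lift_unique hq hx hx (g := 1) (g' := 1)
    (congrArg (fun γ => γ.comp (.ofVertex 1)) h)
  obtain ⟨-, hl⟩ := Sigma.mk.inj_iff.1 hl
  rw [mul_one] at hg
  rw [eq_of_heq hl, onVG_injective hf.immersion.vhom hx (hg.trans (map_one _).symm),
    PathClass.comp_one]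

/-- A covering map which is surjective on fundamental groups is an isomorphism. -/
theorem IsCovering.isIso {f : Hom L G} (hf : f.IsCovering) {q : L.V} {p : G.V} (hq : f.onV q = p)
    (h : Function.Surjective (f.onClass hq hq)) : f.IsIso := by
  have hV : Function.Injective f.onV := by
    intro x x' hx
    obtain ⟨α⟩ := L.exists_pathClass q x
    obtain ⟨α'⟩ := L.exists_pathClass q x'
    -- A preimage `η` of this loop makes `α` and `η α'` lifts of the same path class, so they end at
    -- the same vertex.
    obtain ⟨η, hη⟩ := h ((f.onClass hq hx α).comp (f.onClass hq rfl α').reverse)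
    have key : (f.onClass hq hx α).comp (.ofVertex 1) =
        (f.onClass hq rfl (η.comp α')).comp (.ofVertex 1) := by
      rw [f.onClass_comp hq hq rfl, hη, PathClass.comp_assoc _ _ (f.onClass _ _ _),
        PathClass.reverse_comp, PathClass.comp_one, PathClass.comp_one]
    obtain ⟨l, hl, -⟩ := hf.lift_unique hq hx rfl key
    exact (Sigma.mk.inj_iff.1 hl).1
  have hvhom : ∀ x, Function.Bijective (f.vhom x) := by
    refine fun x => ⟨hf.immersion.vhom x, fun g => ?_⟩
    obtain ⟨α⟩ := L.exists_pathClass q x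
    -- For a preimage `η`, both `(η α, 1)` and `(α, g)` lift the same class, and uniqueness exhibits
    -- `g` as the image of a vertex group element.
    obtain ⟨η, hη⟩ := h (((f.onClass hq rfl α).comp (.ofVertex g)).comp (f.onClass hq rfl α).reverse)
    have key : (f.onClass hq rfl (η.comp α)).comp (.ofVertex 1) =
        (f.onClass hq rfl α).comp (.ofVertex g) := by
      rw [f.onClass_comp hq hq rfl, hη, PathClass.comp_assoc _ _ (f.onClass _ _ _),
        PathClass.reverse_comp, PathClass.comp_one, PathClass.comp_one]
    obtain ⟨l, -, hl⟩ := hf.lift_unique hq rfl rfl key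
    rw [mul_one] at hl
    exact ⟨l, hl⟩
  refine ⟨⟨hV, hf.onV⟩, ⟨fun e e' he => ?_, hf.onE⟩, hvhom, fun a => ⟨hf.immersion.ehom a, ?_⟩⟩
  · have hτ : L.τ e = L.τ e' := hV (by rw [← f.τ_onE, ← f.τ_onE, he])
    -- With vertex homomorphisms onto, `l` can be chosen to compensate the difference of the two
    -- `δ`, so the edges define star elements with equal images.
    obtain ⟨l, hl⟩ := (hvhom (L.τ e')).2 (f.δ' e' rfl * (f.δ' e hτ)⁻¹)
    exact ((f.star_injective_iff _).1 (hf.star (L.τ e')).1 e e' hτ rfl l 1 1 he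
      (by rw [hl, map_one, map_one]; group)).1
  · intro k
    induction a using Quot.inductionOn with
    | _ e =>
      change G.EG (f.onEdge (L.edge e)) at k
      -- The cosets of `l` and `1` at `e` have the same image in the star, so `l` comes from the
      -- edge group of `e`. Its preimage `m` there is the required preimage of `k`.
      obtain ⟨l, hl⟩ := (hvhom (L.τ e)).2
        (f.δ e * G.inc (f.onE e) (f.edge_onE e) (f.τ_onE e) k * (f.δ e)⁻¹)
      obtain ⟨-, m, hm⟩ := eq_of_star_injective (hf.star (L.τ e)).1 rfl rfl rfl rfl rfl rfl rfl
        (f.edge_onE e) (f.τ_onE e) rfl (l₁ := l) (l₂ := 1) (k := k)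
        (show f.vhom _ l * f.δ e = f.vhom _ 1 * f.δ e * _ by rw [hl, map_one]; group)
      refine ⟨m, ?_⟩
      rw [one_mul] at hm
      have h1 := f.pseudonatural e m
      change f.vhom _ (L.inc e rfl rfl m) = _ at h1
      rw [← hm, hl] at h1
      exact (G.inc_injective _ _ _ (mul_left_cancel (mul_right_cancel h1))).symm

end Hom

/-! ### Image subgroups and morphisms over the base -/

namespace PointedCovering

variable {G : GraphOfGroups.{u}} {p : G.V}

theorem mem_subgroup {C : PointedCovering G p} {γ : PiOne G p} :
    γ ∈ C.subgroup ↔ ∃ η : PathClass C.L C.q C.q, C.ρ.onClass C.pointed C.pointed η = γ := by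
  constructor
  · rintro ⟨η, rfl⟩
    exact ⟨η, (C.ρ.mapPiOne_eq _ _).symm⟩
  · rintro ⟨η, rfl⟩
    exact ⟨η, C.ρ.mapPiOne_eq _ _⟩

theorem IsOver.onClass_eq {C₁ C₂ : PointedCovering G p} {f : Hom C₁.L C₂.L} (h : C₁.IsOver C₂ f)
    (α : PathClass C₁.L C₁.q C₁.q) :
    C₁.ρ.onClass C₁.pointed C₁.pointed α =
      C₂.ρ.onClass C₂.pointed C₂.pointed (f.onClass h.pointed h.pointed α) := by
  have hq : (C₂.ρ.comp f).onV C₁.q = p := (congrArg C₂.ρ.onV h.pointed).trans C₂.pointed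
  rw [h.equiv.onClass_eq hq C₁.pointed,
    C₂.ρ.onClass_comp_hom f h.pointed h.pointed C₂.pointed C₂.pointed hq hq]

theorem IsOver.subgroup_le {C₁ C₂ : PointedCovering G p} {f : Hom C₁.L C₂.L}
    (h : C₁.IsOver C₂ f) : C₁.subgroup ≤ C₂.subgroup := by
  intro γ hγ
  obtain ⟨η, rfl⟩ := mem_subgroup.1 hγ
  exact mem_subgroup.2 ⟨_, (h.onClass_eq η).symm⟩

/-- No inverse morphism is needed: an isomorphism is a covering map, so loops lift through `f`. The
lift closes up because `f` is injective on vertices, and the remaining group element lifts because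
vertex homomorphisms are onto. -/
theorem IsOver.subgroup_eq {C₁ C₂ : PointedCovering G p} {f : Hom C₁.L C₂.L}
    (h : C₁.IsOver C₂ f) (hf : f.IsIso) : C₁.subgroup = C₂.subgroup := by
  refine le_antisymm h.subgroup_le fun γ hγ => ?_
  obtain ⟨η, rfl⟩ := mem_subgroup.1 hγ
  obtain ⟨x, hx, α, g, rfl⟩ := hf.isCovering.exists_lift h.pointed η
  obtain rfl : C₁.q = x := hf.onV.1 (h.pointed.trans hx.symm)
  have hsurj : ∀ {w : C₂.L.V} (hw : f.onV C₁.q = w) (g : C₂.L.VG w), ∃ l, f.onVG hw l = g := by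
    rintro _ rfl g
    exact (hf.vhom _).2 g
  obtain ⟨l, rfl⟩ := hsurj hx g
  refine mem_subgroup.2 ⟨α.comp (.ofVertex l), ?_⟩
  rw [h.onClass_eq, f.onClass_comp h.pointed h.pointed h.pointed, f.onClass_ofVertex]

/-- For a loop `η` of `C₂`, the hypothesis gives a loop `θ` with `ρ₁(θ) = ρ₂(η)`. Since `ρ₁(θ) =
ρ₂(f(θ))` and `ρ₂` is injective on classes, `f(θ) = η`. -/
theorem IsOver.isIso {C₁ C₂ : PointedCovering G p} {f : Hom C₁.L C₂.L} (h : C₁.IsOver C₂ f)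
    (hf : f.IsCovering) (hC : C₂.subgroup ≤ C₁.subgroup) : f.IsIso := by
  refine hf.isIso h.pointed fun η => ?_
  obtain ⟨θ, hθ⟩ := mem_subgroup.1 (hC (mem_subgroup.2 ⟨η, rfl⟩))
  refine ⟨θ, C₂.covering.onClass_injective C₂.pointed C₂.pointed ?_⟩
  rw [← h.onClass_eq, hθ]

end PointedCovering

/-! ### Lifting one covering map through another -/

namespace Hom

variable {L₁ L₂ G : GraphOfGroups.{u}}

/-- The elements `l` become the `δ` of the new morphism, and `g⁻¹`, `k` the equivalence from `ρ₂ f`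
to `ρ₁`. Its group homomorphisms are then forced, since those of `ρ₂` are injective:
multiplicativity and pseudonaturality can be tested after applying `ρ₂`. -/
theorem exists_lift_of_data (ρ₁ : Hom L₁ G) (ρ₂ : Hom L₂ G) (h₂ : ρ₂.IsImmersion) (q : L₁.V)
    (y : L₁.V → L₂.V) (hy : ∀ x, ρ₂.onV (y x) = ρ₁.onV x) (E : L₁.E → L₂.E)
    (hE : ∀ e, ρ₂.onE (E e) = ρ₁.onE e) (E_bar : ∀ e, E (L₁.bar e) = L₂.bar (E e))
    (τ_E : ∀ e, L₂.τ (E e) = y (L₁.τ e)) (g : ∀ x, G.VG (ρ₁.onV x)) (hq : g q = 1)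
    (k : ∀ a, G.EG (ρ₁.onEdge a)) (l : ∀ e, L₂.VG (y (L₁.τ e)))
    (hd : ∀ e, ρ₂.onV (L₂.τ (E e)) = ρ₁.onV (L₁.τ e))
    (hl : ∀ e, g (L₁.τ e) * ρ₁.δ e = ρ₂.onVG (hy _) (l e) * ρ₂.delta (E e) (hd e) *
      G.inc (ρ₁.onE e) (ρ₁.edge_onE e) (ρ₁.τ_onE e) (k (L₁.edge e)))
    (hvhom : ∀ x m, ∃ m', ρ₂.onVG (hy x) m' = g x * ρ₁.vhom x m * (g x)⁻¹) :
    ∃ f : Hom L₁ L₂, f.onV = y ∧ EquivFixing q (ρ₂.comp f) ρ₁ := by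
  choose vh hvh using hvhom
  have hEdge : ∀ {e : L₁.E} {a : L₁.Edge}, L₁.edge e = a →
      ρ₂.onEdge (L₂.edge (E e)) = ρ₁.onEdge a := by
    rintro e _ rfl
    rw [← ρ₂.edge_onE, ← ρ₁.edge_onE, hE]
  let A : L₁.Edge → L₂.Edge := Quot.lift (fun e => L₂.edge (E e)) (by
    rintro e _ rfl
    rw [E_bar, L₂.edge_bar])
  have hA : ∀ a, ρ₂.onEdge (A a) = ρ₁.onEdge a := by
    intro a
    induction a using Quot.inductionOn with | _ e => exact hEdge rfl
  have hvi := fun x => onVG_injective h₂.vhom (hy x)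
  -- The star elements of `vh (ι_e m) · l e` and of `l e` at the edge `E e` have the same image
  -- under `ρ₂`. Injectivity of the star map therefore produces the edge group element `m'`.
  have key : ∀ e (m : L₁.EG (L₁.edge e)), ∃ m' : L₂.EG (A (L₁.edge e)),
      vh (L₁.τ e) (L₁.ι e m) = l e * L₂.inc (E e) rfl (τ_E e) m' * (l e)⁻¹ ∧
      ρ₂.onEG (hA _) m' = k _ * ρ₁.ehom _ m * (k _)⁻¹ := by
    intro e m
    have h1 : ρ₂.onVG (hy _) (vh (L₁.τ e) (L₁.ι e m) * l e) * ρ₂.delta (E e) (hd e) =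
        ρ₂.onVG (hy _) (l e) * ρ₂.delta (E e) (hd e) *
          G.inc (ρ₁.onE e) (ρ₁.edge_onE e) (ρ₁.τ_onE e)
            (k (L₁.edge e) * ρ₁.ehom _ m * (k (L₁.edge e))⁻¹) := by
      rw [map_mul, hvh, ρ₁.pseudonatural, map_mul, map_mul, map_inv]
      have h := hl e
      set P := ρ₂.onVG (hy _) (l e)
      set Q := ρ₂.delta (E e) (hd e)
      set I := G.inc (ρ₁.onE e) (ρ₁.edge_onE e) (ρ₁.τ_onE e) (k (L₁.edge e))
      set J := G.inc (ρ₁.onE e) (ρ₁.edge_onE e) (ρ₁.τ_onE e) (ρ₁.ehom _ m)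
      calc g (L₁.τ e) * (ρ₁.δ e * J * (ρ₁.δ e)⁻¹) * (g (L₁.τ e))⁻¹ * P * Q =
          (g (L₁.τ e) * ρ₁.δ e) * J * (g (L₁.τ e) * ρ₁.δ e)⁻¹ * (P * Q) := by group
        _ = _ := by rw [h]; group
    obtain ⟨-, m', hm'⟩ := eq_of_star_injective (h₂.star _) (hy _) (hE e) (hE e) (τ_E e) (τ_E e)
      (hd e) (hd e) _ _ rfl h1
    refine ⟨m', by rw [← hm', mul_inv_cancel_right], ?_⟩
    rw [hm', map_mul, ρ₂.onVG_inc (hE e) rfl (hEdge rfl) (ρ₁.edge_onE e) (τ_E e) (hy _)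
      (ρ₁.τ_onE e) (hd e), ← mul_assoc, ← mul_assoc, inv_mul_cancel_right] at h1
    exact G.inc_injective _ _ _ (mul_left_cancel h1)
  have hehom : ∀ a m, ∃ m' : L₂.EG (A a), ρ₂.onEG (hA a) m' = k a * ρ₁.ehom a m * (k a)⁻¹ := by
    intro a
    induction a using Quot.inductionOn with
    | _ e => exact fun m => (key e m).imp fun _ h => h.2
  choose eh heh using hehom
  have hei := fun a => onEG_injective h₂.ehom (hA a)
  let f : Hom L₁ L₂ :=
    { onV := y
      onE := E
      onEdge := A
      onE_bar := E_bar
      τ_onE := τ_E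
      edge_onE := fun _ => rfl
      vhom := fun x => MonoidHom.mk' (vh x) fun m m' => hvi x (by
        rw [map_mul, hvh, hvh, hvh, map_mul]; group)
      ehom := fun a => MonoidHom.mk' (eh a) fun m m' => hei a (by
        rw [map_mul, heh, heh, heh, map_mul]; group)
      δ := l
      pseudonatural := fun e m => by
        obtain ⟨m', h, h'⟩ := key e m
        obtain rfl : m' = eh _ m := hei (L₁.edge e) (h'.trans (heh _ m).symm)
        exact h }
  have hV' : ∀ x, (ρ₂.comp f).onV x = ρ₁.onV x := hy
  have hE' : ∀ e, (ρ₂.comp f).onE e = ρ₁.onE e := hE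
  refine ⟨f, rfl, equivFixing_of_forall hV' hE' (fun x => (g x)⁻¹) k (by rw [hq, inv_one])
    (fun x m => ?_) (fun a m => ?_) (fun e => ?_)⟩
  · rw [onVG_comp ρ₂ f rfl (hy x)]
    change _ = _ * ρ₂.onVG (hy x) (vh x m) * _
    rw [hvh]
    group
  · rw [onEG_comp ρ₂ f rfl (hA a)]
    change _ = _ * ρ₂.onEG (hA a) (eh a m) * _
    rw [heh]
    group
  · rw [delta_comp ρ₂ f rfl rfl (hy _) (hd e)]
    change _ = _ * (ρ₂.onVG (hy _) (l e) * _) * _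
    rw [mul_assoc, ← hl, inv_mul_cancel_left]

end Hom

namespace PointedCovering

variable {G : GraphOfGroups.{u}} {p : G.V}

/-- Paths from the basepoint are lifted through `ρ₂` to place each vertex. The inclusion of
subgroups then makes the placement consistent along every path between vertices (`hpath`), and
vertex groups and edges are the special cases that define a morphism. -/
theorem exists_hom_of_le {C₁ C₂ : PointedCovering G p} (h : C₁.subgroup ≤ C₂.subgroup) :
    ∃ f : Hom C₁.L C₂.L, f.IsCovering ∧ C₁.IsOver C₂ f := by
  classical
  have hα : ∃ α : ∀ x, PathClass C₁.L C₁.q x, α C₁.q = .ofVertex 1 :=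
    ⟨Function.update (fun x => (C₁.L.exists_pathClass C₁.q x).some) C₁.q (.ofVertex 1),
      Function.update_self _ _ _⟩
  obtain ⟨α, hα⟩ := hα
  have hlift : ∀ x, ∃ (y : C₂.L.V) (hy : C₂.ρ.onV y = C₁.ρ.onV x) (β : PathClass C₂.L C₂.q y)
      (g : G.VG (C₁.ρ.onV x)), C₁.ρ.onClass C₁.pointed rfl (α x) =
        (C₂.ρ.onClass C₂.pointed hy β).comp (.ofVertex g) ∧ (x = C₁.q → y = C₂.q ∧ g = 1) := by
    intro x
    -- At the basepoint the lift must be the trivial one, so that basepoints correspond and the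
    -- equivalence fixes `q`. A lift of unspecified choice is determined only up to the vertex
    -- group.
    by_cases hx : x = C₁.q
    · subst hx
      refine ⟨C₂.q, C₂.pointed.trans C₁.pointed.symm, .ofVertex 1, 1, ?_, fun _ => ⟨rfl, rfl⟩⟩
      have key : ∀ {w : G.V} (hw : C₁.ρ.onV C₁.q = w) (hw' : C₂.ρ.onV C₂.q = w),
          C₁.ρ.onClass C₁.pointed hw (.ofVertex 1) = C₂.ρ.onClass C₂.pointed hw' (.ofVertex 1) := by
        intro w hw hw'
        obtain rfl : p = w := C₁.pointed.symm.trans hw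
        rw [C₁.ρ.onClass_ofVertex, C₂.ρ.onClass_ofVertex, map_one, map_one]
      rw [hα, PathClass.comp_one]
      exact key _ _
    · obtain ⟨y, hy, β, g, hg⟩ := C₂.covering.exists_lift C₂.pointed
        (C₁.ρ.onClass C₁.pointed rfl (α x))
      exact ⟨y, hy, β, g, hg, fun h => absurd h hx⟩
  choose y hy β g hg hq using hlift
  obtain ⟨hyq, hgq⟩ := hq C₁.q rfl
  have hpath : ∀ {x x' : C₁.L.V} (θ : PathClass C₁.L x x'),
      ∃ θ' : PathClass C₂.L (y x) (y x'), (C₂.ρ.onClass (hy x) (hy x') θ').comp (.ofVertex (g x')) =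
        (PathClass.ofVertex (g x)).comp (C₁.ρ.onClass rfl rfl θ) := by
    intro x x' θ
    -- The loop `α x · θ · (α x')⁻¹` is the only place where the inclusion enters: its image is
    -- `ρ₂(η)`, and `(β x)⁻¹ η (β x')` is the desired path.
    obtain ⟨η, hη⟩ := mem_subgroup.1 (h (mem_subgroup.2
      ⟨((α x).comp θ).comp (α x').reverse, rfl⟩))
    have h1 : (β x).comp ((β x).reverse.comp (η.comp (β x'))) = η.comp (β x') := by
      rw [← PathClass.comp_assoc, PathClass.comp_reverse, PathClass.one_comp]
    refine ⟨(β x).reverse.comp (η.comp (β x')), PathClass.comp_left_cancel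
      (C₂.ρ.onClass C₂.pointed (hy x) (β x)) ?_⟩
    refine ((PathClass.comp_assoc _ _ _).symm.trans ?_).trans (PathClass.comp_assoc _ _ _)
    rw [← C₂.ρ.onClass_comp C₂.pointed, h1, ← hg,
      C₂.ρ.onClass_comp C₂.pointed C₂.pointed, hη, PathClass.comp_assoc, ← hg,
      ← C₁.ρ.onClass_comp C₁.pointed C₁.pointed, PathClass.comp_assoc _ (α x').reverse,
      PathClass.reverse_comp, PathClass.comp_one, C₁.ρ.onClass_comp C₁.pointed rfl]
  have hvhom : ∀ x m, ∃ m', C₂.ρ.onVG (hy x) m' = g x * C₁.ρ.vhom x m * (g x)⁻¹ := by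
    intro x m
    obtain ⟨θ, hθ⟩ := hpath (.ofVertex m)
    rw [C₁.ρ.onClass_ofVertex, C₁.ρ.onVG_rfl, PathClass.ofVertex_comp_ofVertex] at hθ
    obtain ⟨l, -, hl⟩ := C₂.covering.lift_unique (hy x) (hy x) (hy x) (α := θ) (g := 1)
      (α' := .ofVertex 1) (g' := g x * C₁.ρ.vhom x m * (g x)⁻¹) (by
        rw [PathClass.comp_one, C₂.ρ.onClass_ofVertex, map_one, PathClass.one_comp]
        refine PathClass.comp_right_cancel (.ofVertex (g x)) (hθ.trans ?_)
        rw [PathClass.ofVertex_comp_ofVertex, inv_mul_cancel_right])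
    exact ⟨l, by rw [← hl, mul_one]⟩
  -- The unoriented edge `a` is a separate argument so that one and the same `k` can be required for
  -- both orientations.
  let Over (e : C₁.L.E) (e' : C₂.L.E) (a : C₁.L.Edge) (k : G.EG (C₁.ρ.onEdge a)) : Prop :=
    ∃ (ha : C₁.L.edge e = a) (_ : C₂.L.τ e' = y (C₁.L.τ e)) (_ : C₂.ρ.onE e' = C₁.ρ.onE e)
      (l : C₂.L.VG (y (C₁.L.τ e))) (hd : C₂.ρ.onV (C₂.L.τ e') = C₁.ρ.onV (C₁.L.τ e)),
      g (C₁.L.τ e) * C₁.ρ.δ e = C₂.ρ.onVG (hy _) l * C₂.ρ.delta e' hd *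
        G.inc (C₁.ρ.onE e) ((C₁.ρ.edge_onE e).trans (congrArg C₁.ρ.onEdge ha)) (C₁.ρ.τ_onE e) k
  have hedge : ∀ e, ∃ e' k, Over e e' (C₁.L.edge e) k ∧
      Over (C₁.L.bar e) (C₂.L.bar e') (C₁.L.edge e) k := by
    intro e
    have hv : G.τ (G.bar (C₁.ρ.onE e)) = C₁.ρ.onV (C₁.L.τ (C₁.L.bar e)) := C₁.ρ.τ_bar_onE rfl
    have ha : G.edge (C₁.ρ.onE e) = C₁.ρ.onEdge (C₁.L.edge e) := C₁.ρ.edge_onE e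
    have ha' : G.edge (G.bar (C₁.ρ.onE e)) = C₁.ρ.onEdge (C₁.L.edge e) := (G.edge_bar _).trans ha
    obtain ⟨θ, hθ⟩ := hpath (.ofEdge e rfl rfl)
    rw [C₁.ρ.onClass_ofEdge rfl rfl rfl rfl rfl hv (C₁.ρ.τ_onE e) rfl rfl] at hθ
    obtain ⟨e₁, h₁, l, k, d, he₁, hl⟩ := Hom.exists_of_star_surjective
      (C₂.covering.star _).2 (hy (C₁.L.τ (C₁.L.bar e))) _ hv ha'
      (g (C₁.L.τ (C₁.L.bar e)) * C₁.ρ.delta (C₁.L.bar e) rfl)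
    obtain ⟨e', rfl⟩ : ∃ e', C₂.L.bar e' = e₁ := ⟨_, C₂.L.bar_bar e₁⟩
    have he' : C₂.ρ.onE e' = C₁.ρ.onE e := by
      rw [← C₂.L.bar_bar e', C₂.ρ.onE_bar, he₁, G.bar_bar]
    have d' : C₂.ρ.onV (C₂.L.τ e') = C₁.ρ.onV (C₁.L.τ e) := by
      rw [← C₂.ρ.τ_onE, he', C₁.ρ.τ_onE]
    -- Star surjectivity at the initial vertex gave `l`, `e'` and `k`. Now `l e'` and `θ` lift the
    -- same class up to vertex group elements, so `e'` ends at the prescribed vertex, and the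
    -- comparison element `l'` serves as the `l` of the other orientation.
    obtain ⟨l', h', hl'⟩ := C₂.covering.lift_unique (hy _) d' (hy _)
      (α := (PathClass.ofVertex l).comp (.ofEdge e' h₁ rfl)) (α' := θ)
      (g := C₂.ρ.delta e' d' * G.inc _ ha (C₁.ρ.τ_onE e) k * (C₁.ρ.delta e rfl)⁻¹ *
        (g (C₁.L.τ e))⁻¹) (g' := 1) (by
        refine PathClass.comp_right_cancel (.ofVertex (g (C₁.L.τ e))) ?_
        rw [PathClass.comp_one, hθ, C₂.ρ.onClass_comp (hy _) (hy _), C₂.ρ.onClass_ofVertex,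
          C₂.ρ.onClass_ofEdge he' (hy _) d' h₁ rfl hv (C₁.ρ.τ_onE e) d d']
        simp only [PathClass.comp_assoc, PathClass.ofVertex_comp_ofVertex_comp,
          PathClass.ofVertex_comp_ofVertex, hl, PathClass.slide_comp _ ha]
        congr 3
        group)
    refine ⟨e', k, ⟨rfl, (Sigma.mk.inj_iff.1 h').1, he', l', d', ?_⟩,
      ⟨C₁.L.edge_bar e, h₁, he₁.trans (C₁.ρ.onE_bar e).symm, l, d, ?_⟩⟩
    · refine mul_right_cancel (b := (C₁.ρ.delta e rfl)⁻¹ * (g (C₁.L.τ e))⁻¹) ?_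
      simp only [mul_assoc] at hl' ⊢
      rw [hl']
      change g _ * (C₁.ρ.δ e * ((C₁.ρ.δ e)⁻¹ * _)) = 1
      group
    · rw [Hom.inc_congr (C₁.ρ.onE_bar e) _ _ ha' hv]
      exact hl
  have hunique : ∀ {e e' e'' a a' k k'}, Over e e' a k → Over e e'' a' k' → e' = e'' := by
    rintro e e' e'' a a' k k' ⟨rfl, h₁, h₂, l, hd, hl⟩ ⟨rfl, h₁', h₂', l', hd', hl'⟩
    refine (Hom.eq_of_star_injective (C₂.covering.star _).1 (hy _) h₂ h₂' h₁ h₁' hd hd'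
      (C₁.ρ.edge_onE e) (C₁.ρ.τ_onE e) rfl (l₁ := l) (l₂ := l') (k := k' * k⁻¹) ?_).1
    rw [map_mul, map_inv, ← mul_assoc, ← hl', hl, mul_inv_cancel_right]
  have hk : ∀ a, ∃ k : G.EG (C₁.ρ.onEdge a), ∀ e, C₁.L.edge e = a → ∃ e', Over e e' a k := by
    intro a
    induction a using Quot.inductionOn with
    | _ e =>
      obtain ⟨e', k, h, h'⟩ := hedge e
      refine ⟨k, fun e₁ he₁ => ?_⟩
      rcases OGraph.eq_or_eq_bar (Γ := C₁.L.toOGraph) (show C₁.L.edge e = C₁.L.edge e₁ from he₁.symm) with rfl | rfl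
      · exact ⟨_, h⟩
      · exact ⟨_, h'⟩
  choose k hk using hk
  choose E hE using fun e => hk _ e rfl
  -- The edges were chosen for each orientation independently. They are reversals of each other
  -- because the edge over `e` is unique whatever `k` is.
  have E_bar : ∀ e, E (C₁.L.bar e) = C₂.L.bar (E e) := by
    intro e
    obtain ⟨e', k, h, h'⟩ := hedge e
    rw [hunique (hE e) h, hunique (hE _) h']
  choose _ τ_E hE l hd hl using hE
  obtain ⟨f, hf, hf'⟩ := Hom.exists_lift_of_data C₁.ρ C₂.ρ C₂.covering.immersion C₁.q y hy E hE
    E_bar τ_E g hgq k l hd hl hvhom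
  refine ⟨f, ?_, by rw [hf, hyq], hf'⟩
  -- `ρ₁` is a twist of `ρ₂ f`, so `ρ₂ f` is a covering map, and then so is `f`.
  obtain ⟨g', k', -, h'⟩ := hf'
  have := C₁.covering
  rw [h'] at this
  exact C₂.covering.of_comp this.of_twist

end PointedCovering

end GraphOfGroups

/-! ### Orbits and the existence of the choices for a quotient -/

theorem orbitE_eq_iff {K : Type u} [Group K] {T : OGraph.{u}} [MulAction K T.V] [MulAction K T.E]
    (A : IsGraphAction K T) {e e' : T.E} : orbitE A e = orbitE A e' ↔ ∃ k : K, k • e' = e :=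
  Quotient.eq.trans (MulAction.orbitRel_apply.trans MulAction.mem_orbit_iff)

theorem orbitV_eq_iff {K : Type u} [Group K] {T : OGraph.{u}} [MulAction K T.V] [MulAction K T.E]
    (A : IsGraphAction K T) {x x' : T.V} : orbitV A x = orbitV A x' ↔ ∃ k : K, k • x' = x :=
  Quotient.eq.trans (MulAction.orbitRel_apply.trans MulAction.mem_orbit_iff)

theorem nonempty_orbitLifts {K : Type u} [Group K] {T : OGraph.{u}} [MulAction K T.V]
    [MulAction K T.E] (A : IsGraphAction K T) (x₀ : T.V) : Nonempty (OrbitLifts A x₀) := by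
  classical
  obtain ⟨edge, hedge⟩ := OGraph.exists_bar_compatible (Γ := quotientGraph A) (B := fun _ => T.E)
    (fun e e' b b' => orbitE A b = e ∧ orbitE A b' = e' ∧ b' = T.bar b)
    (by
      rintro e b _ ⟨h, h', rfl⟩
      exact ⟨h', h, (T.bar_bar b).symm⟩)
    (by
      intro e
      induction e using Quotient.inductionOn with
      | _ e => exact ⟨e, T.bar e, rfl, rfl, rfl⟩)
  have hvert : ∃ vert : (quotientGraph A).V → T.V, (∀ x, orbitV A (vert x) = x) ∧
      vert (orbitV A x₀) = x₀ := by
    refine ⟨Function.update (fun x => (Quotient.exists_rep x).choose) (orbitV A x₀) x₀,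
      fun x => ?_, Function.update_self _ _ _⟩
    by_cases h : x = orbitV A x₀
    · subst h
      rw [Function.update_self]
    · rw [Function.update_of_ne h]
      exact (Quotient.exists_rep x).choose_spec
  obtain ⟨vert, hvert, hbase⟩ := hvert
  have ht : ∀ e, ∃ k : K, k • T.τ (edge e) = vert ((quotientGraph A).τ e) := by
    intro e
    rw [← orbitV_eq_iff A, hvert]
    conv_lhs => rw [← (hedge e).1]
    rfl
  choose t ht using ht
  exact ⟨⟨vert, hvert, hbase, edge, fun e => (hedge e).1, fun e => (hedge e).2.2, t, ht⟩⟩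

theorem OGraph.exists_edge_eq {Γ : OGraph.{u}} (a : Γ.Edge) : ∃ e, Γ.edge e = a := Quot.exists_rep a

namespace GraphOfGroups

variable {G : GraphOfGroups.{u}} {p : G.V}

/-! ### Equality and action in the Bass–Serre tree -/

/-- The action of the fundamental group on path classes. -/
def PathClass.lact (h : PiOne G p) {w : G.V} (α : PathClass G p w) : PathClass G p w :=
  PathClass.comp (show PathClass G p p from h) α

namespace PathClass

theorem mul_lact (g h : PiOne G p) {w : G.V} (α : PathClass G p w) :
    lact (g * h) α = lact g (lact h α) := comp_assoc (G := G) g h α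

theorem lact_comp (h : PiOne G p) {w x : G.V} (α : PathClass G p w) (β : PathClass G w x) :
    lact h (α.comp β) = (lact h α).comp β := (comp_assoc (G := G) h α β).symm

theorem one_lact {w : G.V} (α : PathClass G p w) : lact 1 α = α := one_comp α

theorem inv_lact_lact (h : PiOne G p) {w : G.V} (α : PathClass G p w) :
    lact h⁻¹ (lact h α) = α := by
  rw [← mul_lact, inv_mul_cancel, one_lact]

theorem lact_right_cancel {g h : PiOne G p} {w : G.V} {α : PathClass G p w}
    (H : lact g α = lact h α) : g = h := comp_right_cancel (G := G) α H

end PathClass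

/-- The vertex of the tree given by a homotopy class of paths. -/
def vClass {w : G.V} (α : PathClass G p w) : (tree G p).V := treeVertex α

/-- The oriented edge of the tree over `e` given by a homotopy class of paths. -/
def eClass {v : G.V} (e : G.E) (hv : G.τ (G.bar e) = v) (α : PathClass G p v) : (tree G p).E :=
  treeEdge e hv α

/-- The projection of the tree on vertices. -/
def projV (x : (tree G p).V) : G.V := treeProjV x

/-- The projection of the tree on oriented edges. -/
def projE (x : (tree G p).E) : G.E := treeProjE x

/-- The generating relation is already an equivalence relation, because vertex group elements can be
multiplied and inverted. `exists_of_eClass_eq` uses the same argument with edge groups. -/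
theorem vClass_eq {w w' : G.V} {α : PathClass G p w} {β : PathClass G p w'}
    (h : vClass α = vClass β) :
    ∃ g : G.VG w', (⟨w, α⟩ : Σ w, PathClass G p w) = ⟨w', β.comp (.ofVertex g)⟩ := by
  have key : ∀ {x y : Σ w, PathClass G p w}, Relation.EqvGen (TreeVRel G p) x y →
      ∃ g : G.VG y.1, x = ⟨y.1, y.2.comp (.ofVertex g)⟩ := by
    intro x y h
    induction h with
    | rel x y h =>
      obtain ⟨α, g⟩ := h
      refine ⟨g⁻¹, ?_⟩
      dsimp only
      rw [PathClass.comp_ofVertex_ofVertex, mul_inv_cancel, PathClass.comp_one]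
    | refl x => exact ⟨1, by rw [PathClass.comp_one]⟩
    | symm x y _ ih =>
      obtain ⟨g, rfl⟩ := ih
      refine ⟨g⁻¹, ?_⟩
      dsimp only
      rw [PathClass.comp_ofVertex_ofVertex, mul_inv_cancel, PathClass.comp_one]
    | trans x y z _ _ ih ih' =>
      obtain ⟨g, rfl⟩ := ih'
      obtain ⟨h, rfl⟩ := ih
      refine ⟨g * h, ?_⟩
      dsimp only
      rw [PathClass.comp_ofVertex_ofVertex]
  exact key (Quot.eqvGen_exact h)

theorem exists_of_vClass_eq {w : G.V} {α β : PathClass G p w}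
    (h : vClass α = vClass β) : ∃ g : G.VG w, α = β.comp (.ofVertex g) := by
  obtain ⟨g, hg⟩ := vClass_eq h
  exact ⟨g, eq_of_heq (Sigma.mk.inj_iff.1 hg).2⟩

theorem exists_of_eClass_eq {e : G.E} {v : G.V} (hv : G.τ (G.bar e) = v)
    {α β : PathClass G p v} (h : eClass e hv α = eClass e hv β) {a : G.Edge}
    (ha : G.edge (G.bar e) = a) :
    ∃ k : G.EG a, α = β.comp (.ofVertex (G.inc (G.bar e) ha hv k)) := by
  obtain rfl : G.edge e = a := (G.edge_bar e).symm.trans ha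
  have key : ∀ {x y : TreePreE G p}, Relation.EqvGen (TreeERel G p) x y →
      ∃ k : G.EG (G.edge y.e), x = ⟨y.e, y.v, y.hv,
        y.α.comp (.ofVertex (G.inc (G.bar y.e) (G.edge_bar y.e) y.hv k))⟩ := by
    intro x y h
    induction h with
    | rel x y h =>
      obtain ⟨e, hv, α, k⟩ := h
      refine ⟨k⁻¹, ?_⟩
      dsimp only
      rw [PathClass.comp_ofVertex_ofVertex, ← map_mul, mul_inv_cancel, map_one, PathClass.comp_one]
    | refl x => exact ⟨1, by rw [map_one, PathClass.comp_one]⟩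
    | symm x y _ ih =>
      obtain ⟨k, rfl⟩ := ih
      refine ⟨k⁻¹, ?_⟩
      dsimp only
      rw [PathClass.comp_ofVertex_ofVertex, ← map_mul, mul_inv_cancel, map_one, PathClass.comp_one]
    | trans x y z _ _ ih ih' =>
      obtain ⟨k, rfl⟩ := ih'
      obtain ⟨m, rfl⟩ := ih
      refine ⟨k * m, ?_⟩
      dsimp only
      rw [PathClass.comp_ofVertex_ofVertex, map_mul]
  obtain ⟨k, hk⟩ := key (Quot.eqvGen_exact h)
  injection hk with _ _ hk
  exact ⟨k, hk⟩

theorem eClass_comp {v : G.V} (e : G.E) (hv : G.τ (G.bar e) = v) (α : PathClass G p v)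
    {a : G.Edge} (ha : G.edge (G.bar e) = a) (h : G.EG a) :
    eClass e hv (α.comp (.ofVertex (G.inc (G.bar e) ha hv h))) = eClass e hv α :=
  treeEdge_comp e hv α ha h

theorem eClass_congr {v : G.V} {e e' : G.E} (h : e = e') (hv : G.τ (G.bar e) = v)
    (hv' : G.τ (G.bar e') = v) (α : PathClass G p v) : eClass e hv α = eClass e' hv' α :=
  treeEdge_congr h hv hv' α

theorem smul_vClass {w : G.V} (h : PiOne G p) (α : PathClass G p w) :
    h • vClass α = vClass (PathClass.lact h α) := rfl

theorem smul_eClass {e : G.E} {v : G.V} (hv : G.τ (G.bar e) = v) (h : PiOne G p)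
    (α : PathClass G p v) : h • eClass e hv α = eClass e hv (PathClass.lact h α) := rfl

theorem projE_eClass {e : G.E} {v : G.V} (hv : G.τ (G.bar e) = v) (α : PathClass G p v) :
    projE (eClass e hv α) = e := rfl

theorem exists_vClass (x : (tree G p).V) : ∃ α : PathClass G p (projV x), vClass α = x := by
  induction x using Quot.inductionOn with | _ x => exact ⟨x.2, rfl⟩

theorem exists_eClass (x : (tree G p).E) {v : G.V} (hv : G.τ (G.bar (projE x)) = v) :
    ∃ α : PathClass G p v, eClass (projE x) hv α = x := by
  subst hv
  induction x using Quot.inductionOn with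
  | _ x =>
    obtain ⟨e, v, rfl, α⟩ := x
    exact ⟨α, rfl⟩

theorem projV_smul (h : PiOne G p) (x : (tree G p).V) : projV (h • x) = projV x := by
  induction x using Quot.inductionOn
  rfl

theorem projE_smul (h : PiOne G p) (x : (tree G p).E) : projE (h • x) = projE x :=
  treeProjE_smul h x

theorem projE_bar (x : (tree G p).E) : projE ((tree G p).bar x) = G.bar (projE x) :=
  treeProjE_bar x

theorem projV_τ (x : (tree G p).E) : projV ((tree G p).τ x) = G.τ (projE x) := by
  induction x using Quot.inductionOn
  rfl

theorem bar_eClass {e : G.E} {v w : G.V} (hv : G.τ (G.bar e) = v) (hw : G.τ e = w)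
    (hw' : G.τ (G.bar (G.bar e)) = w) (α : PathClass G p v) :
    (tree G p).bar (eClass e hv α) = eClass (G.bar e) hw' (α.comp (.ofEdge e hv hw)) := by
  subst hw
  rfl

theorem τ_eClass {e : G.E} {v w : G.V} (hv : G.τ (G.bar e) = v) (hw : G.τ e = w)
    (α : PathClass G p v) : (tree G p).τ (eClass e hv α) = vClass (α.comp (.ofEdge e hv hw)) := by
  subst hw
  rfl

theorem τ_bar_eClass {e : G.E} {v : G.V} (hv : G.τ (G.bar e) = v) (α : PathClass G p v) :
    (tree G p).τ ((tree G p).bar (eClass e hv α)) = vClass α := by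
  rw [bar_eClass hv rfl (congrArg G.τ (G.bar_bar e)), τ_eClass _ hv, PathClass.comp_assoc,
    PathClass.ofEdge_bar, PathClass.comp_one]

/-! ### The graph of groups `H \ T` -/

namespace QuotientLifts

variable {H : Subgroup (PiOne G p)} (D : QuotientLifts H)

/-- The chosen lift of a vertex of `H \ T`. -/
def vertT (x : D.quotient.V) : (tree G p).V := D.vert x

/-- The chosen lift of an oriented edge of `H \ T`. -/
def edgeT (e : D.quotient.E) : (tree G p).E := D.edge e

/-- The elements of the fundamental group given by a vertex group of `H \ T`. -/
def valV (x : D.quotient.V) : D.quotient.VG x →* PiOne G p :=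
  H.subtype.comp (MulAction.stabilizer H (D.vert x)).subtype

/-- The elements of the fundamental group given by an edge group of `H \ T`. -/
def valE (a : D.quotient.Edge) : D.quotient.EG a →* PiOne G p :=
  H.subtype.comp (Subgroup.subtype (⨅ e : {e : D.quotient.E // D.quotient.edge e = a},
    MulAction.stabilizer H (D.edge e.1)))

/-- `t e`, as an element of the fundamental group. -/
def tVal (e : D.quotient.E) : PiOne G p := (D.t e : H)

theorem edgeT_bar (e : D.quotient.E) : D.edgeT (D.quotient.bar e) = (tree G p).bar (D.edgeT e) :=
  D.edge_bar e

theorem tVal_mem (e : D.quotient.E) : D.tVal e ∈ H := (D.t e).2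

theorem valV_mem (x : D.quotient.V) (l : D.quotient.VG x) : D.valV x l ∈ H :=
  (show MulAction.stabilizer H (D.vert x) from l).1.2

theorem valV_injective (x : D.quotient.V) : Function.Injective (D.valV x) :=
  fun _ _ h => Subtype.ext (Subtype.ext h)

theorem valE_injective (a : D.quotient.Edge) : Function.Injective (D.valE a) :=
  fun _ _ h => Subtype.ext (Subtype.ext h)

theorem valV_smul (x : D.quotient.V) (l : D.quotient.VG x) : D.valV x l • D.vertT x = D.vertT x :=
  (show MulAction.stabilizer H (D.vert x) from l).2

theorem exists_valV {x : D.quotient.V} {h : PiOne G p} (hH : h ∈ H)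
    (hx : h • D.vertT x = D.vertT x) : ∃ l, D.valV x l = h :=
  ⟨(⟨⟨h, hH⟩, hx⟩ : MulAction.stabilizer H (D.vert x)), rfl⟩

theorem valE_smul (e : D.quotient.E) (k : D.quotient.EG (D.quotient.edge e)) :
    D.valE _ k • D.edgeT e = D.edgeT e := by
  obtain ⟨k, hk⟩ := k
  exact (Subgroup.mem_iInf.1 hk) ⟨e, rfl⟩

theorem exists_valE {e : D.quotient.E} {h : PiOne G p} (hH : h ∈ H)
    (he : h • D.edgeT e = D.edgeT e) : ∃ k, D.valE (D.quotient.edge e) k = h := by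
  have key : ∀ e' : {e' : D.quotient.E // D.quotient.edge e' = D.quotient.edge e},
      h • D.edgeT e'.1 = D.edgeT e'.1 := by
    rintro ⟨e', he'⟩
    rcases OGraph.eq_or_eq_bar (Γ := D.quotient.toOGraph) he'.symm with rfl | rfl
    · exact he
    · rw [edgeT_bar, ← (tree_action G p).smul_bar, he]
  exact ⟨⟨⟨h, hH⟩, Subgroup.mem_iInf.2 key⟩, rfl⟩

theorem valV_ι (e : D.quotient.E) (k : D.quotient.EG (D.quotient.edge e)) :
    D.valV _ (D.quotient.ι e k) = D.tVal e * D.valE _ k * (D.tVal e)⁻¹ := rfl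

theorem tVal_smul (e : D.quotient.E) :
    D.tVal e • (tree G p).τ (D.edgeT e) = D.vertT (D.quotient.τ e) := D.t_spec e

theorem vertT_base : D.vertT D.base = vClass (.ofVertex 1) := D.vert_base

/-- Path classes representing the lifts of the vertices and edges of `H \ T`, and their relation to
the morphism `r : H \ T → G`. -/
structure Representatives (r : Hom D.quotient G) where
  a : ∀ x, PathClass G p (r.onV x)
  s : ∀ e, PathClass G p (r.onV (D.quotient.τ e))
  onV : ∀ x, r.onV x = projV (D.vertT x)
  onE : ∀ e, r.onE e = projE (D.edgeT e)
  vClass_a : ∀ x, vClass (a x) = D.vertT x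
  a_base : (⟨r.onV D.base, a D.base⟩ : Σ w, PathClass G p w) = ⟨p, .ofVertex 1⟩
  eClass_s : ∀ e, eClass (G.bar (r.onE e)) ((congrArg G.τ (G.bar_bar _)).trans (r.τ_onE e)) (s e) =
    (tree G p).bar (D.edgeT e)
  s_eq : ∀ e, s e = (s (D.quotient.bar e)).comp (.ofEdge (r.onE e) (r.τ_bar_onE rfl) (r.τ_onE e))
  t_s : ∀ e, (s e).lact (D.tVal e) = (a _).comp (.ofVertex (r.δ e))
  valV_a : ∀ x l, (a x).lact (D.valV x l) = (a x).comp (.ofVertex (r.vhom x l))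
  valE_s : ∀ e k, (s e).lact (D.valE _ k) =
    (s e).comp (.ofVertex (G.inc (r.onE e) (r.edge_onE e) (r.τ_onE e) (r.ehom _ k)))

/-- The class `s e` represents the reversed edge lift, so it ends over the terminal vertex of `e`,
and its translate by `t_e` gives the same vertex of `T` as `a`; the discrepancy is `δ e`. A
stabilizer element moves `a x` or `s e` by a group element on the right, which is its image under
`r`. -/
theorem exists_representatives : ∃ r : Hom D.quotient G, Nonempty (D.Representatives r) := by
  let V : D.quotient.V → G.V := fun x => projV (D.vertT x)
  let E : D.quotient.E → G.E := fun e => projE (D.edgeT e)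
  have hbar : ∀ e, E (D.quotient.bar e) = G.bar (E e) := by
    intro e
    exact (congrArg projE (D.edgeT_bar e)).trans (projE_bar _)
  have hτ : ∀ e, G.τ (E e) = V (D.quotient.τ e) := by
    intro e
    have := congrArg projV (D.tVal_smul e)
    rwa [projV_smul, projV_τ] at this
  have hτ' : ∀ e, G.τ (G.bar (E e)) = V (D.quotient.τ (D.quotient.bar e)) := by
    intro e
    rw [← hτ, hbar]
  have hbb : ∀ e, G.τ (G.bar (G.bar (E e))) = V (D.quotient.τ e) := by
    intro e
    rw [G.bar_bar, hτ]
  have ha : ∀ x, ∃ a : PathClass G p (V x), vClass a = D.vertT x ∧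
      (x = D.base → (⟨V x, a⟩ : Σ w, PathClass G p w) = ⟨p, .ofVertex 1⟩) := by
    intro x
    by_cases hx : x = D.base
    · have key : ∀ X : (tree G p).V, X = vClass (.ofVertex 1) → ∃ a : PathClass G p (projV X),
          vClass a = X ∧ (⟨projV X, a⟩ : Σ w, PathClass G p w) = ⟨p, .ofVertex 1⟩ := by
        rintro _ rfl
        exact ⟨.ofVertex 1, rfl, rfl⟩
      obtain ⟨a, h, h'⟩ := key (D.vertT x) (by rw [hx, vertT_base])
      exact ⟨a, h, fun _ => h'⟩
    · obtain ⟨a, h⟩ := exists_vClass (D.vertT x)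
      exact ⟨a, h, fun h' => absurd h' hx⟩
  choose a ha ha_base using ha
  have hs := OGraph.exists_bar_compatible (Γ := D.quotient.toOGraph)
    (B := fun e => PathClass G p (V (D.quotient.τ e)))
    (fun e e' b b' => eClass (G.bar (E e)) (hbb e) b = (tree G p).bar (D.edgeT e) ∧
      eClass (G.bar (E e')) (hbb e') b' = (tree G p).bar (D.edgeT e') ∧
      ∃ h : G.τ (G.bar (E e)) = V (D.quotient.τ e'), b = b'.comp (.ofEdge (E e) h (hτ e)))
    (by
      rintro e b b' ⟨h1, h1', h3, h4⟩
      have h5 : G.τ (G.bar (E (D.quotient.bar e))) = V (D.quotient.τ e) := by rw [hbar, hbb]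
      refine ⟨h1', h1, h5, ?_⟩
      rw [h4, PathClass.comp_assoc, PathClass.ofEdge_congr (hbar e) h5 (hτ _) (hbb e) h3,
        PathClass.ofEdge_bar, PathClass.comp_one])
    (by
      intro e
      obtain ⟨α, hα⟩ := exists_eClass (D.edgeT e) (hτ' e)
      refine ⟨α.comp (.ofEdge (E e) (hτ' e) (hτ e)), α, ?_, ?_, hτ' e, rfl⟩
      · rw [← bar_eClass (hτ' e)]
        exact congrArg (tree G p).bar hα
      · rw [edgeT_bar, (tree G p).bar_bar, eClass_congr ((congrArg G.bar (hbar e)).trans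
          (G.bar_bar _)) _ (hτ' e)]
        exact hα)
  obtain ⟨s, hs⟩ := hs
  have hs1 : ∀ e, eClass (G.bar (E e)) (hbb e) (s e) = (tree G p).bar (D.edgeT e) :=
    fun e => (hs e).1
  have hs2 : ∀ e, s e = (s (D.quotient.bar e)).comp (.ofEdge (E e) (hτ' e) (hτ e)) :=
    fun e => (hs e).2.2.choose_spec
  have hs3 : ∀ e, (tree G p).τ (D.edgeT e) = vClass (s e) := by
    intro e
    rw [← τ_bar_eClass (hbb e), hs1, (tree G p).bar_bar]
  have hδ : ∀ e, ∃ δ : G.VG (V (D.quotient.τ e)),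
      (s e).lact (D.tVal e) = (a _).comp (.ofVertex δ) := by
    intro e
    refine exists_of_vClass_eq ?_
    rw [ha, ← D.tVal_smul, hs3, smul_vClass]
  choose δ hδ using hδ
  have hvhom : ∀ x l, ∃ g : G.VG (V x), (a x).lact (D.valV x l) = (a x).comp (.ofVertex g) := by
    intro x l
    refine exists_of_vClass_eq ?_
    rw [← smul_vClass, ha, valV_smul]
  choose vh hvh using hvhom
  let A : D.quotient.Edge → G.Edge := Quot.lift (fun e => G.edge (E e)) (by
    rintro e _ rfl
    rw [hbar, G.edge_bar])
  have hA : ∀ {e a}, D.quotient.edge e = a → G.edge (E e) = A a := by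
    rintro e _ rfl
    rfl
  -- The element `m` is read off from one orientation and must serve both. Since `s` of the reversal
  -- is `s e` followed by the reversed edge, sliding `m` across that edge gives the second case.
  have hehom : ∀ b (k : D.quotient.EG b), ∃ m : G.EG (A b), ∀ e (he : D.quotient.edge e = b),
      (s e).lact (D.valE _ k) = (s e).comp (.ofVertex (G.inc (E e) (hA he) (hτ e) m)) := by
    intro b k
    obtain ⟨e, rfl⟩ := OGraph.exists_edge_eq b
    have h1 : eClass (G.bar (E e)) (hbb e) ((s e).lact (D.valE _ k)) =
        eClass (G.bar (E e)) (hbb e) (s e) := by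
      rw [← smul_eClass, hs1, ← (tree_action G p).smul_bar, valE_smul]
    have hb : G.edge (G.bar (E e)) = A (D.quotient.edge e) := (G.edge_bar _).trans (hA rfl)
    have hb' : G.edge (G.bar (G.bar (E e))) = A (D.quotient.edge e) := (G.edge_bar _).trans hb
    obtain ⟨m, hm⟩ := exists_of_eClass_eq _ h1 hb'
    rw [Hom.inc_congr (G.bar_bar (E e)) _ _ (hA rfl) (hτ e)] at hm
    refine ⟨m, fun e' he' => ?_⟩
    rcases OGraph.eq_or_eq_bar (Γ := D.quotient.toOGraph) he'.symm with rfl | rfl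
    · exact hm
    · have h2 : s (D.quotient.bar e) = (s e).comp (.ofEdge (G.bar (E e)) (hbb e) (hτ' e)) := by
        rw [hs2 e, PathClass.comp_assoc, PathClass.ofEdge_bar, PathClass.comp_one]
      rw [Hom.inc_congr (hbar e) _ _ hb (hτ' e), h2, PathClass.lact_comp, hm,
        PathClass.comp_assoc, PathClass.comp_assoc, ← PathClass.slide' (G.bar (E e)) hb hb',
        Hom.inc_congr (G.bar_bar (E e)) _ _ (hA rfl) (hτ e)]
  choose eh heh using hehom
  let r : Hom D.quotient G :=
    { onV := V
      onE := E
      onEdge := A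
      onE_bar := hbar
      τ_onE := hτ
      edge_onE := fun _ => rfl
      vhom := fun x => MonoidHom.mk' (vh x) fun l l' =>
        -- The left action of the fundamental group commutes with right multiplication, so the
        -- identity holds after applying both sides to `a x`, from which vertex group elements can
        -- be recovered.
        PathClass.comp_ofVertex_cancel (a x) (by
          rw [← hvh, map_mul, ← PathClass.comp_ofVertex_ofVertex, ← hvh, PathClass.mul_lact, hvh,
            PathClass.lact_comp])
      ehom := fun b => MonoidHom.mk' (eh b) fun k k' => by
        obtain ⟨e, rfl⟩ := OGraph.exists_edge_eq b
        refine G.inc_injective (E e) (hA rfl) (hτ e) (PathClass.comp_ofVertex_cancel (s e) ?_)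
        rw [← heh _ _ e rfl, map_mul, map_mul, ← PathClass.comp_ofVertex_ofVertex,
          ← heh _ _ e rfl, PathClass.mul_lact, heh _ k' e rfl, PathClass.lact_comp]
      δ := δ
      pseudonatural := fun e k => by
        refine PathClass.comp_ofVertex_cancel (a _) ((hvh _ _).symm.trans ?_)
        have h1 : (a (D.quotient.τ e)).lact (D.tVal e)⁻¹ =
            (s e).comp (.ofVertex (δ e)⁻¹) := by
          refine PathClass.comp_right_cancel (.ofVertex (δ e)) ?_
          rw [← PathClass.lact_comp, ← hδ, PathClass.inv_lact_lact,
            PathClass.comp_ofVertex_ofVertex, inv_mul_cancel, PathClass.comp_one]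
        rw [valV_ι, PathClass.mul_lact, PathClass.mul_lact, h1, PathClass.lact_comp,
          heh _ _ e rfl, PathClass.lact_comp, PathClass.lact_comp, hδ,
          PathClass.comp_ofVertex_ofVertex, PathClass.comp_ofVertex_ofVertex, ← mul_assoc]
        rfl }
  exact ⟨r, ⟨⟨a, s, fun _ => rfl, fun _ => rfl, ha, ha_base _ rfl, hs1, hs2, hδ, hvh,
    fun e k => heh _ _ e rfl⟩⟩⟩

end QuotientLifts

/-! ### The map from `H \ T` is a covering map with image `H` -/

namespace Hom

variable {L : GraphOfGroups.{u}} (f : Hom L G) {q : L.V}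

/-- Up to renaming the endpoint, `a` is the constant path, so composing with it only changes the
name of the starting vertex. -/
theorem onClass_eq_comp (hq : f.onV q = p) {a : PathClass G p (f.onV q)}
    (ha : (⟨f.onV q, a⟩ : Σ w, PathClass G p w) = ⟨p, .ofVertex 1⟩) {x : L.V}
    (α : PathClass L q x) : f.onClass hq rfl α = a.comp (f.onClass rfl rfl α) := by
  subst hq
  obtain rfl := eq_of_heq (Sigma.mk.inj_iff.1 ha).2
  exact (PathClass.one_comp _).symm

theorem onClass_comp_eq (hq : f.onV q = p) {a : PathClass G p (f.onV q)}
    (ha : (⟨f.onV q, a⟩ : Σ w, PathClass G p w) = ⟨p, .ofVertex 1⟩) (α : PathClass L q q) :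
    (f.onClass hq hq α).comp a = a.comp (f.onClass rfl rfl α) := by
  subst hq
  obtain rfl := eq_of_heq (Sigma.mk.inj_iff.1 ha).2
  exact (PathClass.comp_one _).trans (PathClass.one_comp _).symm

end Hom

namespace QuotientLifts

variable {H : Subgroup (PiOne G p)} {D : QuotientLifts H}

theorem vertT_orbit (D : QuotientLifts H) (x : (tree G p).V) : ∃ h : H,
    h • x = D.vertT (orbitV ((tree_action G p).subgroup H) x) :=
  (orbitV_eq_iff _).1 (D.vert_spec _)

theorem edgeT_orbit (D : QuotientLifts H) (e : (tree G p).E) : ∃ h : H,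
    h • e = D.edgeT (orbitE ((tree_action G p).subgroup H) e) :=
  (orbitE_eq_iff _).1 (D.edge_spec _)

namespace Representatives

variable {r : Hom D.quotient G}

theorem exists_edgeClass (R : D.Representatives r) {e : D.quotient.E} {x : D.quotient.V} (h : D.quotient.τ e = x) :
    ∃ s : PathClass G p (r.onV x),
      eClass (G.bar (r.onE e)) ((congrArg G.τ (G.bar_bar _)).trans (r.τ_onE' h)) s =
        (tree G p).bar (D.edgeT e) ∧
      s.lact (D.tVal e) = (R.a x).comp (.ofVertex (r.δ' e h)) := by
  subst h
  exact ⟨R.s e, R.eClass_s e, R.t_s e⟩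

/-- Both stars enumerate the edges of `T` ending at the lift of `x`: the coset of `l` at `e` gives
the translate of the lift of `e` by `l t_e`, and the coset of `g` at `e'` gives the reversal of the
edge over `ē'` represented by `a x · g`. The local map respects these descriptions. -/
theorem isCovering (R : D.Representatives r) : r.IsCovering := by
  refine Hom.isCovering_of_bijective (fun x l l' h => ?_) (fun b k k' h => ?_)
    (fun x => ⟨?_, ?_⟩)
  · refine D.valV_injective x (PathClass.lact_right_cancel (α := R.a x) ?_)
    rw [R.valV_a, R.valV_a, h]
  · obtain ⟨e, rfl⟩ := OGraph.exists_edge_eq b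
    refine D.valE_injective _ (PathClass.lact_right_cancel (α := R.s e) ?_)
    rw [R.valE_s, R.valE_s, h]
  · rw [Hom.star_injective_iff]
    intro e₁ e₂ h₁ h₂ l₁ l₂ k he hl
    obtain ⟨s₁, hs₁, ht₁⟩ := R.exists_edgeClass h₁
    obtain ⟨s₂, hs₂, ht₂⟩ := R.exists_edgeClass h₂
    have key : (s₁.lact (D.tVal e₁)).lact (D.valV x l₁) =
        ((s₂.lact (D.tVal e₂)).lact (D.valV x l₂)).comp
          (.ofVertex (G.inc (r.onE e₂) rfl (r.τ_onE' h₂) k)) := by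
      rw [ht₁, ht₂, PathClass.lact_comp, PathClass.lact_comp, R.valV_a, R.valV_a,
        PathClass.comp_ofVertex_ofVertex, PathClass.comp_ofVertex_ofVertex,
        PathClass.comp_ofVertex_ofVertex, hl, ← mul_assoc]
    have hb := (congrArg G.τ (G.bar_bar (r.onE e₂))).trans (r.τ_onE' h₂)
    have hE : (D.valV x l₁ * D.tVal e₁) • D.edgeT e₁ = (D.valV x l₂ * D.tVal e₂) • D.edgeT e₂ := by
      rw [← (tree G p).bar_bar (D.edgeT e₁), ← (tree G p).bar_bar (D.edgeT e₂), ← hs₁, ← hs₂,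
        ← (tree_action G p).smul_bar, ← (tree_action G p).smul_bar, smul_eClass, smul_eClass,
        PathClass.mul_lact, PathClass.mul_lact, key,
        eClass_congr (congrArg G.bar he) _ hb, ← Hom.inc_congr (G.bar_bar (r.onE e₂))
          ((G.edge_bar _).trans (G.edge_bar _)) hb, eClass_comp]
    -- This element of `H` carries one chosen edge lift to the other. So the edges lie in the same
    -- orbit and are equal, and the element is in their common stabilizer, the edge group.
    have hE' : ((D.valV x l₂ * D.tVal e₂)⁻¹ * (D.valV x l₁ * D.tVal e₁)) • D.edgeT e₁ =
        D.edgeT e₂ := by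
      rw [mul_smul, hE, inv_smul_smul]
    have hmem : (D.valV x l₂ * D.tVal e₂)⁻¹ * (D.valV x l₁ * D.tVal e₁) ∈ H :=
      H.mul_mem (H.inv_mem (H.mul_mem (D.valV_mem _ _) (D.tVal_mem _)))
        (H.mul_mem (D.valV_mem _ _) (D.tVal_mem _))
    obtain rfl : e₁ = e₂ := by
      rw [← D.edge_spec e₁, ← D.edge_spec e₂]
      exact ((orbitE_eq_iff _).2 ⟨⟨_, hmem⟩, hE'⟩).symm
    subst h₁
    refine ⟨rfl, ?_⟩
    obtain ⟨m, hm⟩ := D.exists_valE hmem hE'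
    refine ⟨m, D.valV_injective _ ?_⟩
    change _ = D.valV _ (l₂ * D.quotient.ι e₁ m)
    rw [map_mul, valV_ι, hm]
    group
  · rw [Hom.star_surjective_iff]
    intro e' h' g
    have hb := (congrArg G.τ (G.bar_bar e')).trans h'
    obtain ⟨Z, hZ⟩ : ∃ Z : (tree G p).E,
        (tree G p).bar Z = eClass (G.bar e') hb ((R.a x).comp (.ofVertex g)) :=
      ⟨_, (tree G p).bar_bar _⟩
    have hZτ : (tree G p).τ Z = D.vertT x := by
      rw [← (tree G p).bar_bar Z, hZ, τ_bar_eClass, ← R.vClass_a]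
      exact treeVertex_comp _ _
    have hZE : projE Z = e' := by
      rw [← (tree G p).bar_bar Z, projE_bar, hZ, projE_eClass, G.bar_bar]
    obtain ⟨e, he⟩ : ∃ e : D.quotient.E, e = orbitE ((tree_action G p).subgroup H) Z := ⟨_, rfl⟩
    obtain ⟨⟨h, hH⟩, hh⟩ := D.edgeT_orbit Z
    rw [← he] at hh
    replace hh : h • Z = D.edgeT e := hh
    have hτ : D.quotient.τ e = x := by
      rw [← D.vert_spec x, he]
      exact congrArg (orbitV ((tree_action G p).subgroup H)) hZτ
    have hE : r.onE e = e' := by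
      rw [R.onE, ← hh, projE_smul, hZE]
    subst hE
    obtain ⟨s, hs, ht⟩ := R.exists_edgeClass hτ
    -- The vertex group element is `h⁻¹ t_e⁻¹`: `h` carries `Z` to the chosen edge lift, and `t_e`
    -- carries the terminal vertex of that lift back to the lift of `x`, where `Z` ends.
    obtain ⟨l, hl⟩ := D.exists_valV (x := x) (H.mul_mem (H.inv_mem hH) (H.inv_mem (D.tVal_mem e)))
      (by
        have h1 := D.tVal_smul e
        rw [hτ] at h1
        conv_lhs => rw [mul_smul, ← h1, inv_smul_smul, ← hh, (tree_action G p).smul_τ,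
          inv_smul_smul, hZτ])
    have h2 : eClass (G.bar (r.onE e)) hb ((R.a x).comp (.ofVertex g)) =
        eClass (G.bar (r.onE e)) hb (s.lact h⁻¹) := by
      rw [← hZ, ← smul_eClass, hs, ← hh, (tree_action G p).smul_bar, inv_smul_smul]
    obtain ⟨k, hk⟩ := exists_of_eClass_eq hb h2 ((G.edge_bar _).trans (G.edge_bar _))
    rw [Hom.inc_congr (G.bar_bar _) _ _ rfl h'] at hk
    have h3 : s.lact h⁻¹ = (R.a x).comp (.ofVertex (r.vhom x l * r.δ' e hτ)) := by
      rw [← PathClass.comp_ofVertex_ofVertex, ← R.valV_a, hl, PathClass.mul_lact,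
        ← PathClass.lact_comp, ← PathClass.lact_comp, ← ht, PathClass.inv_lact_lact]
    rw [h3, PathClass.comp_ofVertex_ofVertex] at hk
    exact ⟨e, hτ, l, k, rfl, PathClass.comp_ofVertex_cancel _ hk⟩

/-- The lifts to the tree of a path of `H \ T` and of its image end at the same vertex. -/
theorem holonomy_lact (R : D.Representatives r) {x y : D.quotient.V} (c : Path D.quotient x y) :
    (R.a y).lact (D.holonomy tree_connected c : PiOne G p) =
      (R.a x).comp (r.onClass rfl rfl (PathClass.mk c)) := by
  induction c with
  | single l => exact R.valV_a _ l
  | @cons v u w l e hv hu γ ih =>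
    subst hv hu
    have h1 : (R.a (D.quotient.τ e)).lact (D.tVal e)⁻¹ =
        (R.s e).comp (.ofVertex (r.delta e rfl)⁻¹) := by
      refine PathClass.comp_right_cancel (.ofVertex (r.delta e rfl)) ?_
      rw [← PathClass.lact_comp, PathClass.comp_ofVertex_ofVertex, inv_mul_cancel,
        PathClass.comp_one]
      refine (congrArg (PathClass.lact _) (R.t_s e).symm).trans (PathClass.inv_lact_lact _ _)
    have h2 : (D.holonomy tree_connected (.cons l e rfl rfl γ) : PiOne G p) =
        D.valV _ l * (D.tVal (D.quotient.bar e) * (D.tVal e)⁻¹) *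
          (D.holonomy tree_connected γ : PiOne G p) := rfl
    have h3 : (R.s (D.quotient.bar e)).lact (D.tVal (D.quotient.bar e)) =
        (R.a _).comp (.ofVertex (r.delta (D.quotient.bar e) rfl)) := R.t_s _
    -- For the edge the computation is `t_ē t_e⁻¹ a = t_ē s_e δ_e⁻¹ = t_ē s_ē e δ_e⁻¹ = a δ_ē e
    -- δ_e⁻¹`, where the first `a` is at the end of `e` and the last at its start; this is `a`
    -- followed by the image of `e`.
    rw [h2, PathClass.mul_lact, ih, PathClass.lact_comp, PathClass.mul_lact, PathClass.mul_lact, h1,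
      PathClass.lact_comp, R.s_eq, PathClass.lact_comp, PathClass.lact_comp, h3, PathClass.lact_comp,
      PathClass.lact_comp, R.valV_a, PathClass.mk_cons, r.onClass_comp rfl rfl rfl,
      r.onClass_comp rfl rfl rfl, r.onClass_ofVertex,
      r.onClass_ofEdge rfl rfl rfl rfl rfl (r.τ_bar_onE rfl) (r.τ_onE e) rfl rfl]
    simp only [PathClass.comp_assoc]
    rfl

theorem isInduced (R : D.Representatives r) (hb : r.onV D.base = p) : D.IsInduced r hb where
  onV x := by
    obtain ⟨h, hh⟩ := D.vertT_orbit x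
    exact (R.onV _).trans ((congrArg projV hh.symm).trans (projV_smul (h : PiOne G p) x))
  onE e := by
    obtain ⟨h, hh⟩ := D.edgeT_orbit e
    exact (R.onE _).trans ((congrArg projE hh.symm).trans (projE_smul (h : PiOne G p) e))
  loop c := by
    refine PathClass.lact_right_cancel (α := R.a D.base) ?_
    rw [R.holonomy_lact]
    refine Eq.trans ?_ (r.onClass_comp_eq hb R.a_base _)
    exact congrArg (fun γ : PiOne G p => (R.a D.base).lact γ) (r.mapPiOne_eq hb _)
  path x c := by
    rw [r.mapClass_eq, r.onClass_eq_comp hb R.a_base, ← R.holonomy_lact]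
    exact congrArg (fun X => (D.holonomy tree_connected c : PiOne G p) • X) (R.vClass_a x)

/-- Loops map to their holonomy, which lies in `H`. Conversely, lift `γ ∈ H` to a path `c` ending at
`x`, with holonomy `h`. Then `h⁻¹ γ ∈ H` carries the base vertex of `T` to the lift of `x`, so `x`
is the basepoint and `h⁻¹ γ` belongs to its vertex group. Appending it to `c` gives a loop with
image `γ`. -/
theorem subgroup_eq (R : D.Representatives r) (hr : r.IsCovering) (hb : r.onV D.base = p) :
    (⟨D.quotient, D.base, r, hr, hb⟩ : PointedCovering G p).subgroup = H := by
  have hloop : ∀ c : Path D.quotient D.base D.base, r.onClass hb hb (PathClass.mk c) =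
      (D.holonomy tree_connected c : PiOne G p) := by
    intro c
    exact (r.mapPiOne_eq hb _).symm.trans ((R.isInduced hb).loop c)
  refine le_antisymm (fun γ hγ => ?_) (fun γ hγ => ?_)
  · obtain ⟨η, rfl⟩ := PointedCovering.mem_subgroup.1 hγ
    induction η using Quotient.inductionOn with
    | _ c =>
      have := (D.holonomy tree_connected c).2
      rw [← hloop c] at this
      exact this
  · obtain ⟨x, hx, α, g, hg⟩ := hr.exists_lift hb (show PathClass G p p from γ)
    induction α using Quotient.inductionOn with
    | _ c =>
      change _ = (r.onClass hb hx (PathClass.mk c)).comp _ at hg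
      obtain ⟨⟨h, hH⟩, hh⟩ : ∃ h, h = D.holonomy tree_connected c := ⟨_, rfl⟩
      have h1 : h • D.vertT x = γ • vClass (.ofVertex 1) := by
        have h2 : ∀ {w : G.V} (hx : r.onV x = w),
            vClass (r.onClass hb hx (PathClass.mk c)) = h • D.vertT x := by
          rintro _ rfl
          rw [r.onClass_eq_comp hb R.a_base, ← R.holonomy_lact, ← hh, ← smul_vClass, R.vClass_a]
        rw [← h2 hx, smul_vClass]
        have h3 : PathClass.lact γ (.ofVertex 1) =
          (r.onClass hb hx (PathClass.mk c)).comp (.ofVertex g) := (PathClass.comp_one _).trans hg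
        rw [h3]
        exact (treeVertex_comp _ _).symm
      have hmem : h⁻¹ * γ ∈ H := H.mul_mem (H.inv_mem hH) hγ
      have h2 : (h⁻¹ * γ) • vClass (.ofVertex 1) = D.vertT x := by
        rw [mul_smul, ← h1, inv_smul_smul]
      obtain rfl : x = D.base := by
        rw [← D.vert_spec x]
        exact (orbitV_eq_iff _).2 ⟨⟨_, hmem⟩, h2⟩
      rw [← vertT_base D] at h2
      obtain ⟨l, hl⟩ := D.exists_valV hmem h2
      refine PointedCovering.mem_subgroup.2 ⟨(PathClass.mk c).comp (.ofVertex l), ?_⟩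
      refine (r.onClass_comp hb hb hb _ _).trans ?_
      have h4 : r.onClass hb hb (.ofVertex l) = D.valV _ l := hloop (.single l)
      rw [hloop c, h4, hl, ← hh]
      exact mul_inv_cancel_left h γ

end Representatives

end QuotientLifts

end GraphOfGroups
end BassSerre

/-! ### The Galois correspondence -/

theorem mainTheorem9 (G : GraphOfGroups.{u}) (p : G.V) :
    (∀ C₁ C₂ : PointedCovering G p,
      C₁.subgroup = C₂.subgroup ↔ ∃ f : Hom C₁.L C₂.L, f.IsIso ∧ C₁.IsOver C₂ f) ∧
    (∀ C₁ C₂ : PointedCovering G p,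
      C₁.subgroup ≤ C₂.subgroup ↔ ∃ f : Hom C₁.L C₂.L, f.IsCovering ∧ C₁.IsOver C₂ f) ∧
    (∀ H : Subgroup (PiOne G p),
      Nonempty (QuotientLifts H) ∧
      ∀ D : QuotientLifts H,
        ∃ (r : Hom D.quotient G) (hr : r.IsCovering) (hb : r.onV D.base = p),
          D.IsInduced r hb ∧
          (⟨D.quotient, D.base, r, hr, hb⟩ : PointedCovering G p).subgroup = H ∧
          ∀ C : PointedCovering G p, C.subgroup = H →
            ∃ f : Hom C.L D.quotient, f.IsIso ∧ C.IsOver ⟨D.quotient, D.base, r, hr, hb⟩ f) := by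
  have iso : ∀ C₁ C₂ : PointedCovering G p, C₁.subgroup = C₂.subgroup →
      ∃ f : Hom C₁.L C₂.L, f.IsIso ∧ C₁.IsOver C₂ f := by
    intro C₁ C₂ h
    obtain ⟨f, hf, hf'⟩ := PointedCovering.exists_hom_of_le h.le
    -- One inclusion of subgroups produces the covering map, and the other makes it an isomorphism.
    exact ⟨f, hf'.isIso hf h.ge, hf'⟩
  refine ⟨fun C₁ C₂ => ⟨iso C₁ C₂, ?_⟩,
    fun C₁ C₂ => ⟨PointedCovering.exists_hom_of_le, ?_⟩, fun H => ⟨nonempty_orbitLifts _ _, ?_⟩⟩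
  · rintro ⟨f, hf, hf'⟩
    exact hf'.subgroup_eq hf
  · rintro ⟨f, -, hf⟩
    exact hf.subgroup_le
  · intro D
    obtain ⟨r, ⟨R⟩⟩ := D.exists_representatives
    have hb : r.onV D.base = p := congrArg Sigma.fst R.a_base
    have hH := R.subgroup_eq R.isCovering hb
    exact ⟨r, R.isCovering, hb, R.isInduced hb, hH, fun C hC => iso C _ (hC.trans hH.symm)⟩
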